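/- Let $d\ge 1$, $\rho_1\ge 0$, $\rho_2>1$, $\sigma=\rho_1+\rho_2-1$, $s\ge\sigma$, $t\ge\rho_2$. For $a,b\ge 0$ the Gelfand–Shilov space $\mathcal S^{a}_{b}(\mathbb R^d)$ consists of the Schwartz functions $\varphi:\mathbb R^d\to\mathbb C$ such that, for some $h>0$, $$p_h^{a,b}(\varphi)=\sup_{x\in\mathbb R^d,\ \alpha,\beta\in\mathbb N^d}\frac{h^{|\alpha+\beta|}}{\alpha!^{b}\,\beta!^{a}}\,|x^\alpha\partial^\beta\varphi(x)|<\infty ,$$ with the locally convex inductive limit topology (over $h>0$) of the normed spaces $\{p_h^{a,b}<\infty\}$. Its topological dual $(\mathcal S^{a}_{b}(\mathbb R^d))'$ carries the strong topology (uniform convergence on bounded sets). A multiresolution analysis (MRA) is an increasing sequence $\{V_m\}_{m\in\mathbb Z}$ of closed subspaces of $L^2(\mathbb R^d)$ with: (a) $\bigcap_m V_m=\{0\}$ and $\bigcup_m V_m$ is dense in $L^2(\mathbb R^d)$; (b) $f(x)\in V_m\Leftrightarrow f(2x)\in V_{m+1}$, $m\in\mathbb Z$; (c) $f(x)\in V_0\Leftrightarrow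 f(x-n)\in V_0$, $n\in\mathbb Z^d$; (d) there is a scaling function, i.e. $\phi\in L^2(\mathbb R^d)$ such that $\{\phi(\cdot-n)\}_{n\in\mathbb Z^d}$ is an orthonormal basis of $V_0$. It is called $(\rho_1,\rho_2)$-regular if it has a scaling function in $\mathcal S^{\rho_1}_{\rho_2}(\mathbb R^d)$. Let $\{V_m\}_{m\in\mathbb Z}$ be a $(\rho_1,\rho_2)$-regular MRA with scaling function $\phi\in\mathcal S^{\rho_1}_{\rho_2}(\mathbb R^d)$ and set $$q_0(x,y)=\sum_{k\in\mathbb Z^d}\phi(x-k)\overline{\phi(y-k)},\qquad q_m(x,y)=2^{md}q_0(2^mx,2^my),\qquad x,y\in\mathbb R^d,\ m\in\mathbb Z.$$ (i) Let $\varphi\in\mathcal S^{s-\sigma}_{t}(\mathbb R^d)$ and, for $m\in\mathbb Z$, let $q_m\varphi$ be its orthogonal projection onto $V_m$, given by $(q_m\varphi)(x)=\int_{\mathbb R^d}\varphi(y)\,q_m(x,y)\,dy$. Then $q_m\varphi\in\mathcal S^{s}_{t}(\mathbb R^d)$ for every $m\in\mathbb Z$, and $$\lim_{m\to\infty}q_m\varphi=\varphi\quad\text{in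 }\mathcal S^{s}_{t}(\mathbb R^d).$$ (ii) For all $m\in\mathbb Z$ and $x\in\mathbb R^d$ one has $q_m(x,\cdot)\in\mathcal S^{s}_{t}(\mathbb R^d)$. Let $f\in(\mathcal S^{s}_{t}(\mathbb R^d))'$ and set $(q_mf)(x)=\langle f(y),q_m(x,y)\rangle$. Then, for every $m\in\mathbb Z$, the formula $\langle q_mf,\psi\rangle=\int_{\mathbb R^d}(q_mf)(x)\,\psi(x)\,dx$, $\psi\in\mathcal S^{s-\sigma}_{t}(\mathbb R^d)$, with absolutely convergent integrals, defines an element of $(\mathcal S^{s-\sigma}_{t}(\mathbb R^d))'$, and $$\lim_{m\to\infty}q_mf=f\quad\text{in }(\mathcal S^{s-\sigma}_{t}(\mathbb R^d))',$$ where $f$ on the right-hand side denotes the restriction of $f$ to $\mathcal S^{s-\sigma}_{t}(\mathbb R^d)\subseteq\mathcal S^{s}_{t}(\mathbb R^d)$. -/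

import Mathlib

open MeasureTheory Filter Topology
open scoped SchwartzMap ENNReal InnerProductSpace

noncomputable section

namespace GelfandShilovMRA

/-- The Euclidean space `ℝ^d`. -/
abbrev Rd (d : ℕ) : Type := EuclideanSpace ℝ (Fin d)

/-- The Hilbert space `L²(ℝ^d)` of complex-valued functions, with Lebesgue measure. -/
abbrev L2 (d : ℕ) : Type := Lp ℂ 2 (volume : Measure (Rd d))

/-! ### Multi-index notation -/

/-- `α! = ∏ i, (α i)!`, as a real number. -/
def mfactorial {d : ℕ} (α : Fin d → ℕ) : ℝ := ∏ i, (Nat.factorial (α i) : ℝ)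

/-- `x^α = ∏ i, (x i)^(α i)`. -/
def monomial {d : ℕ} (α : Fin d → ℕ) (x : Rd d) : ℝ := ∏ i, x i ^ α i

/-- `∂^β = ∂₁^(β 1) ⋯ ∂_d^(β d)` on the Schwartz space, as a product (composition) of powers of
the partial derivatives `∂ᵢ`, the derivatives in the direction of the standard basis vectors. -/
def partialDeriv {d : ℕ} (β : Fin d → ℕ) : 𝓢(Rd d, ℂ) →L[ℂ] 𝓢(Rd d, ℂ) :=
  ((List.finRange d).map fun i =>
    (LineDeriv.lineDerivOpCLM ℂ 𝓢(Rd d, ℂ) (EuclideanSpace.single i (1 : ℝ))) ^ β i).prod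

theorem mfactorial_pos {d : ℕ} (α : Fin d → ℕ) : 0 < mfactorial α :=
  Finset.prod_pos fun i _ => by exact_mod_cast Nat.factorial_pos (α i)

theorem one_le_mfactorial {d : ℕ} (α : Fin d → ℕ) : 1 ≤ mfactorial α := by
  have h : ∏ _i : Fin d, (1 : ℝ) ≤ mfactorial α :=
    Finset.prod_le_prod (fun _ _ => zero_le_one)
      fun i _ => by exact_mod_cast Nat.factorial_pos (α i)
  simpa using h

/-! ### Gelfand-Shilov spaces -/

/-- The norm
`p_h(φ) = sup_{x, α, β} h^|α+β| / (α!^ρ₂ β!^ρ₁) |x^α ∂^β φ(x)|`, with values in `[0, ∞]`. -/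
def gsNorm {d : ℕ} (ρ₁ ρ₂ h : ℝ) (φ : 𝓢(Rd d, ℂ)) : ℝ≥0∞ :=
  ⨆ (x : Rd d) (α : Fin d → ℕ) (β : Fin d → ℕ),
    ENNReal.ofReal (h ^ (∑ i, (α i + β i)) / (mfactorial α ^ ρ₂ * mfactorial β ^ ρ₁)
      * ‖(monomial α x : ℂ) * partialDeriv β φ x‖)

theorem gsNorm_le_iff {d : ℕ} {ρ₁ ρ₂ h : ℝ} {φ : 𝓢(Rd d, ℂ)} {C : ℝ≥0∞} :
    gsNorm ρ₁ ρ₂ h φ ≤ C ↔ ∀ (x : Rd d) (α β : Fin d → ℕ),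
      ENNReal.ofReal (h ^ (∑ i, (α i + β i)) / (mfactorial α ^ ρ₂ * mfactorial β ^ ρ₁)
        * ‖(monomial α x : ℂ) * partialDeriv β φ x‖) ≤ C := by
  simp only [gsNorm, iSup_le_iff]

theorem le_gsNorm {d : ℕ} (ρ₁ ρ₂ h : ℝ) (φ : 𝓢(Rd d, ℂ)) (x : Rd d) (α β : Fin d → ℕ) :
    ENNReal.ofReal (h ^ (∑ i, (α i + β i)) / (mfactorial α ^ ρ₂ * mfactorial β ^ ρ₁)
      * ‖(monomial α x : ℂ) * partialDeriv β φ x‖) ≤ gsNorm ρ₁ ρ₂ h φ :=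
  gsNorm_le_iff.1 le_rfl x α β

theorem gsNorm_zero {d : ℕ} (ρ₁ ρ₂ h : ℝ) : gsNorm ρ₁ ρ₂ h (0 : 𝓢(Rd d, ℂ)) = 0 := by
  simp [gsNorm]

theorem gsNorm_mono {d : ℕ} {ρ₁ ρ₂ h h' : ℝ} (h0 : 0 < h) (hh : h ≤ h') (φ : 𝓢(Rd d, ℂ)) :
    gsNorm ρ₁ ρ₂ h φ ≤ gsNorm ρ₁ ρ₂ h' φ := by
  refine gsNorm_le_iff.2 fun x α β => le_trans (ENNReal.ofReal_le_ofReal ?_)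
    (le_gsNorm ρ₁ ρ₂ h' φ x α β)
  have := mfactorial_pos α
  have := mfactorial_pos β
  gcongr

theorem gsNorm_index_mono {d : ℕ} {ρ₁ ρ₂ r₁ r₂ h : ℝ} (h0 : 0 < h) (h₁ : ρ₁ ≤ r₁) (h₂ : ρ₂ ≤ r₂)
    (φ : 𝓢(Rd d, ℂ)) : gsNorm r₁ r₂ h φ ≤ gsNorm ρ₁ ρ₂ h φ := by
  refine gsNorm_le_iff.2 fun x α β => le_trans (ENNReal.ofReal_le_ofReal ?_)
    (le_gsNorm ρ₁ ρ₂ h φ x α β)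
  have := mfactorial_pos α
  have := mfactorial_pos β
  have := one_le_mfactorial α
  have := one_le_mfactorial β
  gcongr

theorem gsNorm_add_le {d : ℕ} {ρ₁ ρ₂ h : ℝ} (h0 : 0 < h) (φ ψ : 𝓢(Rd d, ℂ)) :
    gsNorm ρ₁ ρ₂ h (φ + ψ) ≤ gsNorm ρ₁ ρ₂ h φ + gsNorm ρ₁ ρ₂ h ψ := by
  refine gsNorm_le_iff.2 fun x α β => le_trans ?_
    (add_le_add (le_gsNorm ρ₁ ρ₂ h φ x α β) (le_gsNorm ρ₁ ρ₂ h ψ x α β))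
  have := mfactorial_pos α
  have := mfactorial_pos β
  rw [← ENNReal.ofReal_add (by positivity) (by positivity), ← mul_add]
  refine ENNReal.ofReal_le_ofReal (mul_le_mul_of_nonneg_left ?_ (by positivity))
  rw [map_add, add_apply, mul_add]
  exact norm_add_le _ _

theorem gsNorm_smul_le {d : ℕ} {ρ₁ ρ₂ h : ℝ} (c : ℂ) (φ : 𝓢(Rd d, ℂ)) :
    gsNorm ρ₁ ρ₂ h (c • φ) ≤ ENNReal.ofReal ‖c‖ * gsNorm ρ₁ ρ₂ h φ := by
  refine gsNorm_le_iff.2 fun x α β => le_trans (le_of_eq ?_)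
    (mul_le_mul_right (le_gsNorm ρ₁ ρ₂ h φ x α β) _)
  rw [← ENNReal.ofReal_mul (norm_nonneg c), map_smul, smul_apply]
  congr 1
  simp only [norm_mul, smul_eq_mul]
  ring

/-- The linear subspace of the Schwartz functions `φ` with `p_h(φ) < ∞` for some `h > 0`. -/
def gsSubmodule (ρ₁ ρ₂ : ℝ) (d : ℕ) : Submodule ℂ 𝓢(Rd d, ℂ) where
  carrier := {φ | ∃ h : ℝ, 0 < h ∧ gsNorm ρ₁ ρ₂ h φ ≠ ∞}
  zero_mem' := ⟨1, one_pos, by rw [gsNorm_zero]; exact ENNReal.zero_ne_top⟩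
  add_mem' := by
    rintro φ ψ ⟨h, h0, hφ⟩ ⟨k, k0, hψ⟩
    refine ⟨min h k, lt_min h0 k0, ne_top_of_le_ne_top (ENNReal.add_ne_top.2 ⟨hφ, hψ⟩) ?_⟩
    exact (gsNorm_add_le (lt_min h0 k0) φ ψ).trans
      (add_le_add (gsNorm_mono (lt_min h0 k0) (min_le_left _ _) φ)
        (gsNorm_mono (lt_min h0 k0) (min_le_right _ _) ψ))
  smul_mem' := by
    rintro c φ ⟨h, h0, hφ⟩
    exact ⟨h, h0, ne_top_of_le_ne_top (ENNReal.mul_ne_top ENNReal.ofReal_ne_top hφ)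
      (gsNorm_smul_le c φ)⟩

/-- The Gelfand-Shilov space `𝒮^{ρ₁}_{ρ₂}(ℝ^d)` (upper index: regularity, lower index: decay).
It is a type of its own, so that it carries its inductive limit topology, and not the one
induced by the Schwartz space. -/
@[ext]
structure GelfandShilov (ρ₁ ρ₂ : ℝ) (d : ℕ) where
  /-- The underlying Schwartz function. -/
  toSchwartz : 𝓢(Rd d, ℂ)
  mem : toSchwartz ∈ gsSubmodule ρ₁ ρ₂ d

namespace GelfandShilov

variable {ρ₁ ρ₂ : ℝ} {d : ℕ}

instance : CoeFun (GelfandShilov ρ₁ ρ₂ d) fun _ => Rd d → ℂ := ⟨fun φ => φ.toSchwartz⟩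

instance : Zero (GelfandShilov ρ₁ ρ₂ d) := ⟨⟨0, Submodule.zero_mem _⟩⟩

instance : Add (GelfandShilov ρ₁ ρ₂ d) :=
  ⟨fun φ ψ => ⟨φ.toSchwartz + ψ.toSchwartz, Submodule.add_mem _ φ.mem ψ.mem⟩⟩

instance : Neg (GelfandShilov ρ₁ ρ₂ d) := ⟨fun φ => ⟨-φ.toSchwartz, Submodule.neg_mem _ φ.mem⟩⟩

instance : Sub (GelfandShilov ρ₁ ρ₂ d) :=
  ⟨fun φ ψ => ⟨φ.toSchwartz - ψ.toSchwartz, Submodule.sub_mem _ φ.mem ψ.mem⟩⟩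

instance : SMul ℕ (GelfandShilov ρ₁ ρ₂ d) :=
  ⟨fun n φ => ⟨n • φ.toSchwartz, nsmul_mem φ.mem n⟩⟩

instance : SMul ℤ (GelfandShilov ρ₁ ρ₂ d) :=
  ⟨fun n φ => ⟨n • φ.toSchwartz, zsmul_mem φ.mem n⟩⟩

instance : SMul ℂ (GelfandShilov ρ₁ ρ₂ d) :=
  ⟨fun c φ => ⟨c • φ.toSchwartz, Submodule.smul_mem _ c φ.mem⟩⟩

theorem toSchwartz_injective :
    Function.Injective (toSchwartz : GelfandShilov ρ₁ ρ₂ d → 𝓢(Rd d, ℂ)) :=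
  fun _ _ h => GelfandShilov.ext h

instance : AddCommGroup (GelfandShilov ρ₁ ρ₂ d) :=
  toSchwartz_injective.addCommGroup _ rfl (fun _ _ => rfl) (fun _ => rfl) (fun _ _ => rfl)
    (fun _ _ => rfl) fun _ _ => rfl

@[simp] theorem toSchwartz_zero : (0 : GelfandShilov ρ₁ ρ₂ d).toSchwartz = 0 := rfl

@[simp] theorem toSchwartz_add (φ ψ : GelfandShilov ρ₁ ρ₂ d) :
    (φ + ψ).toSchwartz = φ.toSchwartz + ψ.toSchwartz := rfl

@[simp] theorem toSchwartz_smul (c : ℂ) (φ : GelfandShilov ρ₁ ρ₂ d) :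
    (c • φ).toSchwartz = c • φ.toSchwartz := rfl

instance : Module ℂ (GelfandShilov ρ₁ ρ₂ d) :=
  toSchwartz_injective.module ℂ
    { toFun := toSchwartz, map_zero' := toSchwartz_zero, map_add' := toSchwartz_add }
    toSchwartz_smul

end GelfandShilov

/-- The seminorms on `𝒮^{ρ₁}_{ρ₂}(ℝ^d)` whose restriction to each of the normed spaces
`{φ | p_h(φ) < ∞}`, `h > 0`, is continuous. -/
def stepContinuousSeminorms (ρ₁ ρ₂ : ℝ) (d : ℕ) : Set (Seminorm ℂ (GelfandShilov ρ₁ ρ₂ d)) :=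
  {q | ∀ h : ℝ, 0 < h → ∃ C : ℝ, ∀ φ : GelfandShilov ρ₁ ρ₂ d,
    gsNorm ρ₁ ρ₂ h φ.toSchwartz ≠ ∞ → q φ ≤ C * (gsNorm ρ₁ ρ₂ h φ.toSchwartz).toReal}

/-- The family of all seminorms that are continuous on each step. -/
def gsSeminorms (ρ₁ ρ₂ : ℝ) (d : ℕ) :
    SeminormFamily ℂ (GelfandShilov ρ₁ ρ₂ d) (stepContinuousSeminorms ρ₁ ρ₂ d) :=
  fun q => q.1

/-- The canonical (locally convex) inductive limit topology of `𝒮^{ρ₁}_{ρ₂}(ℝ^d)`, that is, the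
finest locally convex vector space topology for which the inclusions of all the normed spaces
`{φ | p_h(φ) < ∞}`, `h > 0`, are continuous: it is generated by all the seminorms whose
restrictions to these spaces are continuous. -/
instance (ρ₁ ρ₂ : ℝ) (d : ℕ) : TopologicalSpace (GelfandShilov ρ₁ ρ₂ d) :=
  (gsSeminorms ρ₁ ρ₂ d).moduleFilterBasis.topology

theorem gs_withSeminorms (ρ₁ ρ₂ : ℝ) (d : ℕ) : WithSeminorms (gsSeminorms ρ₁ ρ₂ d) := ⟨rfl⟩

instance (ρ₁ ρ₂ : ℝ) (d : ℕ) : IsTopologicalAddGroup (GelfandShilov ρ₁ ρ₂ d) :=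
  (gs_withSeminorms ρ₁ ρ₂ d).topologicalAddGroup

instance (ρ₁ ρ₂ : ℝ) (d : ℕ) : ContinuousSMul ℂ (GelfandShilov ρ₁ ρ₂ d) :=
  (gs_withSeminorms ρ₁ ρ₂ d).continuousSMul

/-- The inclusion `𝒮^{ρ₁}_{ρ₂}(ℝ^d) → 𝒮^{r₁}_{r₂}(ℝ^d)` for `ρ₁ ≤ r₁`, `ρ₂ ≤ r₂`:
`φ` is sent to the same function. -/
def inclusionLinear {ρ₁ ρ₂ r₁ r₂ : ℝ} {d : ℕ} (h₁ : ρ₁ ≤ r₁) (h₂ : ρ₂ ≤ r₂) :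
    GelfandShilov ρ₁ ρ₂ d →ₗ[ℂ] GelfandShilov r₁ r₂ d where
  toFun φ := ⟨φ.toSchwartz, by
    obtain ⟨h, h0, hφ⟩ := φ.mem
    exact ⟨h, h0, ne_top_of_le_ne_top hφ (gsNorm_index_mono h0 h₁ h₂ φ.toSchwartz)⟩⟩
  map_add' _ _ := rfl
  map_smul' _ _ := rfl

theorem toSchwartz_inclusionLinear {ρ₁ ρ₂ r₁ r₂ : ℝ} {d : ℕ} (h₁ : ρ₁ ≤ r₁) (h₂ : ρ₂ ≤ r₂)
    (φ : GelfandShilov ρ₁ ρ₂ d) : (inclusionLinear h₁ h₂ φ).toSchwartz = φ.toSchwartz := rfl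

theorem comp_inclusionLinear_mem {ρ₁ ρ₂ r₁ r₂ : ℝ} {d : ℕ} (h₁ : ρ₁ ≤ r₁) (h₂ : ρ₂ ≤ r₂)
    {q : Seminorm ℂ (GelfandShilov r₁ r₂ d)} (hq : q ∈ stepContinuousSeminorms r₁ r₂ d) :
    q.comp (inclusionLinear h₁ h₂) ∈ stepContinuousSeminorms ρ₁ ρ₂ d := by
  intro h h0
  obtain ⟨C, hC⟩ := hq h h0
  refine ⟨max C 0, fun φ hφ => ?_⟩
  have hle : gsNorm r₁ r₂ h ((inclusionLinear h₁ h₂ φ).toSchwartz) ≤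
      gsNorm ρ₁ ρ₂ h φ.toSchwartz := by
    rw [toSchwartz_inclusionLinear]
    exact gsNorm_index_mono h0 h₁ h₂ _
  rw [Seminorm.comp_apply]
  refine (hC _ (ne_top_of_le_ne_top hφ hle)).trans ?_
  exact mul_le_mul (le_max_left _ _) (ENNReal.toReal_mono hφ hle) ENNReal.toReal_nonneg
    (le_max_right _ _)

theorem continuous_of_mem_stepContinuousSeminorms {ρ₁ ρ₂ : ℝ} {d : ℕ}
    {q : Seminorm ℂ (GelfandShilov ρ₁ ρ₂ d)} (hq : q ∈ stepContinuousSeminorms ρ₁ ρ₂ d) :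
    Continuous q :=
  (gs_withSeminorms ρ₁ ρ₂ d).continuous_seminorm ⟨q, hq⟩

theorem continuous_inclusionLinear {ρ₁ ρ₂ r₁ r₂ : ℝ} {d : ℕ} (h₁ : ρ₁ ≤ r₁) (h₂ : ρ₂ ≤ r₂) :
    Continuous (inclusionLinear (d := d) h₁ h₂) :=
  (gs_withSeminorms r₁ r₂ d).continuous_of_continuous_comp (inclusionLinear h₁ h₂)
    fun q => continuous_of_mem_stepContinuousSeminorms (comp_inclusionLinear_mem h₁ h₂ q.2)

/-- The inclusion `𝒮^{ρ₁}_{ρ₂}(ℝ^d) → 𝒮^{r₁}_{r₂}(ℝ^d)` as a continuous linear map. -/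
def inclusion {ρ₁ ρ₂ r₁ r₂ : ℝ} {d : ℕ} (h₁ : ρ₁ ≤ r₁) (h₂ : ρ₂ ≤ r₂) :
    GelfandShilov ρ₁ ρ₂ d →L[ℂ] GelfandShilov r₁ r₂ d where
  toLinearMap := inclusionLinear h₁ h₂
  cont := continuous_inclusionLinear h₁ h₂

theorem toSchwartz_inclusion {ρ₁ ρ₂ r₁ r₂ : ℝ} {d : ℕ} (h₁ : ρ₁ ≤ r₁) (h₂ : ρ₂ ≤ r₂)
    (φ : GelfandShilov ρ₁ ρ₂ d) : (inclusion h₁ h₂ φ).toSchwartz = φ.toSchwartz := rfl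

/-- The topological dual `(𝒮^{ρ₁}_{ρ₂}(ℝ^d))'`: continuous linear functionals, with the strong
topology of uniform convergence on bounded sets. -/
abbrev GSDual (ρ₁ ρ₂ : ℝ) (d : ℕ) : Type := GelfandShilov ρ₁ ρ₂ d →L[ℂ] ℂ

/-! ### Multiresolution analyses -/

/-- The point `n ∈ ℤ^d` of `ℝ^d`. -/
def latticePoint {d : ℕ} (n : Fin d → ℤ) : Rd d := WithLp.toLp 2 fun i => (n i : ℝ)

/-- `φ` is a scaling function for `V`: the translates `φ(x - n)`, `n ∈ ℤ^d`, (belong to `L²` and)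
form an orthonormal basis of `V 0`. -/
def IsScalingFunction {d : ℕ} (V : ℤ → Submodule ℂ (L2 d)) (φ : Rd d → ℂ) : Prop :=
  ∃ e : (Fin d → ℤ) → L2 d,
    (∀ n, e n =ᵐ[volume] fun x => φ (x - latticePoint n)) ∧
    Orthonormal ℂ e ∧
    (Submodule.span ℂ (Set.range e)).topologicalClosure = V 0

/-- `V` is a multiresolution analysis of `L²(ℝ^d)`. -/
structure IsMRA {d : ℕ} (V : ℤ → Submodule ℂ (L2 d)) : Prop where
  isClosed : ∀ m, IsClosed (V m : Set (L2 d))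
  monotone : Monotone V
  iInf_eq_bot : ⨅ m, V m = ⊥
  dense_iUnion : Dense (⋃ m, (V m : Set (L2 d)))
  /-- `f(x) ∈ V m ↔ f(2x) ∈ V (m + 1)` -/
  dilation : ∀ (m : ℤ) (f g : L2 d), (g =ᵐ[volume] fun x => f ((2 : ℝ) • x)) →
    (f ∈ V m ↔ g ∈ V (m + 1))
  /-- `f(x) ∈ V 0 ↔ f(x - n) ∈ V 0` -/
  translation : ∀ (n : Fin d → ℤ) (f g : L2 d), (g =ᵐ[volume] fun x => f (x - latticePoint n)) →
    (f ∈ V 0 ↔ g ∈ V 0)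
  exists_scalingFunction : ∃ φ : Rd d → ℂ, MemLp φ 2 volume ∧ IsScalingFunction V φ

/-- The kernel `q₀(x, y) = ∑_{k ∈ ℤ^d} φ(x - k) conj(φ(y - k))`. -/
def kernelZero {d : ℕ} (φ : Rd d → ℂ) (x y : Rd d) : ℂ :=
  ∑' k : Fin d → ℤ, φ (x - latticePoint k) * starRingEnd ℂ (φ (y - latticePoint k))

/-- The kernel `q_m(x, y) = 2^{md} q₀(2^m x, 2^m y)`. -/
def kernel {d : ℕ} (φ : Rd d → ℂ) (m : ℤ) (x y : Rd d) : ℂ :=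
  (2 : ℂ) ^ (m * (d : ℤ)) * kernelZero φ ((2 : ℝ) ^ m • x) ((2 : ℝ) ^ m • y)

/-- `u` is the orthogonal projection of `f` onto the subspace `W` of `L²(ℝ^d)`. -/
def IsOrthogonalProjection {d : ℕ} (W : Submodule ℂ (L2 d)) (f u : L2 d) : Prop :=
  u ∈ W ∧ f - u ∈ Wᗮ

theorem sub_le_of_regular {ρ₁ ρ₂ σ : ℝ} (hρ₁ : 0 ≤ ρ₁) (hρ₂ : 1 < ρ₂) (hσ : σ = ρ₁ + ρ₂ - 1)
    (s : ℝ) : s - σ ≤ s := by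
  linarith

end GelfandShilovMRA

end

/-!
The projection onto `V 0` is the integral operator with kernel `q₀`, because the translates of the
scaling function `φ` form an orthonormal basis of `V 0`; the projection onto `V m` is its conjugate
by the dilation by `2^m`. Everything rests on an estimate of `q_m f - f` in a single step of the
inductive limit, with rate `2^{-m}`. Steps are described by the radial weights `wt`, in terms of
which `IsGSBound` restates the norms `gsNorm`.

The estimate comes from the moments of the kernel. Write `K_u(w) = ∂_x^α q₀(u, u + w)`, for a
multi-index `α` of length `n`, so that
`∂^α (q_m f)(x) = 2^{mn} ∫ f(x + 2^{-m} w) K_u(w) dw` with `u = 2^m x`. The integral of the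
directional derivatives `∂_w^j f(x)` of order `j` against `K_u(w)` is a constant coefficient
differential operator applied to `f`, with symbol `momentPoly K_u j`. The claim is that it vanishes
for `j < n` and equals `n! ∂^α` for `j = n`.

For the scaling function this is `polyDeriv_momentPoly_scalingFunction`. Since `φ ∈ V 0 ⊆ V m`, the
function `φ` is reproduced by the projections onto all `V m`, `m ≥ 0`. The identity
`∂^α φ(x) = 2^{mn} ∫ φ(x + 2^{-m} w) K_u(w) dw` then holds whenever `2^m x ∈ u + ℤ^d`, as `K_u` is
`ℤ^d`-periodic in `u`. Points `x` of this form approximate every point of `ℝ^d` as `m → ∞`, and a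
comparison of the powers of `2^{-m}` in Taylor's formula yields the claim for `φ`. A constant
coefficient operator that annihilates `φ ≠ 0` is zero, since the Fourier transform of `φ` does not
vanish on some open set; this yields the claim for all `f`
(`polyDeriv_momentPoly_centredKernel`).

Hence `∂^α (q_m f - f)(x)` is `2^{mn}` times the integral of the Taylor remainder of order `n + 1`,
which is `O(2^{-m(n+1)})`. The constants are `n!^ρ₁` for the derivatives of the kernel,
`(n+1)!^ρ₂` for its moments of order `n + 1`, `1/n!` in Taylor's formula and `(n+1)!^(s-σ)` for the
derivatives of `f`. Up to a geometric factor, their product is `n!^s`, because `σ = ρ₁ + ρ₂ - 1`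
(`exists_isGSBound_sub`). This gives the convergence for test functions.

For functionals, `q_m f` is the composition of `f` with the transpose of the projection. The kernel
of the transpose is the complex conjugate of that of the projection, so that the same estimate
applies. The pairing can be written as an integral since the series for the kernel converges
absolutely in a single step (`apply_kernelOperator_eq_integral`). The rate is the same on each step,
which makes the supremum of `2^m |⟨q_m f - f, ψ⟩|` over `m` a continuous seminorm of `ψ`, bounded on
bounded sets (`tendsto_dual_of_isGSBound`).
-/

namespace GelfandShilovMRA

/-! ### Weight functions -/

/-- The weight `w(r) = sup_n (h r)^n / n!^t`, which grows like `exp (c r^(1/t))`. A function decays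
as the elements of `𝒮^a_t` do if and only if it is `O(1 / w(‖x‖))` for some `h > 0`. -/
noncomputable def wt (t h r : ℝ) : ℝ := ⨆ n : ℕ, (h * r) ^ n / (n.factorial : ℝ) ^ t

section Weight

variable {t h r : ℝ}

theorem factorial_rpow_pos (t : ℝ) (n : ℕ) : 0 < (n.factorial : ℝ) ^ t :=
  Real.rpow_pos_of_pos (by exact_mod_cast n.factorial_pos) t

theorem bddAbove_wt (ht : 1 ≤ t) (hh : 0 ≤ h) (hr : 0 ≤ r) :
    BddAbove (Set.range fun n : ℕ => (h * r) ^ n / (n.factorial : ℝ) ^ t) := by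
  refine ⟨Real.exp (h * r), ?_⟩
  rintro _ ⟨n, rfl⟩
  refine le_trans ?_ (Real.pow_div_factorial_le_exp (h * r) (by positivity) n)
  have h1 : (1 : ℝ) ≤ n.factorial := by exact_mod_cast n.factorial_pos
  have h2 : (n.factorial : ℝ) ≤ (n.factorial : ℝ) ^ t := by
    simpa using Real.rpow_le_rpow_of_exponent_le h1 ht
  exact div_le_div_of_nonneg_left (by positivity) (by positivity) h2

theorem pow_div_le_wt (ht : 1 ≤ t) (hh : 0 ≤ h) (hr : 0 ≤ r) (n : ℕ) :
    (h * r) ^ n / (n.factorial : ℝ) ^ t ≤ wt t h r :=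
  le_ciSup (bddAbove_wt ht hh hr) n

theorem pow_le_wt (ht : 1 ≤ t) (hh : 0 ≤ h) (hr : 0 ≤ r) (n : ℕ) :
    (h * r) ^ n ≤ (n.factorial : ℝ) ^ t * wt t h r := by
  have := pow_div_le_wt ht hh hr n
  rwa [div_le_iff₀' (factorial_rpow_pos t n)] at this

theorem one_le_wt (ht : 1 ≤ t) (hh : 0 ≤ h) (hr : 0 ≤ r) : 1 ≤ wt t h r := by
  simpa using pow_div_le_wt ht hh hr 0

theorem wt_pos (ht : 1 ≤ t) (hh : 0 ≤ h) (hr : 0 ≤ r) : 0 < wt t h r :=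
  one_pos.trans_le (one_le_wt ht hh hr)

theorem wt_le {c : ℝ} (hc : ∀ n : ℕ, (h * r) ^ n ≤ c * (n.factorial : ℝ) ^ t) : wt t h r ≤ c :=
  ciSup_le fun n => by rw [div_le_iff₀ (factorial_rpow_pos t n)]; exact hc n

theorem wt_mono {h' r' : ℝ} (ht : 1 ≤ t) (h0 : 0 ≤ h * r) (hh' : 0 ≤ h') (hr' : 0 ≤ r')
    (hle : h * r ≤ h' * r') : wt t h r ≤ wt t h' r' :=
  wt_le fun n => (pow_le_pow_left₀ h0 hle n).trans <| by
    rw [mul_comm (wt t h' r')]; exact pow_le_wt ht hh' hr' n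

theorem wt_anti {t' : ℝ} (ht : 1 ≤ t) (htt : t ≤ t') (hh : 0 ≤ h) (hr : 0 ≤ r) :
    wt t' h r ≤ wt t h r := by
  refine wt_le fun n => (pow_le_wt ht hh hr n).trans ?_
  rw [mul_comm]
  have h1 : (1 : ℝ) ≤ n.factorial := by exact_mod_cast n.factorial_pos
  have := wt_pos ht hh hr
  gcongr

/-- The weights are submultiplicative up to a dilation. -/
theorem wt_half_le_mul {r₁ r₂ : ℝ} (ht : 1 ≤ t) (hh : 0 ≤ h) (hr : 0 ≤ r) (h₁ : 0 ≤ r₁)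
    (h₂ : 0 ≤ r₂) (hle : r ≤ r₁ + r₂) : wt t (h / 2) r ≤ wt t h r₁ * wt t h r₂ := by
  have o₁ := one_le_wt ht hh h₁
  have o₂ := one_le_wt ht hh h₂
  -- the larger of `r₁` and `r₂` is at least `r / 2`, and the other weight is at least `1`
  rcases le_total r₁ r₂ with h12 | h12
  · refine (wt_mono ht (by positivity) hh h₂ (?_ : _ ≤ h * r₂)).trans
      (le_mul_of_one_le_left (by linarith) o₁)
    nlinarith
  · refine (wt_mono ht (by positivity) hh h₁ (?_ : _ ≤ h * r₁)).trans
      (le_mul_of_one_le_right (by linarith) o₂)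
    nlinarith

theorem factorial_two_mul_le (n : ℕ) : (2 * n).factorial ≤ 2 ^ (2 * n) * n.factorial ^ 2 := by
  have h1 := Nat.choose_mul_factorial_mul_factorial (show n ≤ 2 * n by omega)
  have h2 : 2 * n - n = n := by omega
  rw [h2] at h1
  rw [← h1, mul_assoc, ← sq]
  exact Nat.mul_le_mul_right _ (Nat.choose_le_two_pow _ _)

/-- The square of a weight is dominated by the weight with a larger parameter. -/
theorem wt_sq_le (ht : 1 ≤ t) (hh : 0 ≤ h) (hr : 0 ≤ r) :
    wt t h r ^ 2 ≤ wt t (2 ^ t * h) r := by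
  have hp : (0 : ℝ) < 2 ^ t := by positivity
  have hpos := wt_pos ht (by positivity : 0 ≤ 2 ^ t * h) hr
  suffices wt t h r ≤ √(wt t (2 ^ t * h) r) by
    have := pow_le_pow_left₀ (wt_pos ht hh hr).le this 2
    rwa [Real.sq_sqrt hpos.le] at this
  refine wt_le fun n => ?_
  have hf := factorial_rpow_pos t n
  -- the square of the term of index `n` is compared with the term of index `2 n`
  refine le_of_sq_le_sq ?_ (by positivity)
  rw [mul_pow (√_), Real.sq_sqrt hpos.le]
  have key := pow_le_wt ht (by positivity : 0 ≤ 2 ^ t * h) hr (2 * n)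
  have hfac : ((2 * n).factorial : ℝ) ^ t ≤ (2 ^ t) ^ (2 * n) * ((n.factorial : ℝ) ^ t) ^ 2 := by
    have h1 : ((2 * n).factorial : ℝ) ≤ 2 ^ (2 * n) * (n.factorial : ℝ) ^ 2 := by
      exact_mod_cast factorial_two_mul_le n
    refine (Real.rpow_le_rpow (by positivity) h1 (by linarith)).trans_eq ?_
    rw [Real.mul_rpow (by positivity) (by positivity), ← Real.rpow_natCast, ← Real.rpow_natCast,
      ← Real.rpow_natCast, ← Real.rpow_natCast, ← Real.rpow_mul (by positivity),
      ← Real.rpow_mul (by positivity), ← Real.rpow_mul (by positivity),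
      ← Real.rpow_mul (by positivity)]
    ring_nf
  have h3 := key.trans (mul_le_mul_of_nonneg_right hfac hpos.le)
  rw [mul_assoc, mul_pow, mul_assoc] at h3
  have h4 := le_of_mul_le_mul_left h3 (by positivity)
  rw [← pow_mul, mul_comm n 2]
  linarith

/-- `wt_sq_le` read from the larger to the smaller parameter. -/
theorem wt_div_sq_le (ht : 1 ≤ t) (hh : 0 ≤ h) (hr : 0 ≤ r) :
    wt t (h / 2 ^ t) r * wt t (h / 2 ^ t) r ≤ wt t h r := by
  have hp : (0 : ℝ) < 2 ^ t := by positivity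
  have := wt_sq_le ht (by positivity : 0 ≤ h / 2 ^ t) hr
  rwa [mul_div_cancel₀ _ hp.ne', sq] at this

theorem exists_pow_le_wt (ht : 1 ≤ t) (hh : 0 < h) (N : ℕ) :
    ∃ C : ℝ, 0 < C ∧ ∀ r : ℝ, 0 ≤ r → (1 + r) ^ N ≤ C * wt t h r := by
  have hf := factorial_rpow_pos t N
  refine ⟨2 ^ N * (1 + (N.factorial : ℝ) ^ t / h ^ N), by positivity, fun r hr => ?_⟩
  have o := one_le_wt ht hh.le hr
  have h1 : r ^ N ≤ (N.factorial : ℝ) ^ t / h ^ N * wt t h r := by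
    have := pow_le_wt ht hh.le hr N
    rw [mul_pow] at this
    rw [div_mul_eq_mul_div, le_div_iff₀ (by positivity)]
    linarith
  have h2 : (1 + r) ^ N ≤ 2 ^ N * (1 + r ^ N) := by
    rcases le_total r 1 with h | h
    · refine (pow_le_pow_left₀ (by positivity) (by linarith : 1 + r ≤ 2) N).trans ?_
      have : (0 : ℝ) ≤ 2 ^ N * r ^ N := by positivity
      linarith
    · refine (pow_le_pow_left₀ (by positivity) (by linarith : 1 + r ≤ 2 * r) N).trans ?_
      rw [mul_pow]
      have : (0 : ℝ) ≤ 2 ^ N := by positivity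
      linarith
  refine h2.trans ?_
  rw [mul_assoc, add_mul, one_mul]
  gcongr

theorem exists_inv_wt_le (ht : 1 ≤ t) (hh : 0 < h) (N : ℕ) :
    ∃ C : ℝ, 0 < C ∧ ∀ r : ℝ, 0 ≤ r → (wt t h r)⁻¹ ≤ C * ((1 + r) ^ N)⁻¹ := by
  obtain ⟨C, hC, H⟩ := exists_pow_le_wt ht hh N
  refine ⟨C, hC, fun r hr => ?_⟩
  have := wt_pos ht hh.le hr
  have h2 : 0 < (1 + r) ^ N := by positivity
  rw [← div_eq_mul_inv, inv_eq_one_div, div_le_div_iff₀ this h2, one_mul]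
  exact H r hr

end Weight

/-! ### Integrals and lattice sums of reciprocal weights -/

theorem integrable_inv_one_add_norm_pow (d : ℕ) :
    Integrable fun w : Rd d => ((1 + ‖w‖) ^ (d + 1))⁻¹ := by
  have := integrable_one_add_norm (E := Rd d) (μ := volume) (r := (d + 1 : ℕ)) (by simp)
  refine this.congr (Eventually.of_forall fun w => ?_)
  simp only
  rw [Real.rpow_neg (by positivity), Real.rpow_natCast]

theorem summable_inv_one_add_abs_sq : Summable fun k : ℤ => ((1 + |(k : ℝ)|) ^ 2)⁻¹ := by
  have h : Summable fun n : ℕ => ((1 + (n : ℝ)) ^ 2)⁻¹ := by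
    have := (summable_nat_add_iff 1).2 (Real.summable_one_div_nat_pow.2 one_lt_two)
    refine this.congr fun n => ?_
    push_cast
    rw [one_div, add_comm]
  refine Summable.of_nat_of_neg ?_ ?_ <;> simpa using h

theorem abs_apply_le_norm {d : ℕ} (x : Rd d) (i : Fin d) : |x i| ≤ ‖x‖ := by
  simpa using PiLp.norm_apply_le x i

theorem norm_le_sum_abs {d : ℕ} (x : Rd d) : ‖x‖ ≤ ∑ i, |x i| := by
  rw [EuclideanSpace.norm_eq]
  refine Real.sqrt_le_iff.2 ⟨Finset.sum_nonneg fun _ _ => abs_nonneg _, ?_⟩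
  simpa using Finset.sum_sq_le_sq_sum_of_nonneg (s := Finset.univ) (f := fun i => |x i|)
    fun i _ => abs_nonneg _

@[simp] theorem latticePoint_apply {d : ℕ} (n : Fin d → ℤ) (i : Fin d) :
    latticePoint n i = n i := rfl

theorem latticePoint_sub {d : ℕ} (m n : Fin d → ℤ) :
    latticePoint (m - n) = latticePoint m - latticePoint n := by
  ext i; simp

theorem latticePoint_add {d : ℕ} (m n : Fin d → ℤ) :
    latticePoint (m + n) = latticePoint m + latticePoint n := by
  ext i; simp

/-- The point of the lattice below `u`. -/
noncomputable def latticeFloor {d : ℕ} (u : Rd d) : Fin d → ℤ := fun i => ⌊u i⌋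

theorem norm_sub_latticeFloor_le {d : ℕ} (u : Rd d) : ‖u - latticePoint (latticeFloor u)‖ ≤ d := by
  refine (norm_le_sum_abs _).trans ?_
  calc ∑ i, |(u - latticePoint (latticeFloor u)) i| ≤ ∑ _i : Fin d, (1 : ℝ) := by
        refine Finset.sum_le_sum fun i _ => ?_
        simp only [PiLp.sub_apply, latticePoint_apply, latticeFloor, Int.self_sub_floor]
        rw [abs_of_nonneg (Int.fract_nonneg _)]
        exact (Int.fract_lt_one _).le
    _ = d := by simp

theorem summable_inv_one_add_norm_latticePoint (d : ℕ) :
    Summable fun k : Fin d → ℤ => ((1 + ‖latticePoint k‖) ^ (2 * d))⁻¹ := by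
  classical
  have hs := summable_inv_one_add_abs_sq
  have hprod : Summable fun k : Fin d → ℤ => ∏ i, ((1 + |(k i : ℝ)|) ^ 2)⁻¹ := by
    refine summable_of_sum_le (c := ∏ _i : Fin d, ∑' k : ℤ, ((1 + |(k : ℝ)|) ^ 2)⁻¹)
      (fun k => Finset.prod_nonneg fun i _ => by positivity) fun u => ?_
    calc ∑ k ∈ u, ∏ i, ((1 + |(k i : ℝ)|) ^ 2)⁻¹
        ≤ ∑ k ∈ Fintype.piFinset fun i => u.image fun k : Fin d → ℤ => k i,
            ∏ i, ((1 + |(k i : ℝ)|) ^ 2)⁻¹ := by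
          refine Finset.sum_le_sum_of_subset_of_nonneg (fun k hk => ?_)
            fun k _ _ => Finset.prod_nonneg fun i _ => by positivity
          exact Fintype.mem_piFinset.2 fun i => Finset.mem_image_of_mem _ hk
      _ = ∏ i : Fin d, ∑ k ∈ u.image fun k : Fin d → ℤ => k i, ((1 + |(k : ℝ)|) ^ 2)⁻¹ :=
          (Finset.prod_univ_sum (fun i : Fin d => u.image fun k : Fin d → ℤ => k i)
            (fun _ (k : ℤ) => ((1 + |(k : ℝ)|) ^ 2)⁻¹)).symm
      _ ≤ _ := Finset.prod_le_prod (fun i _ => Finset.sum_nonneg fun _ _ => by positivity)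
          fun i _ => hs.sum_le_tsum _ fun _ _ => by positivity
  refine hprod.of_nonneg_of_le (fun k => by positivity) fun k => ?_
  have hle : ∏ i, (1 + |(k i : ℝ)|) ^ 2 ≤ (1 + ‖latticePoint k‖) ^ (2 * d) := by
    calc ∏ i, (1 + |(k i : ℝ)|) ^ 2 ≤ ∏ _i : Fin d, (1 + ‖latticePoint k‖) ^ 2 := by
          refine Finset.prod_le_prod (fun i _ => by positivity) fun i _ => ?_
          have := abs_apply_le_norm (latticePoint k) i
          rw [latticePoint_apply] at this
          gcongr
      _ = _ := by simp [pow_mul]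
  rw [Finset.prod_inv_distrib]
  exact inv_anti₀ (Finset.prod_pos fun i _ => by positivity) hle

/-- The sums of the reciprocal weight over all translates of the lattice are uniformly bounded. -/
theorem exists_tsum_inv_wt_le (d : ℕ) {t h : ℝ} (ht : 1 ≤ t) (hh : 0 < h) :
    ∃ S : ℝ, 0 < S ∧ ∀ u : Rd d, (Summable fun k => (wt t h ‖u - latticePoint k‖)⁻¹) ∧
      ∑' k, (wt t h ‖u - latticePoint k‖)⁻¹ ≤ S := by
  obtain ⟨C, hC, H⟩ := exists_inv_wt_le ht hh (2 * d)
  have hs := summable_inv_one_add_norm_latticePoint d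
  set g : (Fin d → ℤ) → ℝ := fun k => ((1 + ‖latticePoint k‖) ^ (2 * d))⁻¹
  refine ⟨C * ((1 + d) ^ (2 * d) * ∑' k, g k) + 1, ?_, fun u => ?_⟩
  · have : 0 ≤ ∑' k, g k := tsum_nonneg fun k => by positivity
    positivity
  set n := latticeFloor u
  have hle : ∀ k, (wt t h ‖u - latticePoint k‖)⁻¹ ≤ C * ((1 + d) ^ (2 * d) * g (n - k)) := by
    intro k
    refine (H _ (norm_nonneg _)).trans (mul_le_mul_of_nonneg_left ?_ hC.le)
    have h1 : 1 + ‖latticePoint (n - k)‖ ≤ (1 + d) * (1 + ‖u - latticePoint k‖) := by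
      have h2 : ‖latticePoint (n - k)‖ ≤ ‖u - latticePoint k‖ + ‖u - latticePoint n‖ := by
        rw [latticePoint_sub, show latticePoint n - latticePoint k
          = (u - latticePoint k) - (u - latticePoint n) by abel]
        exact norm_sub_le _ _
      have h3 := norm_sub_latticeFloor_le u
      have h4 : 0 ≤ (d : ℝ) * ‖u - latticePoint k‖ := by positivity
      have h5 : ‖u - latticePoint n‖ ≤ d := h3
      nlinarith
    have h6 := pow_le_pow_left₀ (by positivity) h1 (2 * d)
    rw [mul_pow] at h6
    simp only [g]
    rw [← div_eq_mul_inv, inv_eq_one_div, div_le_div_iff₀ (by positivity) (by positivity), one_mul]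
    exact h6
  have hsum : Summable fun k => C * ((1 + d) ^ (2 * d) * g (n - k)) :=
    (((Equiv.subLeft n).summable_iff (f := g)).2 hs).mul_left _ |>.mul_left _
  have hS : Summable fun k => (wt t h ‖u - latticePoint k‖)⁻¹ :=
    hsum.of_nonneg_of_le (fun k => inv_nonneg.2 (wt_pos ht hh.le (norm_nonneg _)).le) hle
  refine ⟨hS, (hS.tsum_le_tsum hle hsum).trans ?_⟩
  rw [tsum_mul_left, tsum_mul_left, show ∑' k, g (n - k) = ∑' k, g k from
    (Equiv.subLeft n).tsum_eq g]
  linarith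

/-! ### Constant coefficient differential operators on the Schwartz space -/

section Deriv

variable {d : ℕ}

/-- The derivative in the direction `v`, as an operator on the Schwartz space. -/
noncomputable def dirDeriv (v : Rd d) : 𝓢(Rd d, ℂ) →L[ℂ] 𝓢(Rd d, ℂ) :=
  LineDeriv.lineDerivOpCLM ℂ 𝓢(Rd d, ℂ) v

theorem dirDeriv_apply (v : Rd d) (f : 𝓢(Rd d, ℂ)) (x : Rd d) :
    dirDeriv v f x = fderiv ℝ f x v := rfl

theorem dirDeriv_comm (v w : Rd d) : dirDeriv v * dirDeriv w = dirDeriv w * dirDeriv v := by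
  ext f x
  have h : ∀ v w : Rd d, (dirDeriv v * dirDeriv w) f x = iteratedFDeriv ℝ 2 f x ![v, w] := by
    intro v w
    rw [← SchwartzMap.iteratedLineDerivOp_eq_iteratedFDeriv]
    simp [LineDeriv.iteratedLineDerivOp_succ_left, dirDeriv]
  rw [h, h, iteratedFDeriv_two_apply, iteratedFDeriv_two_apply]
  have := ((f.smooth 2).contDiffAt (x := x)).isSymmSndFDerivAt (by simp)
  simpa using this v w

open scoped IsMulCommutative in
/-- The operator `p(∂₁, …, ∂_d)` on the Schwartz space, for a polynomial `p`. Since the partial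
derivatives commute, this is multiplicative in `p`. -/
noncomputable def polyDeriv :
    MvPolynomial (Fin d) ℂ →ₐ[ℂ] (𝓢(Rd d, ℂ) →L[ℂ] 𝓢(Rd d, ℂ)) :=
  haveI := Algebra.isMulCommutative_adjoin ℂ
    (s := Set.range fun i : Fin d => dirDeriv (EuclideanSpace.single i (1 : ℝ)))
    (by rintro _ ⟨i, rfl⟩ _ ⟨j, rfl⟩; exact dirDeriv_comm _ _)
  (Algebra.adjoin ℂ (Set.range fun i : Fin d =>
    dirDeriv (EuclideanSpace.single i (1 : ℝ)))).val.comp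
    (MvPolynomial.aeval fun i => ⟨_, Algebra.subset_adjoin ⟨i, rfl⟩⟩)

theorem polyDeriv_X (i : Fin d) :
    polyDeriv (MvPolynomial.X i) = dirDeriv (EuclideanSpace.single i (1 : ℝ)) := by
  simp [polyDeriv]

theorem partialDeriv_eq_polyDeriv (β : Fin d → ℕ) :
    partialDeriv β = polyDeriv (∏ i, MvPolynomial.X i ^ β i) := by
  rw [Fin.prod_univ_def, map_list_prod, List.map_map]
  simp only [partialDeriv, Function.comp_def, map_pow, polyDeriv_X]
  rfl

theorem dirDeriv_eq_polyDeriv (v : Rd d) :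
    dirDeriv v = polyDeriv (∑ i, MvPolynomial.C (v i : ℂ) * MvPolynomial.X i) := by
  ext f x
  simp only [map_sum, map_mul, polyDeriv_X, ← MvPolynomial.algebraMap_eq, AlgHom.commutes]
  have hv : v = ∑ i, v i • EuclideanSpace.single i (1 : ℝ) := by
    ext j
    simp [Finset.sum_apply, Pi.single_apply]
  conv_lhs => rw [hv, dirDeriv_apply, map_sum]
  simp only [map_smul, Algebra.algebraMap_eq_smul_one, smul_mul_assoc, one_mul,
    sum_apply, smul_apply]
  rfl

theorem partialDeriv_zero : partialDeriv (0 : Fin d → ℕ) = 1 := by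
  simp [partialDeriv_eq_polyDeriv]

theorem partialDeriv_mul_single (β : Fin d → ℕ) (i : Fin d) :
    partialDeriv β * dirDeriv (EuclideanSpace.single i (1 : ℝ)) =
      partialDeriv (β + Pi.single i 1) := by
  classical
  rw [partialDeriv_eq_polyDeriv, partialDeriv_eq_polyDeriv, ← polyDeriv_X, ← map_mul]
  congr 1
  simp only [Pi.add_apply, pow_add, Finset.prod_mul_distrib]
  congr 1
  rw [Finset.prod_eq_single i] <;> simp +contextual

theorem partialDeriv_dirDeriv (β : Fin d → ℕ) (v : Rd d) (f : 𝓢(Rd d, ℂ)) (x : Rd d) :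
    partialDeriv β (dirDeriv v f) x =
      ∑ i, (v i : ℂ) * partialDeriv (β + Pi.single i 1) f x := by
  have : dirDeriv v = ∑ i, (v i : ℂ) • dirDeriv (EuclideanSpace.single i (1 : ℝ)) := by
    rw [dirDeriv_eq_polyDeriv, map_sum]
    refine Finset.sum_congr rfl fun i _ => ?_
    rw [map_mul, polyDeriv_X, ← MvPolynomial.algebraMap_eq, AlgHom.commutes,
      Algebra.algebraMap_eq_smul_one, smul_mul_assoc, one_mul]
  rw [this, sum_apply, map_sum, sum_apply]
  refine Finset.sum_congr rfl fun i _ => ?_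
  rw [← partialDeriv_mul_single, smul_apply, map_smul]
  rfl

/-- The multinomial expansion of the powers of a directional derivative. -/
theorem dirDeriv_pow_apply (v : Rd d) (j : ℕ) (f : 𝓢(Rd d, ℂ)) (x : Rd d) :
    (dirDeriv v ^ j) f x = ∑ β ∈ Finset.piAntidiag Finset.univ j,
      (Nat.multinomial Finset.univ β : ℂ) * (monomial β v : ℂ) * partialDeriv β f x := by
  have : dirDeriv v ^ j = ∑ β ∈ Finset.piAntidiag Finset.univ j,
      ((Nat.multinomial Finset.univ β : ℂ) * (monomial β v : ℂ)) • partialDeriv β := by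
    rw [dirDeriv_eq_polyDeriv, ← map_pow, Finset.sum_pow_eq_sum_piAntidiag, map_sum]
    refine Finset.sum_congr rfl fun β _ => ?_
    simp only [mul_pow, Finset.prod_mul_distrib, ← MvPolynomial.C_pow]
    rw [map_mul, map_mul, ← partialDeriv_eq_polyDeriv, map_natCast, ← map_prod,
      ← MvPolynomial.algebraMap_eq, AlgHom.commutes, Algebra.algebraMap_eq_smul_one,
      smul_mul_assoc, one_mul, mul_smul, monomial, Complex.ofReal_prod]
    simp only [Complex.ofReal_pow, Nat.cast_smul_eq_nsmul, nsmul_eq_mul]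
  rw [this, sum_apply, sum_apply]
  rfl

theorem norm_partialDeriv_iteratedLineDeriv_le {n : ℕ} (v : Fin n → Rd d) (β : Fin d → ℕ)
    (f : 𝓢(Rd d, ℂ)) (x : Rd d) {B : ℝ}
    (hB : ∀ γ : Fin d → ℕ, ∑ i, γ i = n + ∑ i, β i → ‖partialDeriv γ f x‖ ≤ B) :
    ‖partialDeriv β (LineDeriv.iteratedLineDerivOp v f) x‖ ≤ (∏ l, ‖v l‖) * d ^ n * B := by
  classical
  induction n generalizing β with
  | zero => simpa using hB β (by simp)
  | succ n ih =>
    rw [LineDeriv.iteratedLineDerivOp_succ_left]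
    change ‖partialDeriv β (dirDeriv (v 0) _) x‖ ≤ _
    rw [partialDeriv_dirDeriv]
    refine (norm_sum_le _ _).trans ?_
    calc _ ≤ ∑ _i : Fin d, ‖v 0‖ * ((∏ l, ‖Fin.tail v l‖) * d ^ n * B) := by
          refine Finset.sum_le_sum fun i _ => ?_
          rw [norm_mul, Complex.norm_real]
          refine mul_le_mul (abs_apply_le_norm _ _) (ih _ _ fun γ hγ => hB γ ?_) (norm_nonneg _)
            (norm_nonneg _)
          rw [hγ]
          simp [Finset.sum_add_distrib]
          ring
      _ = _ := by
          rw [Finset.sum_const, Finset.card_univ, Fintype.card_fin, Fin.prod_univ_succ,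
            nsmul_eq_mul]
          simp only [Fin.tail]
          ring

theorem norm_iteratedFDeriv_le_of_partialDeriv (n : ℕ) (f : 𝓢(Rd d, ℂ)) (x : Rd d) {B : ℝ}
    (hB0 : 0 ≤ B) (hB : ∀ γ : Fin d → ℕ, ∑ i, γ i = n → ‖partialDeriv γ f x‖ ≤ B) :
    ‖iteratedFDeriv ℝ n f x‖ ≤ d ^ n * B := by
  refine ContinuousMultilinearMap.opNorm_le_bound (by positivity) fun v => ?_
  have := norm_partialDeriv_iteratedLineDeriv_le v 0 f x (B := B) (by simpa using hB)
  rw [partialDeriv_zero, one_apply_eq_self,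
    SchwartzMap.iteratedLineDerivOp_eq_iteratedFDeriv] at this
  linarith

theorem dirDeriv_pow_eq (v : Rd d) (n : ℕ) (f : 𝓢(Rd d, ℂ)) :
    (dirDeriv v ^ n) f = LineDeriv.iteratedLineDerivOp (fun _ : Fin n => v) f := by
  induction n with
  | zero => simp
  | succ n ih =>
    rw [LineDeriv.iteratedLineDerivOp_succ_left, pow_succ', mul_apply_eq_comp, ih]
    rfl

theorem norm_dirDeriv_pow_le (v : Rd d) (n : ℕ) (f : 𝓢(Rd d, ℂ)) (x : Rd d) {B : ℝ}
    (hB : ∀ γ : Fin d → ℕ, ∑ i, γ i = n → ‖partialDeriv γ f x‖ ≤ B) :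
    ‖(dirDeriv v ^ n) f x‖ ≤ (d * ‖v‖) ^ n * B := by
  have := norm_partialDeriv_iteratedLineDeriv_le (fun _ : Fin n => v) 0 f x (B := B)
    (by simpa using hB)
  rw [partialDeriv_zero, one_apply_eq_self, ← dirDeriv_pow_eq] at this
  simp only [Finset.prod_const, Finset.card_univ, Fintype.card_fin] at this
  rw [mul_pow]
  linarith

theorem dirDeriv_smul (ε : ℝ) (v : Rd d) : dirDeriv (ε • v) = (ε : ℂ) • dirDeriv v := by
  ext f x
  rw [dirDeriv_apply, map_smul]
  rfl

theorem iteratedDeriv_segment (f : 𝓢(Rd d, ℂ)) (x v : Rd d) (n : ℕ) :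
    iteratedDeriv n (fun τ : ℝ => f (x + τ • v)) = fun τ => (dirDeriv v ^ n) f (x + τ • v) := by
  induction n with
  | zero => simp
  | succ n ih =>
    rw [iteratedDeriv_succ, ih]
    funext τ
    have h1 : HasDerivAt (fun τ : ℝ => x + τ • v) v τ := by
      simpa using ((hasDerivAt_id τ).smul_const v).const_add x
    rw [pow_succ']
    exact ((((dirDeriv v ^ n) f).hasFDerivAt (x + τ • v)).comp_hasDerivAt τ h1).deriv

/-- Taylor's formula along the segment from `x` to `x + ε w`. -/
theorem norm_sub_taylor_le (f : 𝓢(Rd d, ℂ)) (x w : Rd d) (ε : ℝ) (n : ℕ) {B : ℝ}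
    (hB : ∀ γ : Fin d → ℕ, ∑ i, γ i = n + 1 → ∀ τ ∈ Set.Icc (0 : ℝ) 1,
      ‖partialDeriv γ f (x + τ • ε • w)‖ ≤ B) :
    ‖f (x + ε • w) - ∑ j ∈ Finset.range (n + 1),
      ((ε ^ j / j.factorial : ℝ) : ℂ) * (dirDeriv w ^ j) f x‖ ≤
      (d * (|ε| * ‖w‖)) ^ (n + 1) * B / n.factorial := by
  set v := ε • w
  have hsm : ContDiff ℝ (n + 1 : ℕ) fun τ : ℝ => f (x + τ • v) :=
    (f.smooth (n + 1 : ℕ)).comp (contDiff_const.add (contDiff_id.smul contDiff_const))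
  have hwithin : ∀ j ≤ n + 1, ∀ τ ∈ Set.Icc (0 : ℝ) 1,
      iteratedDerivWithin j (fun τ : ℝ => f (x + τ • v)) (Set.Icc 0 1) τ
        = (dirDeriv v ^ j) f (x + τ • v) := by
    intro j hj τ hτ
    rw [iteratedDerivWithin_eq_iteratedDeriv (uniqueDiffOn_Icc zero_lt_one)
      ((hsm.of_le (by exact_mod_cast hj)).contDiffAt) hτ, iteratedDeriv_segment]
  have := taylor_mean_remainder_bound (f := fun τ : ℝ => f (x + τ • v)) (n := n)
    (C := (d * ‖v‖) ^ (n + 1) * B) zero_le_one (by exact_mod_cast hsm.contDiffOn)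
    (Set.right_mem_Icc.2 zero_le_one) (fun τ hτ => by
      rw [hwithin _ le_rfl _ hτ]
      exact norm_dirDeriv_pow_le v (n + 1) f _ fun γ hγ => hB γ hγ τ hτ)
  rw [taylor_within_apply] at this
  simp only [one_smul, sub_zero, one_pow, mul_one] at this
  rw [norm_smul, Real.norm_eq_abs] at this
  refine le_trans (le_of_eq ?_) this
  congr 2
  refine Finset.sum_congr rfl fun j hj => ?_
  rw [hwithin j (Finset.mem_range.1 hj).le 0 (Set.left_mem_Icc.2 zero_le_one), dirDeriv_smul,
    smul_pow, smul_apply]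
  simp
  ring

/-- If the partial derivatives of order one commute with `L` up to the factor `c`, then those of
order `β` do so up to the factor `c^|β|`. -/
theorem partialDeriv_comm_of_single {L : 𝓢(Rd d, ℂ) → 𝓢(Rd d, ℂ)} {c : ℝ}
    (hL : ∀ i f, dirDeriv (EuclideanSpace.single i (1 : ℝ)) (L f) =
      (c : ℂ) • L (dirDeriv (EuclideanSpace.single i (1 : ℝ)) f))
    (hc : ∀ f, L ((c : ℂ) • f) = (c : ℂ) • L f) (β : Fin d → ℕ) (f : 𝓢(Rd d, ℂ)) :
    partialDeriv β (L f) = ((c ^ ∑ i, β i : ℝ) : ℂ) • L (partialDeriv β f) := by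
  have hpow : ∀ i n f, (dirDeriv (EuclideanSpace.single i (1 : ℝ)) ^ n) (L f) =
      ((c ^ n : ℝ) : ℂ) • L ((dirDeriv (EuclideanSpace.single i (1 : ℝ)) ^ n) f) := by
    intro i n
    induction n with
    | zero => simp
    | succ n ih =>
      intro f
      rw [pow_succ, mul_apply_eq_comp, hL, map_smul, ih, smul_smul,
        mul_apply_eq_comp]
      push_cast
      ring_nf
  have hcn : ∀ n f, L (((c ^ n : ℝ) : ℂ) • f) = ((c ^ n : ℝ) : ℂ) • L f := by
    intro n
    induction n with
    | zero => simp
    | succ n ih =>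
      intro f
      rw [pow_succ, Complex.ofReal_mul, mul_smul, ih, hc, smul_smul]
  have hlist : ∀ l : List (Fin d), (l.map fun i =>
      dirDeriv (EuclideanSpace.single i (1 : ℝ)) ^ β i).prod (L f) =
      ((c ^ (l.map β).sum : ℝ) : ℂ) • L ((l.map fun i =>
        dirDeriv (EuclideanSpace.single i (1 : ℝ)) ^ β i).prod f) := by
    intro l
    induction l with
    | nil => simp
    | cons i l ih =>
      simp only [List.map_cons, List.prod_cons, mul_apply_eq_comp, ih, map_smul, hpow,
        smul_smul, List.sum_cons, pow_add, Complex.ofReal_mul]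
      rw [mul_comm]
  have := hlist (List.finRange d)
  rwa [← Fin.sum_univ_def] at this

end Deriv

section Fourier

variable {d : ℕ}

open scoped FourierTransform in
theorem fourier_polyDeriv (p : MvPolynomial (Fin d) ℂ) (f : 𝓢(Rd d, ℂ)) (ξ : Rd d) :
    𝓕 (polyDeriv p f) ξ =
      MvPolynomial.eval (fun i => 2 * Real.pi * Complex.I * (ξ i : ℂ)) p * 𝓕 f ξ := by
  induction p using MvPolynomial.induction_on generalizing f with
  | C a =>
    rw [← MvPolynomial.algebraMap_eq, AlgHom.commutes, Algebra.algebraMap_eq_smul_one,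
      MvPolynomial.algebraMap_eq, MvPolynomial.eval_C, smul_apply, one_apply_eq_self,
      FourierTransform.fourier_smul]
    rfl
  | add p q hp hq =>
    rw [map_add, map_add, add_apply, FourierTransform.fourier_add, add_apply, hp, hq, add_mul]
  | mul_X p i hp =>
    rw [map_mul, mul_apply_eq_comp, hp, polyDeriv_X, map_mul, MvPolynomial.eval_X,
      mul_assoc (MvPolynomial.eval _ p)]
    congr 1
    change 𝓕 (LineDeriv.lineDerivOp (EuclideanSpace.single i (1 : ℝ)) f) ξ = _
    rw [SchwartzMap.fourier_lineDerivOp_eq, smul_apply,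
      SchwartzMap.smulLeftCLM_apply_apply (by fun_prop)]
    rw [EuclideanSpace.inner_single_right]
    simp [mul_assoc]

open scoped FourierTransform in
/-- A nonzero Schwartz function satisfies no nontrivial constant coefficient linear partial
differential equation, since its Fourier transform does not vanish on some open set. -/
theorem eq_zero_of_polyDeriv_eq_zero {φ : 𝓢(Rd d, ℂ)} (hφ : φ ≠ 0)
    {p : MvPolynomial (Fin d) ℂ} (hp : polyDeriv p φ = 0) : p = 0 := by
  have h1 : 𝓕 φ ≠ 0 := fun h =>
    hφ ((FourierTransform.fourierCLE ℂ 𝓢(Rd d, ℂ)).map_eq_zero_iff.1 h)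
  obtain ⟨ξ₀, hξ₀⟩ : ∃ ξ, 𝓕 φ ξ ≠ 0 := by
    by_contra! h
    exact h1 (SchwartzMap.ext h)
  have hnear : ∀ᶠ ξ in 𝓝 (WithLp.ofLp ξ₀), 𝓕 φ (WithLp.toLp 2 ξ) ≠ 0 := by
    have hc : Continuous fun ξ : Fin d → ℝ => 𝓕 φ (WithLp.toLp 2 ξ) :=
      (𝓕 φ).continuous.comp (PiLp.continuous_toLp 2 _)
    exact hc.continuousAt.eventually_ne (by simpa using hξ₀)
  obtain ⟨ε, hε, hball⟩ := Metric.eventually_nhds_iff_ball.1 hnear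
  have hpi : (2 * Real.pi * Complex.I : ℂ) ≠ 0 := Complex.two_pi_I_ne_zero
  refine MvPolynomial.funext_set
    (fun i => (fun r : ℝ => (2 * Real.pi * Complex.I * (r : ℂ))) '' Metric.ball (ξ₀ i) ε)
    (fun i => Set.Infinite.image ?_ ?_) fun z hz => ?_
  · intro a _ b _ hab
    exact_mod_cast mul_left_cancel₀ hpi hab
  · rw [Real.ball_eq_Ioo]
    exact Set.Ioo_infinite (by linarith)
  · choose r hr hrz using fun i => hz i (Set.mem_univ i)
    have hz' : z = fun i => 2 * Real.pi * Complex.I * (((WithLp.toLp 2 r : Rd d) i : ℝ) : ℂ) :=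
      funext fun i => (hrz i).symm
    have hmem : r ∈ Metric.ball (WithLp.ofLp ξ₀) ε := by
      rw [Metric.mem_ball, dist_pi_lt_iff hε]
      exact fun i => hr i
    have h2 := fourier_polyDeriv p φ (WithLp.toLp 2 r)
    rw [hp, FourierTransform.fourier_zero,
      zero_apply] at h2
    rw [hz', map_zero]
    exact (mul_eq_zero.1 h2.symm).resolve_right (hball r hmem)

end Fourier

/-! ### Translation, dilation and conjugation of Schwartz functions -/

section Operations

variable {d : ℕ}

/-- The translate `f(x - a)`. -/
noncomputable def translate (a : Rd d) : 𝓢(Rd d, ℂ) →L[ℂ] 𝓢(Rd d, ℂ) :=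
  SchwartzMap.compSubConstCLM ℂ a

@[simp] theorem translate_apply (a : Rd d) (f : 𝓢(Rd d, ℂ)) (x : Rd d) :
    translate a f x = f (x - a) := rfl

/-- The dilate `f(c x)`. -/
noncomputable def dilate (c : ℝˣ) : 𝓢(Rd d, ℂ) →L[ℂ] 𝓢(Rd d, ℂ) :=
  SchwartzMap.compCLMOfContinuousLinearEquiv ℂ (ContinuousLinearEquiv.smulLeft c)

@[simp] theorem dilate_apply (c : ℝˣ) (f : 𝓢(Rd d, ℂ)) (x : Rd d) :
    dilate c f x = f ((c : ℝ) • x) := rfl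

/-- The complex conjugate of a Schwartz function. -/
noncomputable def conjugate (f : 𝓢(Rd d, ℂ)) : 𝓢(Rd d, ℂ) :=
  f.postcompCLM (Complex.conjCLE : ℂ →L[ℝ] ℂ)

@[simp] theorem conjugate_apply (f : 𝓢(Rd d, ℂ)) (x : Rd d) :
    conjugate f x = starRingEnd ℂ (f x) := rfl

theorem partialDeriv_translate (a : Rd d) (β : Fin d → ℕ) (f : 𝓢(Rd d, ℂ)) :
    partialDeriv β (translate a f) = translate a (partialDeriv β f) := by
  have := partialDeriv_comm_of_single (L := translate a) (c := 1) (fun i f => ?_)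
    (fun f => by simp) β f
  · simpa using this
  · ext x
    simp only [dirDeriv_apply, translate_apply, Complex.ofReal_one, one_smul]
    exact congrArg (fun L : Rd d →L[ℝ] ℂ => L (EuclideanSpace.single i 1))
      (fderiv_comp_sub (𝕜 := ℝ) (f := f) a)

theorem partialDeriv_dilate (c : ℝˣ) (β : Fin d → ℕ) (f : 𝓢(Rd d, ℂ)) :
    partialDeriv β (dilate c f) =
      (((c : ℝ) ^ ∑ i, β i : ℝ) : ℂ) • dilate c (partialDeriv β f) := by
  refine partialDeriv_comm_of_single (L := dilate c) (fun i f => ?_) (fun f => map_smul _ _ _) β f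
  have := SchwartzMap.lineDerivOp_compCLMOfContinuousLinearEquiv (𝕜 := ℂ)
    (EuclideanSpace.single i (1 : ℝ)) (ContinuousLinearEquiv.smulLeft c : Rd d ≃L[ℝ] Rd d) f
  refine Eq.trans this ?_
  change dilate c (dirDeriv ((c : ℝ) • EuclideanSpace.single i (1 : ℝ)) f) = _
  rw [dirDeriv_smul, smul_apply, map_smul]

theorem partialDeriv_conjugate (β : Fin d → ℕ) (f : 𝓢(Rd d, ℂ)) :
    partialDeriv β (conjugate f) = conjugate (partialDeriv β f) := by
  have := partialDeriv_comm_of_single (L := conjugate) (c := 1) (fun i f => ?_)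
    (fun f => by simp) β f
  · simpa using this
  · ext x
    simp only [dirDeriv_apply, conjugate_apply, Complex.ofReal_one, one_smul]
    have h := ((Complex.conjCLE : ℂ →L[ℝ] ℂ).hasFDerivAt.comp x (f.hasFDerivAt x)).fderiv
    change fderiv ℝ ((Complex.conjCLE : ℂ →L[ℝ] ℂ) ∘ f) x _ = _
    rw [h]
    rfl

end Operations

/-! ### Gelfand-Shilov bounds in terms of weights -/

/-- `C` bounds the norm of `f` in the step with parameter `h` of `𝒮^a_b`, in the following variant
of `gsNorm`: the decay is expressed by the radial weight `wt b h ‖x‖`, and the factorials of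
multi-indices are replaced by the factorials of their lengths. Up to a change of `h`, this is the
same as a bound on `gsNorm`, see `isGSBound_of_gsNorm` and `gsNorm_le_of_isGSBound`. -/
def IsGSBound {d : ℕ} (a b h C : ℝ) (f : 𝓢(Rd d, ℂ)) : Prop :=
  ∀ (β : Fin d → ℕ) (x : Rd d), h ^ (∑ i, β i) * ‖partialDeriv β f x‖ * wt b h ‖x‖ ≤
    C * ((∑ i, β i).factorial : ℝ) ^ a

section Bound

variable {d : ℕ} {a b h C : ℝ} {f : 𝓢(Rd d, ℂ)}

theorem mfactorial_le_factorial_sum (β : Fin d → ℕ) :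
    mfactorial β ≤ ((∑ i, β i).factorial : ℝ) := by
  have := Nat.le_of_dvd (Nat.factorial_pos _) (Nat.prod_factorial_dvd_factorial_sum Finset.univ β)
  rw [mfactorial]
  exact_mod_cast this

theorem factorial_sum_le_mfactorial (β : Fin d → ℕ) :
    ((∑ i, β i).factorial : ℝ) ≤ ((d : ℝ) + 1) ^ (∑ i, β i) * mfactorial β := by
  classical
  have h1 : Nat.multinomial Finset.univ β ≤ d ^ (∑ i, β i) := by
    have := Finset.sum_pow_eq_sum_piAntidiag (Finset.univ : Finset (Fin d)) (fun _ => (1 : ℕ))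
      (∑ i, β i)
    simp only [Finset.sum_const, Finset.card_univ, Fintype.card_fin, smul_eq_mul, mul_one, one_pow,
      Finset.prod_const_one, Nat.cast_id] at this
    rw [this]
    exact Finset.single_le_sum (f := fun k => Nat.multinomial Finset.univ k)
      (fun _ _ => Nat.zero_le _) (by simp [Finset.mem_piAntidiag])
  have h2 : (Nat.multinomial Finset.univ β : ℝ) ≤ ((d : ℝ) + 1) ^ (∑ i, β i) := by
    refine le_trans (b := (d : ℝ) ^ (∑ i, β i)) (by exact_mod_cast h1) ?_
    gcongr
    linarith
  rw [← Nat.multinomial_spec, mfactorial]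
  push_cast
  rw [mul_comm]
  gcongr

theorem abs_monomial_le (α : Fin d → ℕ) (x : Rd d) : |monomial α x| ≤ ‖x‖ ^ (∑ i, α i) := by
  rw [monomial, Finset.abs_prod, ← Finset.prod_pow_eq_pow_sum]
  refine Finset.prod_le_prod (fun _ _ => abs_nonneg _) fun i _ => ?_
  rw [abs_pow]
  have := abs_apply_le_norm x i
  gcongr

theorem exists_norm_le_mul_abs {x : Rd d} (hx : x ≠ 0) : ∃ i, ‖x‖ ≤ (d + 1) * |x i| := by
  by_contra! hc
  have h0 : 0 < ‖x‖ := norm_pos_iff.2 hx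
  have h1 : ‖x‖ ≤ ∑ _i : Fin d, ‖x‖ / (d + 1) := (norm_le_sum_abs x).trans <|
    Finset.sum_le_sum fun i _ => by
      rw [le_div_iff₀ (by positivity), mul_comm]
      exact (hc i).le
  rw [Finset.sum_const, Finset.card_univ, Fintype.card_fin, nsmul_eq_mul, mul_div_assoc',
    le_div_iff₀ (by positivity)] at h1
  linarith

theorem IsGSBound.nonneg (hb : 1 ≤ b) (hh : 0 ≤ h) (hf : IsGSBound a b h C f) : 0 ≤ C := by
  have h1 := hf 0 0
  simp only [Pi.zero_apply, Finset.sum_const_zero, Nat.factorial_zero, Nat.cast_one,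
    Real.one_rpow, mul_one] at h1
  have := (wt_pos hb hh (norm_nonneg (0 : Rd d))).le
  exact le_trans (by positivity) h1

theorem IsGSBound.norm_le (hb : 1 ≤ b) (hh : 0 < h) (hf : IsGSBound a b h C f) (β : Fin d → ℕ)
    (x : Rd d) : ‖partialDeriv β f x‖ ≤
      C * ((∑ i, β i).factorial : ℝ) ^ a / h ^ (∑ i, β i) * (wt b h ‖x‖)⁻¹ := by
  have h1 := hf β x
  have := wt_pos hb hh.le (norm_nonneg x)
  rw [← div_eq_mul_inv, le_div_iff₀ this, le_div_iff₀ (by positivity)]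
  linarith

theorem isGSBound_of_norm_le {A h' C' : ℝ} (hb : 1 ≤ b) (hh' : 0 < h') (hA : 0 ≤ A)
    (hle : h' * A ≤ 1) (hC' : 0 ≤ C')
    (hf : ∀ β x, ‖partialDeriv β f x‖ ≤
      C' * A ^ (∑ i, β i) * ((∑ i, β i).factorial : ℝ) ^ a * (wt b h' ‖x‖)⁻¹) :
    IsGSBound a b h' C' f := by
  intro β x
  have hw := wt_pos hb hh'.le (norm_nonneg x)
  set n := ∑ i, β i
  have hfac := factorial_rpow_pos a n
  calc h' ^ n * ‖partialDeriv β f x‖ * wt b h' ‖x‖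
      ≤ h' ^ n * (C' * A ^ n * (n.factorial : ℝ) ^ a * (wt b h' ‖x‖)⁻¹) * wt b h' ‖x‖ := by
        gcongr
        exact hf β x
    _ = (h' * A) ^ n * (C' * (n.factorial : ℝ) ^ a) := by
        rw [mul_pow]
        field_simp
    _ ≤ 1 * (C' * (n.factorial : ℝ) ^ a) := by
        gcongr
        exact pow_le_one₀ (by positivity) hle
    _ = _ := one_mul _

theorem IsGSBound.mono_right {C' : ℝ} (hC : C ≤ C') (hf : IsGSBound a b h C f) :
    IsGSBound a b h C' f := fun β x => (hf β x).trans <| by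
  have := factorial_rpow_pos a (∑ i, β i)
  gcongr

theorem IsGSBound.mono {h' : ℝ} (hb : 1 ≤ b) (h0 : 0 ≤ h') (hle : h' ≤ h)
    (hf : IsGSBound a b h C f) : IsGSBound a b h' C f := fun β x => by
  refine le_trans ?_ (hf β x)
  have hw := wt_mono hb (mul_nonneg h0 (norm_nonneg x)) (h0.trans hle) (norm_nonneg x)
    (mul_le_mul_of_nonneg_right hle (norm_nonneg x))
  have := wt_pos hb h0 (norm_nonneg x)
  have := h0.trans hle
  gcongr

theorem IsGSBound.index_mono {a' b' : ℝ} (hb : 1 ≤ b) (hh : 0 ≤ h) (ha : a ≤ a') (hbb : b ≤ b')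
    (hf : IsGSBound a b h C f) : IsGSBound a' b' h C f := fun β x => by
  have hC := hf.nonneg hb hh
  have h1 : (1 : ℝ) ≤ (∑ i, β i).factorial := by exact_mod_cast Nat.factorial_pos _
  have hw := wt_anti hb hbb hh (norm_nonneg x)
  have h2 := hf β x
  calc _ ≤ h ^ (∑ i, β i) * ‖partialDeriv β f x‖ * wt b h ‖x‖ := by gcongr
    _ ≤ C * ((∑ i, β i).factorial : ℝ) ^ a := h2
    _ ≤ _ := by gcongr

theorem IsGSBound.smul (c : ℂ) (hf : IsGSBound a b h C f) : IsGSBound a b h (‖c‖ * C) (c • f) := by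
  intro β x
  rw [map_smul, smul_apply, norm_smul]
  have := mul_le_mul_of_nonneg_left (hf β x) (norm_nonneg c)
  linarith

/-- Translation by `k` costs a factor that grows with `k` like the weight. -/
theorem IsGSBound.translate (hb : 1 ≤ b) (hh : 0 ≤ h) (hf : IsGSBound a b h C f) (k : Rd d) :
    IsGSBound a b (h / 2) (C * wt b h ‖k‖) (translate k f) := by
  intro β x
  rw [partialDeriv_translate, translate_apply]
  have hle : wt b (h / 2) ‖x‖ ≤ wt b h ‖x - k‖ * wt b h ‖k‖ :=
    wt_half_le_mul hb hh (norm_nonneg _) (norm_nonneg _) (norm_nonneg _)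
      (by simpa using norm_add_le (x - k) k)
  have hk := wt_pos hb hh (norm_nonneg k)
  have hx := wt_pos hb (by positivity : 0 ≤ h / 2) (norm_nonneg x)
  calc _ ≤ h ^ (∑ i, β i) * ‖partialDeriv β f (x - k)‖ * (wt b h ‖x - k‖ * wt b h ‖k‖) := by
        gcongr
        linarith
    _ ≤ C * ((∑ i, β i).factorial : ℝ) ^ a * wt b h ‖k‖ := by
        rw [← mul_assoc]
        have := hf β (x - k)
        gcongr
    _ = _ := by ring

theorem IsGSBound.conjugate (hf : IsGSBound a b h C f) :
    IsGSBound a b h C (conjugate f) := by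
  intro β x
  rw [partialDeriv_conjugate, conjugate_apply, RCLike.norm_conj]
  exact hf β x

theorem IsGSBound.dilate {h' : ℝ} {c : ℝˣ} (hc : 0 < (c : ℝ)) (hb : 1 ≤ b) (h0 : 0 ≤ h')
    (hh : 0 ≤ h) (h₁ : h' * c ≤ h) (h₂ : h' ≤ h * c) (hf : IsGSBound a b h C f) :
    IsGSBound a b h' C (dilate c f) := by
  intro β x
  rw [partialDeriv_dilate, smul_apply, dilate_apply, norm_smul, Complex.norm_real,
    Real.norm_of_nonneg (by positivity)]
  have hw : wt b h' ‖x‖ ≤ wt b h ‖(c : ℝ) • x‖ := by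
    refine wt_mono hb (by positivity) hh (norm_nonneg _) ?_
    rw [norm_smul, Real.norm_of_nonneg hc.le, ← mul_assoc]
    gcongr
  have hpos := wt_pos hb h0 (norm_nonneg x)
  calc _ = (h' * c) ^ (∑ i, β i) * ‖partialDeriv β f ((c : ℝ) • x)‖ * wt b h' ‖x‖ := by
        rw [mul_pow]
        ring
    _ ≤ h ^ (∑ i, β i) * ‖partialDeriv β f ((c : ℝ) • x)‖ * wt b h ‖(c : ℝ) • x‖ := by gcongr
    _ ≤ _ := hf β _

/-- The radial weight is controlled by powers of a single coordinate, since the largest coordinate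
of `x` is comparable to `‖x‖`. -/
theorem isGSBound_of_gsNorm (ha : 0 ≤ a) (hb : 1 ≤ b) (hh : 0 < h) (hf : gsNorm a b h f ≠ ∞) :
    IsGSBound a b (h / (d + 1)) (gsNorm a b h f).toReal f := by
  classical
  set N := (gsNorm a b h f).toReal
  have hN : 0 ≤ N := ENNReal.toReal_nonneg
  have hd : (0 : ℝ) < d + 1 := by positivity
  intro β x
  set m := ∑ i, β i
  have key : ∀ (i : Fin d → ℕ), h ^ (∑ l, i l) * h ^ m * (|monomial i x| * ‖partialDeriv β f x‖) ≤
      N * (mfactorial i ^ b * (m.factorial : ℝ) ^ a) := by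
    intro α
    have h1 := ENNReal.toReal_mono hf (le_gsNorm a b h f x α β)
    have hα := mfactorial_pos α
    have hβ := mfactorial_pos β
    rw [ENNReal.toReal_ofReal (by positivity), norm_mul, Complex.norm_real, Real.norm_eq_abs,
      div_mul_eq_mul_div, div_le_iff₀ (by positivity), Finset.sum_add_distrib, pow_add] at h1
    refine h1.trans ?_
    have := mfactorial_le_factorial_sum β
    gcongr
  have hfac := factorial_rpow_pos a m
  have hx : ∀ n : ℕ, h ^ m * ‖partialDeriv β f x‖ * (h / (d + 1) * ‖x‖) ^ n ≤
      N * (m.factorial : ℝ) ^ a * (n.factorial : ℝ) ^ b := by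
    intro n
    have hnf := factorial_rpow_pos b n
    rcases Nat.eq_zero_or_pos n with rfl | hn
    · have := key 0
      simpa [mfactorial, monomial] using this
    rcases eq_or_ne x 0 with rfl | hx0
    · rw [norm_zero, mul_zero, zero_pow hn.ne', mul_zero]
      positivity
    obtain ⟨i, hi⟩ := exists_norm_le_mul_abs hx0
    have h1 := key (Pi.single i n)
    have e1 : ∑ l, (Pi.single i n : Fin d → ℕ) l = n := by simp
    have e2 : mfactorial (Pi.single i n : Fin d → ℕ) = n.factorial := by
      rw [mfactorial, Finset.prod_eq_single i] <;> simp +contextual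
    have e3 : monomial (Pi.single i n : Fin d → ℕ) x = x i ^ n := by
      rw [monomial, Finset.prod_eq_single i] <;> simp +contextual
    rw [e1, e2, e3, abs_pow] at h1
    have h2 : (h / (d + 1) * ‖x‖) ^ n ≤ (h * |x i|) ^ n := by
      refine pow_le_pow_left₀ (by positivity) ?_ n
      rw [div_mul_eq_mul_div, div_le_iff₀ hd]
      nlinarith
    calc _ ≤ h ^ m * ‖partialDeriv β f x‖ * (h * |x i|) ^ n := by gcongr
      _ = h ^ n * h ^ m * (|x i| ^ n * ‖partialDeriv β f x‖) := by rw [mul_pow]; ring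
      _ ≤ _ := h1
      _ = _ := by ring
  rcases eq_or_lt_of_le (norm_nonneg (partialDeriv β f x)) with h0 | h0
  · rw [← h0, mul_zero, zero_mul]
    positivity
  have hw : wt b (h / (d + 1)) ‖x‖ ≤
      N * (m.factorial : ℝ) ^ a / (h ^ m * ‖partialDeriv β f x‖) := by
    refine wt_le fun n => ?_
    rw [div_mul_eq_mul_div (N * _), le_div_iff₀ (by positivity)]
    linarith [hx n]
  rw [le_div_iff₀ (by positivity)] at hw
  have hwp := wt_pos hb (by positivity : 0 ≤ h / (d + 1)) (norm_nonneg x)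
  refine le_trans ?_ hw
  rw [mul_comm]
  gcongr
  exact div_le_self hh.le (by linarith)

/-- The factorial of the length of a multi-index exceeds that of the multi-index by a geometric
factor only, see `factorial_sum_le_mfactorial`; this factor is absorbed by the change of `h`. -/
theorem gsNorm_le_of_isGSBound (ha : 0 ≤ a) (hb : 1 ≤ b) (hh : 0 < h) (hf : IsGSBound a b h C f) :
    gsNorm a b (h / ((d : ℝ) + 1) ^ (a + b)) f ≤ ENNReal.ofReal C := by
  refine gsNorm_le_iff.2 fun x α β => ENNReal.ofReal_le_ofReal ?_
  have hC := hf.nonneg hb hh.le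
  have hα := mfactorial_pos α
  have hβ := mfactorial_pos β
  have hd : (1 : ℝ) ≤ d + 1 := by simp
  set M : ℝ := ((d : ℝ) + 1) ^ (a + b)
  have hM : 0 < M := by positivity
  set m := ∑ i, α i
  set n := ∑ i, β i
  have hfac : ∀ (γ : Fin d → ℕ) (r : ℝ), 0 ≤ r → r ≤ a + b →
      ((∑ i, γ i).factorial : ℝ) ^ r ≤ M ^ (∑ i, γ i) * mfactorial γ ^ r := by
    intro γ r hr hrab
    have hγ := mfactorial_pos γ
    refine (Real.rpow_le_rpow (by positivity) (factorial_sum_le_mfactorial γ) hr).trans ?_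
    rw [Real.mul_rpow (by positivity) hγ.le, ← Real.rpow_natCast, ← Real.rpow_mul (by positivity),
      mul_comm ((∑ i, γ i : ℕ) : ℝ), Real.rpow_mul (by positivity), Real.rpow_natCast]
    gcongr
    exact Real.rpow_le_rpow_of_exponent_le hd hrab
  have h1 := hfac α b (by linarith) (by linarith)
  have h2 := hfac β a ha (by linarith)
  have hw := wt_pos hb hh.le (norm_nonneg x)
  have h3 : h ^ (m + n) * (|monomial α x| * ‖partialDeriv β f x‖) ≤
      C * M ^ (m + n) * (mfactorial α ^ b * mfactorial β ^ a) := by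
    calc _ ≤ h ^ (m + n) * (‖x‖ ^ m * ‖partialDeriv β f x‖) := by
          gcongr
          exact abs_monomial_le α x
      _ = (h * ‖x‖) ^ m * (h ^ n * ‖partialDeriv β f x‖) := by rw [mul_pow, pow_add]; ring
      _ ≤ ((m.factorial : ℝ) ^ b * wt b h ‖x‖) * (h ^ n * ‖partialDeriv β f x‖) := by
          gcongr
          exact pow_le_wt hb hh.le (norm_nonneg x) m
      _ = (m.factorial : ℝ) ^ b * (h ^ n * ‖partialDeriv β f x‖ * wt b h ‖x‖) := by ring
      _ ≤ (M ^ m * mfactorial α ^ b) * (C * (M ^ n * mfactorial β ^ a)) := by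
          have h4 := (hf β x).trans (mul_le_mul_of_nonneg_left h2 hC)
          exact mul_le_mul h1 h4 (by positivity) (by positivity)
      _ = _ := by rw [pow_add]; ring
  rw [norm_mul, Complex.norm_real, Real.norm_eq_abs, Finset.sum_add_distrib, div_pow,
    div_div, div_mul_eq_mul_div, div_le_iff₀ (by positivity)]
  refine h3.trans (le_of_eq ?_)
  ring

theorem mem_gsSubmodule_iff (ha : 0 ≤ a) (hb : 1 ≤ b) :
    f ∈ gsSubmodule a b d ↔ ∃ h > 0, ∃ C, IsGSBound a b h C f := by
  constructor
  · rintro ⟨h, h0, hf⟩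
    exact ⟨h / (d + 1), by positivity, _, isGSBound_of_gsNorm ha hb h0 hf⟩
  · rintro ⟨h, h0, C, hf⟩
    exact ⟨h / ((d : ℝ) + 1) ^ (a + b), by positivity,
      ne_top_of_le_ne_top ENNReal.ofReal_ne_top (gsNorm_le_of_isGSBound ha hb h0 hf)⟩

/-- The Schwartz seminorms are controlled by the bounds on Gelfand-Shilov norms. -/
theorem IsGSBound.seminorm_le (hb : 1 ≤ b) (hh : 0 < h) (hf : IsGSBound a b h C f) (k n : ℕ) :
    SchwartzMap.seminorm ℂ k n f ≤
      C * (d ^ n * ((n.factorial : ℝ) ^ a / h ^ n) * ((k.factorial : ℝ) ^ b / h ^ k)) := by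
  have hC := hf.nonneg hb hh.le
  have hfa := factorial_rpow_pos a n
  have hfb := factorial_rpow_pos b k
  refine SchwartzMap.seminorm_le_bound ℂ k n f (by positivity) fun x => ?_
  have hw := wt_pos hb hh.le (norm_nonneg x)
  have h1 := norm_iteratedFDeriv_le_of_partialDeriv n f x
    (B := C * (n.factorial : ℝ) ^ a / h ^ n * (wt b h ‖x‖)⁻¹) (by positivity) fun γ hγ => by
      have := hf.norm_le hb hh γ x
      rwa [hγ] at this
  have h2 : ‖x‖ ^ k ≤ (k.factorial : ℝ) ^ b / h ^ k * wt b h ‖x‖ := by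
    have := pow_le_wt hb hh.le (norm_nonneg x) k
    rw [mul_pow] at this
    rw [div_mul_eq_mul_div, le_div_iff₀ (by positivity)]
    linarith
  refine (mul_le_mul h2 h1 (norm_nonneg _) (by positivity)).trans (le_of_eq ?_)
  field_simp

end Bound

/-! ### The inductive limit topology and its continuous seminorms -/

section Topology

variable {d : ℕ} {a b : ℝ}

theorem exists_le_of_mem_stepContinuousSeminorms {q : Seminorm ℂ (GelfandShilov a b d)}
    (hq : q ∈ stepContinuousSeminorms a b d) (ha : 0 ≤ a) (hb : 1 ≤ b) {h : ℝ} (hh : 0 < h) :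
    ∃ K : ℝ, 0 ≤ K ∧ ∀ (f : GelfandShilov a b d) (C : ℝ), IsGSBound a b h C f.toSchwartz →
      q f ≤ K * C := by
  obtain ⟨K, hK⟩ := hq (h / ((d : ℝ) + 1) ^ (a + b)) (by positivity)
  refine ⟨max K 0, le_max_right _ _, fun f C hf => ?_⟩
  have hle := gsNorm_le_of_isGSBound ha hb hh hf
  have hC := hf.nonneg hb hh.le
  refine (hK f (ne_top_of_le_ne_top ENNReal.ofReal_ne_top hle)).trans ?_
  have h1 := ENNReal.toReal_mono ENNReal.ofReal_ne_top hle
  rw [ENNReal.toReal_ofReal hC] at h1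
  exact mul_le_mul (le_max_left _ _) h1 ENNReal.toReal_nonneg (le_max_right _ _)

theorem mem_stepContinuousSeminorms_of_le {q : Seminorm ℂ (GelfandShilov a b d)} (ha : 0 ≤ a)
    (hb : 1 ≤ b) (hq : ∀ h : ℝ, 0 < h → ∃ K : ℝ, ∀ (f : GelfandShilov a b d) (C : ℝ),
      IsGSBound a b h C f.toSchwartz → q f ≤ K * C) :
    q ∈ stepContinuousSeminorms a b d := by
  intro h h0
  obtain ⟨K, hK⟩ := hq (h / (d + 1)) (by positivity)
  exact ⟨K, fun f hf => hK f _ (isGSBound_of_gsNorm ha hb h0 hf)⟩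

theorem mem_stepContinuousSeminorms_of_continuous {q : Seminorm ℂ (GelfandShilov a b d)}
    (hq : Continuous q) : q ∈ stepContinuousSeminorms a b d := by
  obtain ⟨s, K, -, hK⟩ := Seminorm.bound_of_continuous (gs_withSeminorms a b d) q hq
  intro h h0
  choose C hC using fun p : stepContinuousSeminorms a b d => p.2 h h0
  refine ⟨K * ∑ p ∈ s, |C p|, fun f hf => (hK f).trans ?_⟩
  rw [smul_apply, NNReal.smul_def, smul_eq_mul, mul_assoc]
  refine mul_le_mul_of_nonneg_left (Seminorm.finset_sup_apply_le
    (mul_nonneg (Finset.sum_nonneg fun _ _ => abs_nonneg _) ENNReal.toReal_nonneg)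
    fun p hp => (hC p f hf).trans (mul_le_mul_of_nonneg_right ?_ ENNReal.toReal_nonneg)) K.2
  exact (le_abs_self _).trans
    (Finset.single_le_sum (f := fun p => |C p|) (fun _ _ => abs_nonneg _) hp)

theorem exists_norm_apply_le (F : GSDual a b d) (ha : 0 ≤ a) (hb : 1 ≤ b) {h : ℝ} (hh : 0 < h) :
    ∃ K : ℝ, 0 ≤ K ∧ ∀ (f : GelfandShilov a b d) (C : ℝ), IsGSBound a b h C f.toSchwartz →
      ‖F f‖ ≤ K * C :=
  exists_le_of_mem_stepContinuousSeminorms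
    (q := (normSeminorm ℂ ℂ).comp F.toLinearMap)
    (mem_stepContinuousSeminorms_of_continuous (continuous_norm.comp F.continuous)) ha hb hh

/-- A linear map that is bounded from each step to some step is continuous. -/
theorem continuous_of_isGSBound {a' b' : ℝ} (ha : 0 ≤ a) (hb : 1 ≤ b) (ha' : 0 ≤ a') (hb' : 1 ≤ b')
    (T : GelfandShilov a b d →ₗ[ℂ] GelfandShilov a' b' d)
    (hT : ∀ h : ℝ, 0 < h → ∃ h' > 0, ∃ K : ℝ, ∀ (f : GelfandShilov a b d) (C : ℝ),
      IsGSBound a b h C f.toSchwartz → IsGSBound a' b' h' (K * C) (T f).toSchwartz) :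
    Continuous T := by
  refine (gs_withSeminorms a' b' d).continuous_of_continuous_comp T fun q => ?_
  refine continuous_of_mem_stepContinuousSeminorms (q := q.1.comp T)
    (mem_stepContinuousSeminorms_of_le ha hb fun h h0 => ?_)
  obtain ⟨h', h0', K, hK⟩ := hT h h0
  obtain ⟨K', -, hK'⟩ := exists_le_of_mem_stepContinuousSeminorms q.2 ha' hb' h0'
  exact ⟨K' * K, fun f C hf => by
    rw [Seminorm.comp_apply, mul_assoc]
    exact hK' _ _ (hK f C hf)⟩

/-- Convergence in a single step implies convergence in the inductive limit. -/
theorem tendsto_of_isGSBound {ι : Type*} {l : Filter ι} (ha : 0 ≤ a) (hb : 1 ≤ b) {h : ℝ}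
    (hh : 0 < h) {u : ι → GelfandShilov a b d} {f : GelfandShilov a b d} {C : ι → ℝ}
    (hC : Tendsto C l (𝓝 0))
    (hu : ∀ᶠ i in l, IsGSBound a b h (C i) ((u i).toSchwartz - f.toSchwartz)) :
    Tendsto u l (𝓝 f) := by
  refine ((gs_withSeminorms a b d).tendsto_nhds u f).2 fun q ε hε => ?_
  obtain ⟨K, -, hK⟩ := exists_le_of_mem_stepContinuousSeminorms q.2 ha hb hh
  have h1 : Tendsto (fun i => K * C i) l (𝓝 0) := by simpa using hC.const_mul K
  filter_upwards [h1.eventually_lt_const hε, hu] with i hi hui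
  exact (hK (u i - f) (C i) hui).trans_lt hi

end Topology

/-! ### Absolutely convergent series -/

section Series

variable {d : ℕ} {a b h : ℝ} {ι : Type*}

/-- A series of Schwartz functions that converges absolutely with respect to each of the Schwartz
seminorms converges in the Schwartz space. -/
theorem exists_hasSum_of_summable_seminorm {f : ι → 𝓢(Rd d, ℂ)}
    (hf : ∀ k n, Summable fun i => SchwartzMap.seminorm ℂ k n (f i)) :
    ∃ F : 𝓢(Rd d, ℂ), HasSum f F := by
  have hfs : ∀ i, ContDiff ℝ (⊤ : ℕ∞) (f i) := fun i => (f i).smooth ⊤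
  have hbd : ∀ (n : ℕ) (i : ι) (x : Rd d),
      ‖iteratedFDeriv ℝ n (f i) x‖ ≤ SchwartzMap.seminorm ℂ 0 n (f i) :=
    fun n i x => (f i).norm_iteratedFDeriv_le_seminorm ℂ n x
  have hder : ∀ (n : ℕ) (x : Rd d), iteratedFDeriv ℝ n (fun y => ∑' i, f i y) x =
      ∑' i, iteratedFDeriv ℝ n (f i) x := fun n x =>
    iteratedFDeriv_tsum_apply (N := (⊤ : ℕ∞)) hfs (fun n _ => hf 0 n)
      (fun n i x _ => hbd n i x) le_top x
  have hsumn : ∀ (n : ℕ) (x : Rd d), Summable fun i => iteratedFDeriv ℝ n (f i) x := fun n x =>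
    Summable.of_norm_bounded (hf 0 n) fun i => hbd n i x
  have hmul : ∀ (k n : ℕ) (x : Rd d) (i : ι), ‖x‖ ^ k * ‖iteratedFDeriv ℝ n (f i) x‖ ≤
      SchwartzMap.seminorm ℂ k n (f i) := fun k n x i => (f i).le_seminorm ℂ k n x
  -- the same estimate serves for the decay of the sum and for the tails of the series
  have htail : ∀ (s : Set ι) (k n : ℕ) (x : Rd d),
      ‖x‖ ^ k * ‖∑' i : s, iteratedFDeriv ℝ n (f i) x‖ ≤
        ∑' i : s, SchwartzMap.seminorm ℂ k n (f i) := by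
    intro s k n x
    have h1 : ‖∑' i : s, ‖x‖ ^ k • iteratedFDeriv ℝ n (f i) x‖ ≤
        ∑' i : s, SchwartzMap.seminorm ℂ k n (f i) := by
      refine tsum_of_norm_bounded ((hf k n).subtype s).hasSum fun i => ?_
      rw [norm_smul, norm_pow, norm_norm]
      exact hmul k n x i
    have h2 : Summable fun i : s => iteratedFDeriv ℝ n (f i) x := (hsumn n x).subtype s
    rwa [h2.tsum_const_smul, norm_smul, norm_pow, norm_norm] at h1
  let F : 𝓢(Rd d, ℂ) :=
    { toFun := fun x => ∑' i, f i x
      smooth' := contDiff_tsum (N := (⊤ : ℕ∞)) hfs (fun n _ => hf 0 n)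
        (fun n i x _ => hbd n i x)
      decay' := fun k n => ⟨∑' i, SchwartzMap.seminorm ℂ k n (f i), fun x => by
        rw [hder]
        have := htail Set.univ k n x
        rwa [tsum_univ (fun i => iteratedFDeriv ℝ n (f i) x),
          tsum_univ (fun i => SchwartzMap.seminorm ℂ k n (f i))] at this⟩ }
  refine ⟨F, ((schwartz_withSeminorms ℂ (Rd d) ℂ).tendsto_nhds _ _).2 ?_⟩
  rintro ⟨k, n⟩ ε hε
  have h0 := tendsto_tsum_compl_atTop_zero fun i => SchwartzMap.seminorm ℂ k n (f i)
  filter_upwards [h0.eventually_lt_const hε] with s hs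
  refine lt_of_le_of_lt ?_ hs
  rw [SchwartzMap.schwartzSeminormFamily_apply, ← map_neg_eq_map, neg_sub]
  refine SchwartzMap.seminorm_le_bound ℂ k n _ (tsum_nonneg fun i => apply_nonneg _ _) fun x => ?_
  have h1 : iteratedFDeriv ℝ n (F - ∑ i ∈ s, f i : 𝓢(Rd d, ℂ)) x =
      ∑' i : {i // i ∉ s}, iteratedFDeriv ℝ n (f i) x := by
    have e1 : ((F - ∑ i ∈ s, f i : 𝓢(Rd d, ℂ)) : Rd d → ℂ) =
        (F : Rd d → ℂ) - fun x => ∑ i ∈ s, f i x := by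
      funext x
      simp [sub_apply, sum_apply]
    rw [e1, iteratedFDeriv_sub_apply ((F.smooth n).contDiffAt)
      ((ContDiff.sum fun i _ => (f i).smooth n).contDiffAt), iteratedFDeriv_sum
      (fun i _ => (f i).smooth n)]
    rw [show iteratedFDeriv ℝ n F x = _ from hder n x, Finset.sum_apply, sub_eq_iff_eq_add',
      (hsumn n x).sum_add_tsum_subtype_compl s]
  rw [h1]
  exact htail {i | i ∉ s} k n x

/-- Evaluation of derivatives commutes with convergent series in the Schwartz space. -/
theorem hasSum_partialDeriv_apply {f : ι → 𝓢(Rd d, ℂ)} {F : 𝓢(Rd d, ℂ)} (hF : HasSum f F)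
    (β : Fin d → ℕ) (x : Rd d) : HasSum (fun i => partialDeriv β (f i) x) (partialDeriv β F x) := by
  have h1 := hF.mapL (partialDeriv β)
  have h2 := h1.mapL (SchwartzMap.toBoundedContinuousFunctionCLM ℂ (Rd d) ℂ)
  exact h2.mapL (BoundedContinuousFunction.evalCLM ℂ x)

theorem hasSum_apply {f : ι → 𝓢(Rd d, ℂ)} {F : 𝓢(Rd d, ℂ)} (hF : HasSum f F) (x : Rd d) :
    HasSum (fun i => f i x) (F x) := by
  simpa [partialDeriv_zero] using hasSum_partialDeriv_apply hF 0 x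

theorem isGSBound_of_hasSum {f : ι → 𝓢(Rd d, ℂ)} {F : 𝓢(Rd d, ℂ)} (hF : HasSum f F) (hb : 1 ≤ b)
    (hh : 0 ≤ h) {C : ι → ℝ} {S : ℝ} (hC : HasSum C S) (hf : ∀ i, IsGSBound a b h (C i) (f i)) :
    IsGSBound a b h S F := by
  intro β x
  have hw := wt_pos hb hh (norm_nonneg x)
  have h1 := hasSum_partialDeriv_apply hF β x
  have h2 : HasSum (fun i => ((h ^ (∑ i, β i) * wt b h ‖x‖ : ℝ) : ℂ) * partialDeriv β (f i) x) _ :=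
    h1.mul_left _
  have h3 := tsum_of_norm_bounded (f := fun i =>
    ((h ^ (∑ i, β i) * wt b h ‖x‖ : ℝ) : ℂ) * partialDeriv β (f i) x)
    (hC.mul_right (((∑ i, β i).factorial : ℝ) ^ a)) fun i => by
    rw [norm_mul, Complex.norm_real, Real.norm_of_nonneg (by positivity)]
    linarith [hf i β x]
  rw [h2.tsum_eq, norm_mul, Complex.norm_real, Real.norm_of_nonneg (by positivity)] at h3
  linarith

/-- A series that converges absolutely in a single step of the inductive limit converges, both in
the Schwartz space and in the Gelfand-Shilov space. -/
theorem exists_hasSum_of_isGSBound (ha : 0 ≤ a) (hb : 1 ≤ b) (hh : 0 < h)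
    {f : ι → GelfandShilov a b d} {C : ι → ℝ} (hC : Summable C)
    (hf : ∀ i, IsGSBound a b h (C i) (f i).toSchwartz) :
    ∃ F : GelfandShilov a b d, HasSum f F ∧ HasSum (fun i => (f i).toSchwartz) F.toSchwartz ∧
      IsGSBound a b h (∑' i, C i) F.toSchwartz := by
  obtain ⟨F, hF⟩ := exists_hasSum_of_summable_seminorm (f := fun i => (f i).toSchwartz)
    fun k n => (hC.mul_right _).of_nonneg_of_le (fun i => apply_nonneg _ _)
      fun i => (hf i).seminorm_le hb hh k n
  have hFb := isGSBound_of_hasSum hF hb hh.le hC.hasSum hf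
  refine ⟨⟨F, (mem_gsSubmodule_iff ha hb).2 ⟨h, hh, _, hFb⟩⟩, ?_, hF, hFb⟩
  refine tendsto_of_isGSBound ha hb hh (tendsto_tsum_compl_atTop_zero C)
    (Eventually.of_forall fun s => ?_)
  have h1 : HasSum (fun i : {i // i ∉ s} => (f i).toSchwartz) (F - ∑ i ∈ s, (f i).toSchwartz) := by
    rw [Finset.hasSum_compl_iff s (f := fun i => (f i).toSchwartz)]
    simpa using hF
  have h2 := (isGSBound_of_hasSum h1 hb hh.le (S := ∑' i : {i // i ∉ s}, C i)
    (hC.subtype {i | i ∉ s}).hasSum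
    fun i => hf i).smul (-1)
  have h3 : (∑ i ∈ s, f i).toSchwartz = ∑ i ∈ s, (f i).toSchwartz :=
    map_sum ({ toFun := GelfandShilov.toSchwartz, map_zero' := rfl, map_add' := fun _ _ => rfl } :
      GelfandShilov a b d →+ 𝓢(Rd d, ℂ)) f s
  simpa only [h3, norm_neg, norm_one, one_mul, neg_smul, one_smul, neg_sub] using h2

end Series

/-! ### Kernels built from lattice translates -/

section Kernel

variable {d : ℕ} {b h : ℝ}

/-- `χ` is `O(1 / wt b h ‖x‖)`, with constant `C`. -/
def HasDecay (b h C : ℝ) (χ : Rd d → ℂ) : Prop := ∀ x, ‖χ x‖ * wt b h ‖x‖ ≤ C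

theorem HasDecay.norm_le {C : ℝ} {χ : Rd d → ℂ} (hb : 1 ≤ b) (hh : 0 ≤ h) (hχ : HasDecay b h C χ)
    (x : Rd d) : ‖χ x‖ ≤ C * (wt b h ‖x‖)⁻¹ := by
  rw [← div_eq_mul_inv, le_div_iff₀ (wt_pos hb hh (norm_nonneg x))]
  exact hχ x

theorem HasDecay.nonneg {C : ℝ} {χ : Rd d → ℂ} (hb : 1 ≤ b) (hh : 0 ≤ h)
    (hχ : HasDecay b h C χ) : 0 ≤ C :=
  le_trans (mul_nonneg (norm_nonneg _) (wt_pos hb hh (norm_nonneg _)).le) (hχ 0)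

theorem HasDecay.norm_le' {C : ℝ} {χ : Rd d → ℂ} (hb : 1 ≤ b) (hh : 0 ≤ h)
    (hχ : HasDecay b h C χ) (x : Rd d) : ‖χ x‖ ≤ C :=
  (le_mul_of_one_le_right (norm_nonneg _) (one_le_wt hb hh (norm_nonneg x))).trans (hχ x)

theorem HasDecay.mono {C h' b' : ℝ} {χ : Rd d → ℂ} (hb : 1 ≤ b) (h0 : 0 ≤ h') (hle : h' ≤ h)
    (hbb : b ≤ b') (hχ : HasDecay b h C χ) : HasDecay b' h' C χ := fun x => by
  refine le_trans (mul_le_mul_of_nonneg_left ?_ (norm_nonneg _)) (hχ x)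
  exact (wt_anti hb hbb h0 (norm_nonneg x)).trans (wt_mono hb (mul_nonneg h0 (norm_nonneg x))
    (h0.trans hle) (norm_nonneg x) (mul_le_mul_of_nonneg_right hle (norm_nonneg x)))

theorem IsGSBound.hasDecay {a C : ℝ} {f : 𝓢(Rd d, ℂ)} (hh : 0 < h)
    (hf : IsGSBound a b h C f) (β : Fin d → ℕ) :
    HasDecay b h (C * ((∑ i, β i).factorial : ℝ) ^ a / h ^ (∑ i, β i)) (partialDeriv β f) := by
  intro x
  rw [le_div_iff₀ (by positivity)]
  linarith [hf β x]

theorem IsGSBound.hasDecay_zero {a C : ℝ} {f : 𝓢(Rd d, ℂ)} (hf : IsGSBound a b h C f) :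
    HasDecay b h C f := by
  intro x
  have := hf 0 x
  simpa [partialDeriv_zero] using this

/-- Two decaying factors give decay in the distance of their centres, with something to spare. -/
theorem wt_mul_wt_le {r p q : ℝ} (hb : 1 ≤ b) (hh : 0 ≤ h) (hr : 0 ≤ r) (hp : 0 ≤ p) (hq : 0 ≤ q)
    (hle : r ≤ p + q) : wt b (h / 2 ^ b / 2) r * wt b (h / 2 ^ b) p ≤ wt b h p * wt b h q := by
  have h2 : (1 : ℝ) ≤ 2 ^ b := Real.one_le_rpow (by norm_num) (by linarith)
  have h1 : 0 ≤ h / 2 ^ b := by positivity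
  have hle' : h / 2 ^ b ≤ h := div_le_self hh h2
  have e1 := wt_half_le_mul hb h1 hr hp hq hle
  have e2 := wt_div_sq_le hb hh hp
  have e3 : wt b (h / 2 ^ b) q ≤ wt b h q := wt_mono hb (by positivity) hh hq (by gcongr)
  have p1 := wt_pos hb h1 hp
  have p2 := wt_pos hb h1 hq
  have p3 := wt_pos hb hh hp
  calc _ ≤ (wt b (h / 2 ^ b) p * wt b (h / 2 ^ b) q) * wt b (h / 2 ^ b) p := by gcongr
    _ = (wt b (h / 2 ^ b) p * wt b (h / 2 ^ b) p) * wt b (h / 2 ^ b) q := by ring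
    _ ≤ _ := by gcongr

theorem HasDecay.norm_mul_le {C C' r : ℝ} {χ η : Rd d → ℂ} (hb : 1 ≤ b) (hh : 0 ≤ h)
    (hχ : HasDecay b h C χ) (hη : HasDecay b h C' η) {x y : Rd d} (hr : 0 ≤ r)
    (hle : r ≤ ‖x‖ + ‖y‖) :
    ‖χ x * η y‖ ≤ C * C' * (wt b (h / 2 ^ b / 2) r)⁻¹ * (wt b (h / 2 ^ b) ‖x‖)⁻¹ := by
  have h1 := wt_mul_wt_le hb hh hr (norm_nonneg x) (norm_nonneg y) hle
  have p1 := wt_pos hb (by positivity : 0 ≤ h / 2 ^ b / 2) hr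
  have p2 := wt_pos hb (by positivity : 0 ≤ h / 2 ^ b) (norm_nonneg x)
  have hC := hχ.nonneg hb hh
  rw [norm_mul, ← div_eq_mul_inv, ← div_eq_mul_inv, div_div, le_div_iff₀ (by positivity)]
  calc _ ≤ ‖χ x‖ * ‖η y‖ * (wt b h ‖x‖ * wt b h ‖y‖) := by gcongr
    _ = (‖χ x‖ * wt b h ‖x‖) * (‖η y‖ * wt b h ‖y‖) := by ring
    _ ≤ C * C' := mul_le_mul (hχ x) (hη y)
        (mul_nonneg (norm_nonneg _) (wt_pos hb hh (norm_nonneg y)).le) hC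

theorem HasDecay.integrable {C : ℝ} {χ : Rd d → ℂ} (hb : 1 ≤ b) (hh : 0 < h)
    (hχ : HasDecay b h C χ) (hc : Continuous χ) : Integrable χ := by
  obtain ⟨K, hK, H⟩ := exists_inv_wt_le hb hh (d + 1)
  have hC := hχ.nonneg hb hh.le
  refine ((integrable_inv_one_add_norm_pow d).const_mul (C * K)).mono' hc.aestronglyMeasurable
    (Eventually.of_forall fun x => (hχ.norm_le hb hh.le x).trans ?_)
  rw [mul_assoc]
  exact mul_le_mul_of_nonneg_left (H _ (norm_nonneg x)) hC

/-- The kernel `∑_k χ(u - k) η(v - k)`. -/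
noncomputable def kernelSum (χ η : Rd d → ℂ) (u v : Rd d) : ℂ :=
  ∑' k : Fin d → ℤ, χ (u - latticePoint k) * η (v - latticePoint k)

theorem kernelZero_eq_kernelSum (φ : 𝓢(Rd d, ℂ)) (u v : Rd d) :
    kernelZero φ u v = kernelSum φ (conjugate φ) u v := rfl

theorem kernelSum_add_latticePoint (χ η : Rd d → ℂ) (u v : Rd d) (l : Fin d → ℤ) :
    kernelSum χ η (u + latticePoint l) (v + latticePoint l) = kernelSum χ η u v := by
  rw [kernelSum, kernelSum, ← (Equiv.addRight l).tsum_eq]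
  refine tsum_congr fun k => ?_
  simp only [Equiv.coe_addRight, latticePoint_add, add_sub_add_right_eq_sub]

/-- Off-diagonal decay of the kernels. -/
theorem exists_norm_kernelSum_le (hb : 1 ≤ b) (hh : 0 < h) :
    ∃ S : ℝ, 0 < S ∧ ∀ (χ η : Rd d → ℂ) (C C' : ℝ), HasDecay b h C χ → HasDecay b h C' η →
      ∀ u v, (Summable fun k => χ (u - latticePoint k) * η (v - latticePoint k)) ∧
        ‖kernelSum χ η u v‖ ≤ C * C' * S * (wt b (h / 2 ^ b / 2) ‖v - u‖)⁻¹ := by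
  obtain ⟨S, hS, H⟩ := exists_tsum_inv_wt_le d hb (by positivity : 0 < h / 2 ^ b)
  refine ⟨S, hS, fun χ η C C' hχ hη u v => ?_⟩
  have hC := hχ.nonneg hb hh.le
  have hC' := hη.nonneg hb hh.le
  obtain ⟨hs, hle⟩ := H u
  have hbd : ∀ k, ‖χ (u - latticePoint k) * η (v - latticePoint k)‖ ≤
      C * C' * (wt b (h / 2 ^ b / 2) ‖v - u‖)⁻¹ * (wt b (h / 2 ^ b) ‖u - latticePoint k‖)⁻¹ :=
    fun k => hχ.norm_mul_le hb hh.le hη (norm_nonneg _) (by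
      rw [add_comm]
      simpa using norm_sub_le (v - latticePoint k) (u - latticePoint k))
  have p := wt_pos hb (by positivity : 0 ≤ h / 2 ^ b / 2) (norm_nonneg (v - u))
  refine ⟨Summable.of_norm_bounded (hs.mul_left _) hbd,
    (tsum_of_norm_bounded (hs.mul_left _).hasSum hbd).trans ?_⟩
  rw [tsum_mul_left]
  calc _ ≤ C * C' * (wt b (h / 2 ^ b / 2) ‖v - u‖)⁻¹ * S := by gcongr
    _ = _ := by ring

theorem summable_norm_sub_latticePoint {C : ℝ} {χ : Rd d → ℂ} (hb : 1 ≤ b) (hh : 0 < h)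
    (hχ : HasDecay b h C χ) (u : Rd d) : Summable fun k => ‖χ (u - latticePoint k)‖ := by
  obtain ⟨S, -, H⟩ := exists_tsum_inv_wt_le d hb hh
  exact ((H u).1.mul_left C).of_nonneg_of_le (fun _ => norm_nonneg _)
    fun k => hχ.norm_le hb hh.le _

theorem continuous_kernelSum {C C' : ℝ} {χ η : Rd d → ℂ} (hb : 1 ≤ b) (hh : 0 < h)
    (hχ : HasDecay b h C χ) (hη : HasDecay b h C' η) (hc : Continuous η) (u : Rd d) :
    Continuous (kernelSum χ η u) := by
  refine continuous_tsum
    (fun k => continuous_const.mul (hc.comp (continuous_id.sub continuous_const)))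
    ((summable_norm_sub_latticePoint hb hh hχ u).mul_right C') fun k v => ?_
  rw [norm_mul]
  exact mul_le_mul_of_nonneg_left (hη.norm_le' hb hh.le _) (norm_nonneg _)

/-- Integration against the kernel can be carried out term by term. -/
theorem integrable_mul_kernelSum {C C' : ℝ} {χ η : Rd d → ℂ} (hb : 1 ≤ b) (hh : 0 < h)
    (hχ : HasDecay b h C χ) (hη : HasDecay b h C' η) (hc : Continuous η) {f : Rd d → ℂ} {B : ℝ}
    (hf : Continuous f) (hB : ∀ x, ‖f x‖ ≤ B) (u : Rd d) :
    Integrable (fun y => f y * kernelSum χ η u y) ∧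
      HasSum (fun k => χ (u - latticePoint k) * ∫ y, f y * η (y - latticePoint k))
        (∫ y, f y * kernelSum χ η u y) := by
  have hB0 : 0 ≤ B := (norm_nonneg _).trans (hB 0)
  have hηi := hη.integrable hb hh hc
  have hint : ∀ k : Fin d → ℤ, Integrable fun y => f y * η (y - latticePoint k) := fun k =>
    (hηi.comp_sub_right (latticePoint k)).bdd_mul hf.aestronglyMeasurable (c := B)
      (Eventually.of_forall hB)
  constructor
  · obtain ⟨S, hS, H⟩ := exists_norm_kernelSum_le (d := d) hb hh
    have hK : HasDecay b (h / 2 ^ b / 2) (C * C' * S) fun w => kernelSum χ η u (u + w) := by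
      intro w
      have h1 := (H χ η C C' hχ hη u (u + w)).2
      rw [add_sub_cancel_left, ← div_eq_mul_inv, le_div_iff₀ (wt_pos hb (by positivity)
        (norm_nonneg w))] at h1
      exact h1
    have hcont := continuous_kernelSum hb hh hχ hη hc u
    have h2 := (hK.integrable hb (by positivity)
      (hcont.comp (continuous_const.add continuous_id))).comp_sub_right u
    simp only [add_sub_cancel] at h2
    exact h2.bdd_mul hf.aestronglyMeasurable (c := B) (Eventually.of_forall hB)
  · have h1 := hasSum_integral_of_summable_integral_norm (μ := (volume : Measure (Rd d)))
      (F := fun k y => χ (u - latticePoint k) * (f y * η (y - latticePoint k)))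
      (fun k => (hint k).const_mul _) ?_
    · have e1 : ∀ y, ∑' k : Fin d → ℤ, χ (u - latticePoint k) * (f y * η (y - latticePoint k)) =
          f y * kernelSum χ η u y := fun y => by
        rw [kernelSum, ← tsum_mul_left]
        exact tsum_congr fun k => by ring
      simp only [e1, integral_const_mul] at h1
      exact h1
    · refine ((summable_norm_sub_latticePoint hb hh hχ u).mul_right
        (B * ∫ y, ‖η y‖)).of_nonneg_of_le (fun k => integral_nonneg fun y => norm_nonneg _)
        fun k => ?_
      simp only [norm_mul]
      rw [integral_const_mul]
      refine mul_le_mul_of_nonneg_left ?_ (norm_nonneg _)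
      rw [← integral_sub_right_eq_self (fun y => ‖η y‖) (latticePoint k), ← integral_const_mul]
      refine integral_mono (by simpa only [norm_mul] using (hint k).norm)
        ((hηi.norm.comp_sub_right _).const_mul _) fun y => ?_
      exact mul_le_mul_of_nonneg_right (hB y) (norm_nonneg _)

end Kernel

/-! ### The operator with kernel `q₀` -/

section Operator

variable {d : ℕ}

/-- A series `∑_k c_k φ(x - k)` with decaying coefficients converges absolutely in a single step of
the inductive limit. -/
theorem exists_hasSum_smul_translate (d : ℕ) {a t h : ℝ} (ha : 0 ≤ a) (ht : 1 ≤ t) (hh : 0 < h) :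
    ∃ h' > 0, ∃ S : ℝ, ∀ (φ : 𝓢(Rd d, ℂ)) (e : (Fin d → ℤ) → GelfandShilov a t d) (C A : ℝ)
      (c : (Fin d → ℤ) → ℂ), IsGSBound a t h C φ →
        (∀ k, (e k).toSchwartz = translate (latticePoint k) φ) →
        (∀ k, ‖c k‖ ≤ A * (wt t h ‖latticePoint k‖)⁻¹) →
        ∃ F : GelfandShilov a t d, HasSum (fun k => c k • e k) F ∧
          HasSum (fun k => c k • translate (latticePoint k) φ) F.toSchwartz ∧
          IsGSBound a t h' (S * (C * A)) F.toSchwartz := by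
  have h2 : (1 : ℝ) ≤ 2 ^ t := Real.one_le_rpow (by norm_num) (by linarith)
  set h₂ := h / 2 ^ t
  have p₂ : 0 < h₂ := by positivity
  have hle : h₂ ≤ h := div_le_self hh.le h2
  obtain ⟨S, hS, HS⟩ := exists_tsum_inv_wt_le d ht p₂
  refine ⟨h₂ / 2, by positivity, S, fun φ e C A c hφ he hc => ?_⟩
  have hC := hφ.nonneg ht hh.le
  have hA : 0 ≤ A := by
    have h1 := (norm_nonneg _).trans (hc 0)
    have h3 := inv_pos.2 (wt_pos ht hh.le (norm_nonneg (latticePoint (0 : Fin d → ℤ))))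
    exact nonneg_of_mul_nonneg_left h1 h3
  set B : (Fin d → ℤ) → ℝ := fun k => C * A * (wt t h₂ ‖(0 : Rd d) - latticePoint k‖)⁻¹
  have hbd : ∀ k, IsGSBound a t (h₂ / 2) (B k) (c k • e k).toSchwartz := by
    intro k
    rw [GelfandShilov.toSchwartz_smul, he]
    refine (((hφ.mono ht p₂.le hle).translate ht p₂.le (latticePoint k)).smul _).mono_right ?_
    have q₁ := wt_pos ht hh.le (norm_nonneg (latticePoint k))
    have q₂ := wt_pos ht p₂.le (norm_nonneg (latticePoint k))
    have h4 := wt_div_sq_le ht hh.le (norm_nonneg (latticePoint k))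
    simp only [B, zero_sub, norm_neg]
    calc _ ≤ A * (wt t h ‖latticePoint k‖)⁻¹ * (C * wt t h₂ ‖latticePoint k‖) := by
          have := hc k
          gcongr
      _ = C * A * (wt t h₂ ‖latticePoint k‖ / wt t h ‖latticePoint k‖) := by
          rw [div_eq_mul_inv]; ring
      _ ≤ _ := by
          gcongr
          rw [div_le_iff₀ q₁, ← div_le_iff₀' (by positivity), div_inv_eq_mul]
          exact h4
  obtain ⟨F, hF₁, hF₂, hF₃⟩ := exists_hasSum_of_isGSBound ha ht (by positivity : 0 < h₂ / 2)
    ((HS 0).1.mul_left _) hbd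
  refine ⟨F, hF₁, hF₂.congr_fun fun k => ?_, hF₃.mono_right ?_⟩
  · rw [GelfandShilov.toSchwartz_smul, he]
  · rw [tsum_mul_left, mul_comm]
    exact mul_le_mul_of_nonneg_right (HS 0).2 (by positivity)

/-- The integrals of decaying functions against lattice translates of decaying functions decay. -/
theorem exists_integral_norm_mul_le (d : ℕ) {t h : ℝ} (ht : 1 ≤ t) (hh : 0 < h) :
    ∃ J : ℝ, 0 ≤ J ∧ ∀ (f η : 𝓢(Rd d, ℂ)) (C C' : ℝ), HasDecay t h C f → HasDecay t h C' η →
      ∀ k : Fin d → ℤ, ∫ y, ‖f y * η (y - latticePoint k)‖ ≤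
        C * C' * J * (wt t (h / 2 ^ t / 2) ‖latticePoint k‖)⁻¹ := by
  obtain ⟨K, hK, HK⟩ := exists_inv_wt_le ht (by positivity : 0 < h / 2 ^ t) (d + 1)
  refine ⟨K * ∫ y : Rd d, ((1 + ‖y‖) ^ (d + 1))⁻¹,
    mul_nonneg hK.le (integral_nonneg fun y => by positivity), fun f η C C' hf hη k => ?_⟩
  have nη := hη.nonneg ht hh.le
  have nf := hf.nonneg ht hh.le
  have q := wt_pos ht (by positivity : 0 ≤ h / 2 ^ t / 2) (norm_nonneg (latticePoint k))
  have h3 := integral_mono_of_nonneg (μ := (volume : Measure (Rd d)))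
    (f := fun y => ‖f y * η (y - latticePoint k)‖) (Eventually.of_forall fun y => norm_nonneg _)
    ((integrable_inv_one_add_norm_pow d).const_mul
      (C * C' * (wt t (h / 2 ^ t / 2) ‖latticePoint k‖)⁻¹ * K))
    (Eventually.of_forall fun y => by
      refine (hf.norm_mul_le ht hh.le hη (norm_nonneg (latticePoint k)) ?_).trans ?_
      · simpa using norm_sub_le y (y - latticePoint k)
      · beta_reduce
        rw [mul_assoc _ K]
        exact mul_le_mul_of_nonneg_left (HK _ (norm_nonneg y)) (by positivity))
  rw [integral_const_mul] at h3
  refine h3.trans (le_of_eq ?_)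
  ring

/-- The series `∑_k (∫ f(y) η(y - k) dy) φ(x - k)` converges absolutely in a single step of the
inductive limit, which depends only on the decay of `f`, `φ` and `η`. -/
theorem exists_hasSum_translate (d : ℕ) {a t h : ℝ} (ha : 0 ≤ a) (ht : 1 ≤ t) (hh : 0 < h) :
    ∃ h' > 0, ∃ S : ℝ, ∀ (φ η f : 𝓢(Rd d, ℂ)) (e : (Fin d → ℤ) → GelfandShilov a t d)
      (Cφ Cη C : ℝ), IsGSBound a t h Cφ φ → HasDecay t h Cη η → HasDecay t h C f →
        (∀ k, (e k).toSchwartz = translate (latticePoint k) φ) →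
        ∃ F : GelfandShilov a t d,
          HasSum (fun k => (∫ y, f y * η (y - latticePoint k)) • e k) F ∧
          HasSum (fun k => (∫ y, f y * η (y - latticePoint k)) • translate (latticePoint k) φ)
            F.toSchwartz ∧
          IsGSBound a t h' (S * (Cφ * (C * Cη))) F.toSchwartz := by
  have h2 : (1 : ℝ) ≤ 2 ^ t := Real.one_le_rpow (by norm_num) (by linarith)
  have p₁ : 0 < h / 2 ^ t / 2 := by positivity
  have hle : h / 2 ^ t / 2 ≤ h := (half_le_self (by positivity)).trans (div_le_self hh.le h2)
  obtain ⟨J, hJ, HJ⟩ := exists_integral_norm_mul_le d ht hh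
  obtain ⟨h', h0', S, HS⟩ := exists_hasSum_smul_translate d ha ht p₁
  refine ⟨h', h0', S * J, fun φ η f e Cφ Cη C hφ hη hf he => ?_⟩
  obtain ⟨F, hF₁, hF₂, hF₃⟩ := HS φ e Cφ (C * Cη * J)
    (fun k => ∫ y, f y * η (y - latticePoint k)) (hφ.mono ht p₁.le hle) he
    fun k => (norm_integral_le_integral_norm _).trans (HJ f η C Cη hf hη k)
  refine ⟨F, hF₁, hF₂, hF₃.mono_right (le_of_eq ?_)⟩
  ring

/-- The lattice translates of an element of a Gelfand-Shilov space. -/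
theorem exists_eq_translate {a t h C : ℝ} (ha : 0 ≤ a) (ht : 1 ≤ t) (hh : 0 < h)
    {φ : 𝓢(Rd d, ℂ)} (hφ : IsGSBound a t h C φ) : ∃ e : (Fin d → ℤ) → GelfandShilov a t d,
      ∀ k, (e k).toSchwartz = translate (latticePoint k) φ :=
  ⟨fun k => ⟨translate (latticePoint k) φ, (mem_gsSubmodule_iff ha ht).2
    ⟨_, by positivity, _, hφ.translate ht hh.le (latticePoint k)⟩⟩, fun _ => rfl⟩

/-- Derivatives of the sum of the series are given by integration against the kernel. -/
theorem partialDeriv_eq_integral_kernelSum {a t h Cφ Cη : ℝ} (ht : 1 ≤ t) (hh : 0 < h)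
    {φ η f F : 𝓢(Rd d, ℂ)} (hφ : IsGSBound a t h Cφ φ) (hη : HasDecay t h Cη η)
    (hF : HasSum (fun k => (∫ y, f y * η (y - latticePoint k)) • translate (latticePoint k) φ) F)
    (β : Fin d → ℕ) (u : Rd d) :
    partialDeriv β F u = ∫ y, f y * kernelSum (partialDeriv β φ) η u y := by
  have h1 := hasSum_partialDeriv_apply hF β u
  have h2 := (integrable_mul_kernelSum ht hh (hφ.hasDecay hh β) hη η.continuous f.continuous
    (fun x => f.norm_le_seminorm ℂ x) u).2
  refine h1.unique (h2.congr_fun fun k => ?_)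
  rw [map_smul, partialDeriv_translate]
  exact mul_comm _ _

end Operator

/-! ### Orthogonal projections onto the spaces of a multiresolution analysis -/

section Projection

variable {d : ℕ}

theorem quasiMeasurePreserving_smul_Rd {c : ℝ} (hc : c ≠ 0) :
    Measure.QuasiMeasurePreserving (fun x : Rd d => c • x) volume volume := by
  refine ⟨(continuous_const_smul c).measurable, ?_⟩
  rw [Measure.map_addHaar_smul volume hc]
  exact Measure.smul_absolutelyContinuous

theorem exists_dilate_L2 {c : ℝ} (hc : c ≠ 0) (f : L2 d) :
    ∃ g : L2 d, g =ᵐ[volume] fun x => f (c • x) := by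
  have h1 : MemLp (fun x : Rd d => f (c • x)) 2 volume := by
    refine MemLp.comp_of_map (f := fun x : Rd d => c • x) (g := f) ?_
      (continuous_const_smul c).measurable.aemeasurable
    rw [Measure.map_addHaar_smul volume hc]
    exact (Lp.memLp f).smul_measure ENNReal.ofReal_ne_top
  exact ⟨h1.toLp, h1.coeFn_toLp⟩

theorem inner_dilate_L2 {c : ℝ} {v g v' g' : L2 d}
    (hv : v' =ᵐ[volume] fun x => v (c • x)) (hg : g' =ᵐ[volume] fun x => g (c • x)) :
    ⟪v', g'⟫_ℂ = ((|(c ^ d)⁻¹| : ℝ) : ℂ) * ⟪v, g⟫_ℂ := by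
  rw [L2.inner_def, L2.inner_def]
  have h1 : ∫ x, ⟪v' x, g' x⟫_ℂ = ∫ x, ⟪v (c • x), g (c • x)⟫_ℂ := by
    refine integral_congr_ae ?_
    filter_upwards [hv, hg] with x h1 h2
    rw [h1, h2]
  rw [h1, Measure.integral_comp_smul volume (fun x => ⟪v x, g x⟫_ℂ) c, finrank_euclideanSpace_fin,
    Complex.real_smul]

theorem isOrthogonalProjection_dilate_iff {V : ℤ → Submodule ℂ (L2 d)} (hV : IsMRA V) (m : ℤ)
    {f u f' u' : L2 d} (hf : f' =ᵐ[volume] fun x => f ((2 : ℝ) • x))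
    (hu : u' =ᵐ[volume] fun x => u ((2 : ℝ) • x)) :
    IsOrthogonalProjection (V m) f u ↔ IsOrthogonalProjection (V (m + 1)) f' u' := by
  have h2 : (2 : ℝ) ≠ 0 := two_ne_zero
  have hg : (f' - u' : L2 d) =ᵐ[volume] fun x => (f - u : L2 d) ((2 : ℝ) • x) := by
    have h3 := (quasiMeasurePreserving_smul_Rd (d := d) h2).ae_eq_comp (Lp.coeFn_sub f u)
    filter_upwards [hf, hu, Lp.coeFn_sub f' u', h3] with x a1 a2 a3 a4
    rw [a3, Pi.sub_apply, a1, a2]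
    exact a4.symm
  have hc : ((|((2 : ℝ) ^ d)⁻¹| : ℝ) : ℂ) ≠ 0 := by
    simp
  refine and_congr (hV.dilation m u u' hu) ?_
  rw [Submodule.mem_orthogonal, Submodule.mem_orthogonal]
  constructor
  · intro H v' hv'
    obtain ⟨v, hv⟩ := exists_dilate_L2 (inv_ne_zero h2) v'
    have hv2 : v' =ᵐ[volume] fun x => v ((2 : ℝ) • x) := by
      have h3 := (quasiMeasurePreserving_smul_Rd (d := d) h2).ae_eq_comp hv
      filter_upwards [h3] with x a1
      refine Eq.trans ?_ a1.symm
      simp only [Function.comp_apply]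
      rw [inv_smul_smul₀ h2]
    rw [inner_dilate_L2 hv2 hg, H v ((hV.dilation m v v' hv2).2 hv'), mul_zero]
  · intro H v hv
    obtain ⟨v', hv'⟩ := exists_dilate_L2 h2 v
    have h3 := H v' ((hV.dilation m v v' hv').1 hv)
    rw [inner_dilate_L2 hv' hg] at h3
    exact (mul_eq_zero.1 h3).resolve_left hc

/-- The number `2^m`, as a unit. -/
noncomputable def twoPow (m : ℤ) : ℝˣ := Units.mk0 (2 : ℝ) two_ne_zero ^ m

@[simp] theorem coe_twoPow (m : ℤ) : (twoPow m : ℝ) = 2 ^ m := by simp [twoPow]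

theorem twoPow_add (m n : ℤ) : twoPow (m + n) = twoPow m * twoPow n := zpow_add _ _ _

theorem dilate_dilate (c c' : ℝˣ) (f : 𝓢(Rd d, ℂ)) :
    dilate c (dilate c' f) = dilate (c' * c) f := by
  ext x
  simp [smul_smul]

@[simp] theorem dilate_twoPow_zero (f : 𝓢(Rd d, ℂ)) : dilate (twoPow 0) f = f := by
  ext x
  simp

theorem toLp_dilate_ae (m : ℤ) (f : 𝓢(Rd d, ℂ)) :
    (dilate (twoPow (m + 1)) f).toLp 2 volume =ᵐ[volume]
      fun x => (dilate (twoPow m) f).toLp 2 volume ((2 : ℝ) • x) := by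
  have h1 := (quasiMeasurePreserving_smul_Rd (d := d) two_ne_zero).ae_eq_comp
    ((dilate (twoPow m) f).coeFn_toLp 2 volume)
  filter_upwards [(dilate (twoPow (m + 1)) f).coeFn_toLp 2 volume, h1] with x a1 a2
  rw [a1]
  refine Eq.trans ?_ a2.symm
  simp only [dilate_apply, Function.comp_apply, coe_twoPow, smul_smul]
  rw [zpow_add_one₀ two_ne_zero]

theorem isOrthogonalProjection_dilate {V : ℤ → Submodule ℂ (L2 d)} (hV : IsMRA V)
    {f u : 𝓢(Rd d, ℂ)} (h : IsOrthogonalProjection (V 0) (f.toLp 2 volume) (u.toLp 2 volume))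
    (m : ℤ) : IsOrthogonalProjection (V m) ((dilate (twoPow m) f).toLp 2 volume)
      ((dilate (twoPow m) u).toLp 2 volume) := by
  have step := fun m : ℤ =>
    isOrthogonalProjection_dilate_iff hV m (toLp_dilate_ae m f) (toLp_dilate_ae m u)
  induction m using Int.induction_on with
  | zero => simpa using h
  | succ n ih => exact (step n).1 ih
  | pred n ih => exact (step (-n - 1)).2 (by simpa using ih)

/-- The orthonormal expansion of a Schwartz function, if it converges in the Schwartz space. -/
theorem isOrthogonalProjection_of_hasSum {V : ℤ → Submodule ℂ (L2 d)} {φ f F : 𝓢(Rd d, ℂ)}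
    (hφ : IsScalingFunction V φ)
    (hF : HasSum (fun k => (∫ y, f y * conjugate φ (y - latticePoint k)) •
      translate (latticePoint k) φ) F) :
    IsOrthogonalProjection (V 0) (f.toLp 2 volume) (F.toLp 2 volume) := by
  obtain ⟨e, he, horth, hspan⟩ := hφ
  have hek : ∀ k, (translate (latticePoint k) φ).toLp 2 volume = e k := fun k =>
    Lp.ext (((translate (latticePoint k) φ).coeFn_toLp 2 volume).trans (he k).symm)
  have hsum : HasSum (fun k => (∫ y, f y * conjugate φ (y - latticePoint k)) • e k)
      (F.toLp 2 volume) := by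
    have := hF.mapL (SchwartzMap.toLpCLM ℂ ℂ 2 (volume : Measure (Rd d)))
    refine this.congr_fun fun k => ?_
    rw [map_smul, ← hek]
    rfl
  have hmem : ∀ k, e k ∈ Submodule.span ℂ (Set.range e) := fun k => Submodule.subset_span ⟨k, rfl⟩
  rw [IsOrthogonalProjection, ← hspan, Submodule.orthogonal_closure]
  refine ⟨?_, ?_⟩
  · exact (Submodule.isClosed_topologicalClosure _).mem_of_tendsto hsum
      (Eventually.of_forall fun s => Submodule.le_topologicalClosure _ <|
        Submodule.sum_mem _ fun k _ => Submodule.smul_mem _ _ (hmem k))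
  · have hle : Submodule.span ℂ (Set.range e) ≤
        (Submodule.span ℂ {f.toLp 2 volume - F.toLp 2 volume})ᗮ := by
      rw [Submodule.span_le]
      rintro _ ⟨n, rfl⟩
      rw [SetLike.mem_coe, Submodule.mem_orthogonal_singleton_iff_inner_left, inner_sub_right,
        sub_eq_zero]
      have h1 : ⟪e n, f.toLp 2 volume⟫_ℂ = ∫ y, f y * conjugate φ (y - latticePoint n) := by
        rw [← hek, SchwartzMap.inner_toL2_toL2_eq _ _ volume]
        rfl
      have h2 := hsum.mapL (innerSL ℂ (e n))
      have h3 := hasSum_single (f := fun k => innerSL ℂ (e n)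
        ((∫ y, f y * conjugate φ (y - latticePoint k)) • e k)) n fun k hk => by
          rw [map_smul, innerSL_apply_apply, horth.2 hk.symm, smul_zero]
      have h4 := h2.unique h3
      rw [map_smul, innerSL_apply_apply, innerSL_apply_apply, inner_self_eq_norm_sq_to_K,
        horth.1 n] at h4
      rw [h1, h4]
      simp
    exact (Submodule.mem_orthogonal _ _).2 fun v hv =>
      Submodule.mem_orthogonal_singleton_iff_inner_left.1 (hle hv)

end Projection

/-! ### Taylor polynomials integrated against a decaying kernel -/

section Taylor

variable {d : ℕ} {b h C : ℝ} {K : Rd d → ℂ}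

/-- The constant in the decay of `‖w‖^p K(w)` grows like `p!^b`, up to a geometric factor. -/
theorem HasDecay.pow_mul (hb : 1 ≤ b) (hh : 0 < h) (hK : HasDecay b h C K) (p : ℕ) :
    HasDecay b (h / 2 ^ b) (C * ((p.factorial : ℝ) ^ b / (h / 2 ^ b) ^ p))
      fun w => ((‖w‖ ^ p : ℝ) : ℂ) * K w := by
  intro w
  have h₁ : 0 < h / 2 ^ b := by positivity
  have hw := wt_pos hb h₁.le (norm_nonneg w)
  have e1 := pow_le_wt hb h₁.le (norm_nonneg w) p
  have e2 := wt_div_sq_le hb hh.le (norm_nonneg w)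
  have hf := factorial_rpow_pos b p
  rw [mul_pow] at e1
  rw [norm_mul, Complex.norm_real, Real.norm_of_nonneg (by positivity), mul_div_assoc',
    le_div_iff₀ (by positivity)]
  calc _ = ((h / 2 ^ b) ^ p * ‖w‖ ^ p) * (‖K w‖ * wt b (h / 2 ^ b) ‖w‖) := by ring
    _ ≤ ((p.factorial : ℝ) ^ b * wt b (h / 2 ^ b) ‖w‖) * (‖K w‖ * wt b (h / 2 ^ b) ‖w‖) := by gcongr
    _ = (p.factorial : ℝ) ^ b * (‖K w‖ * (wt b (h / 2 ^ b) ‖w‖ * wt b (h / 2 ^ b) ‖w‖)) := by ring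
    _ ≤ (p.factorial : ℝ) ^ b * (‖K w‖ * wt b h ‖w‖) := by gcongr
    _ ≤ (p.factorial : ℝ) ^ b * C := by
        have := hK w
        gcongr
    _ = _ := mul_comm _ _

theorem HasDecay.integrable_pow_mul (hb : 1 ≤ b) (hh : 0 < h) (hK : HasDecay b h C K)
    (hc : Continuous K) (p : ℕ) : Integrable fun w => ‖w‖ ^ p * ‖K w‖ := by
  have := ((hK.pow_mul hb hh p).integrable hb (by positivity) (by fun_prop)).norm
  refine this.congr (Eventually.of_forall fun w => ?_)
  simp

theorem HasDecay.integrable_monomial_mul (hb : 1 ≤ b) (hh : 0 < h) (hK : HasDecay b h C K)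
    (hc : Continuous K) (β : Fin d → ℕ) : Integrable fun w => K w * (monomial β w : ℂ) := by
  refine (hK.integrable_pow_mul hb hh hc (∑ i, β i)).mono' ?_ (Eventually.of_forall fun w => ?_)
  · unfold monomial
    exact Continuous.aestronglyMeasurable (by fun_prop)
  · rw [norm_mul, Complex.norm_real, mul_comm]
    exact mul_le_mul_of_nonneg_right (abs_monomial_le β w) (norm_nonneg _)

/-- The polynomial `∑_{|β| = j} (j! / β!) M_β X^β`, where `M_β` is the moment of order `β` of `K`.
The corresponding differential operator maps `f` to the integral of the `j`-th directional
derivatives `∂_w^j f` against `K(w)`, see `polyDeriv_momentPoly`. -/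
noncomputable def momentPoly (K : Rd d → ℂ) (j : ℕ) : MvPolynomial (Fin d) ℂ :=
  ∑ β ∈ Finset.piAntidiag Finset.univ j,
    MvPolynomial.C ((Nat.multinomial Finset.univ β : ℂ) * ∫ w, K w * (monomial β w : ℂ)) *
      ∏ i, MvPolynomial.X i ^ β i

theorem integrable_mul_dirDeriv_pow (hb : 1 ≤ b) (hh : 0 < h) (hK : HasDecay b h C K)
    (hc : Continuous K) (j : ℕ) (f : 𝓢(Rd d, ℂ)) (x : Rd d) :
    Integrable fun w => (dirDeriv w ^ j) f x * K w := by
  simp only [dirDeriv_pow_apply, Finset.sum_mul]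
  refine integrable_finsetSum _ fun β _ => ?_
  refine ((hK.integrable_monomial_mul hb hh hc β).const_mul
    ((Nat.multinomial Finset.univ β : ℂ) * partialDeriv β f x)).congr
    (Eventually.of_forall fun w => ?_)
  ring

theorem polyDeriv_momentPoly (hb : 1 ≤ b) (hh : 0 < h) (hK : HasDecay b h C K)
    (hc : Continuous K) (j : ℕ) (f : 𝓢(Rd d, ℂ)) (x : Rd d) :
    polyDeriv (momentPoly K j) f x = ∫ w, (dirDeriv w ^ j) f x * K w := by
  simp only [dirDeriv_pow_apply, Finset.sum_mul]
  have hint : ∀ β : Fin d → ℕ, Integrable fun w =>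
      (Nat.multinomial Finset.univ β : ℂ) * (monomial β w : ℂ) * partialDeriv β f x * K w :=
    fun β => ((hK.integrable_monomial_mul hb hh hc β).const_mul
      ((Nat.multinomial Finset.univ β : ℂ) * partialDeriv β f x)).congr
      (Eventually.of_forall fun w => by ring)
  rw [integral_finsetSum _ fun β _ => hint β, momentPoly, map_sum, sum_apply, sum_apply]
  refine Finset.sum_congr rfl fun β _ => ?_
  rw [map_mul, ← partialDeriv_eq_polyDeriv, ← MvPolynomial.algebraMap_eq, AlgHom.commutes,
    Algebra.algebraMap_eq_smul_one, smul_mul_assoc, one_mul, smul_apply, smul_apply, smul_eq_mul,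
    mul_right_comm, ← integral_const_mul]
  exact integral_congr_ae (Eventually.of_forall fun w => by ring)

/-- Taylor's formula, integrated against `K`. -/
theorem norm_integral_sub_taylor_le (hb : 1 ≤ b) (hh : 0 < h) (hK : HasDecay b h C K)
    (hc : Continuous K) (f : 𝓢(Rd d, ℂ)) (x : Rd d) (ε : ℝ) (n : ℕ) {g : Rd d → ℝ}
    (hg : Integrable g) (hle : ∀ w, ‖f (x + ε • w) - ∑ j ∈ Finset.range (n + 1),
      ((ε ^ j / j.factorial : ℝ) : ℂ) * (dirDeriv w ^ j) f x‖ * ‖K w‖ ≤ g w) :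
    ‖(∫ w, f (x + ε • w) * K w) - ∑ j ∈ Finset.range (n + 1),
      ((ε ^ j / j.factorial : ℝ) : ℂ) * polyDeriv (momentPoly K j) f x‖ ≤ ∫ w, g w := by
  have hf : Integrable fun w => f (x + ε • w) * K w :=
    (hK.integrable hb hh hc).bdd_mul
      (f.continuous.comp (by fun_prop : Continuous fun w : Rd d => x + ε • w)).aestronglyMeasurable
      (Eventually.of_forall fun w => f.norm_le_seminorm ℂ _)
  have hj : ∀ j : ℕ, Integrable fun w =>
      ((ε ^ j / j.factorial : ℝ) : ℂ) * ((dirDeriv w ^ j) f x * K w) := fun j =>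
    (integrable_mul_dirDeriv_pow hb hh hK hc j f x).const_mul _
  have e1 : ∑ j ∈ Finset.range (n + 1),
      ((ε ^ j / j.factorial : ℝ) : ℂ) * polyDeriv (momentPoly K j) f x =
      ∫ w, ∑ j ∈ Finset.range (n + 1),
        ((ε ^ j / j.factorial : ℝ) : ℂ) * ((dirDeriv w ^ j) f x * K w) := by
    rw [integral_finsetSum _ fun j _ => hj j]
    exact Finset.sum_congr rfl fun j _ => by
      rw [polyDeriv_momentPoly hb hh hK hc, integral_const_mul]
  rw [e1, ← integral_sub hf (integrable_finsetSum _ fun j _ => hj j)]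
  refine norm_integral_le_of_norm_le hg
    (Eventually.of_forall fun w => le_trans (le_of_eq ?_) (hle w))
  rw [← norm_mul, sub_mul, Finset.sum_mul]
  simp only [mul_assoc]

end Taylor

/-! ### The moments of the derivatives of the reproducing kernel -/

section Moments

variable {d : ℕ} {a b h C : ℝ}

/-- The kernel of `∂^α ∘ Q`, where `Q` is the operator with kernel `q₀`, centred at `u`. -/
noncomputable def centredKernel (φ : 𝓢(Rd d, ℂ)) (α : Fin d → ℕ) (u w : Rd d) : ℂ :=
  kernelSum (partialDeriv α φ) (conjugate φ) u (u + w)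

theorem centredKernel_add_latticePoint (φ : 𝓢(Rd d, ℂ)) (α : Fin d → ℕ) (u w : Rd d)
    (l : Fin d → ℤ) : centredKernel φ α (u + latticePoint l) w = centredKernel φ α u w := by
  rw [centredKernel, add_right_comm, kernelSum_add_latticePoint]
  rfl

theorem exists_hasDecay_centredKernel (hb : 1 ≤ b) (hh : 0 < h) (d : ℕ) :
    ∃ S : ℝ, 0 < S ∧ ∀ (φ : 𝓢(Rd d, ℂ)) (a C : ℝ), IsGSBound a b h C φ → ∀ α u,
      HasDecay b (h / 2 ^ b / 2) (C * ((∑ i, α i).factorial : ℝ) ^ a / h ^ (∑ i, α i) * C * S)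
        (centredKernel φ α u) := by
  obtain ⟨S, hS, H⟩ := exists_norm_kernelSum_le (d := d) hb hh
  refine ⟨S, hS, fun φ a C hφ α u w => ?_⟩
  have h1 := (H _ _ _ _ (hφ.hasDecay hh α) hφ.conjugate.hasDecay_zero u (u + w)).2
  rwa [add_sub_cancel_left, ← div_eq_mul_inv, le_div_iff₀ (wt_pos hb (by positivity)
    (norm_nonneg w))] at h1

theorem continuous_centredKernel (hb : 1 ≤ b) (hh : 0 < h) {φ : 𝓢(Rd d, ℂ)}
    (hφ : IsGSBound a b h C φ) (α : Fin d → ℕ) (u : Rd d) : Continuous (centredKernel φ α u) :=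
  (continuous_kernelSum hb hh (hφ.hasDecay hh α) hφ.conjugate.hasDecay_zero
    (conjugate φ).continuous u).comp (continuous_const.add continuous_id)

theorem IsOrthogonalProjection.eq_of_mem {W : Submodule ℂ (L2 d)} {f u : L2 d}
    (hu : IsOrthogonalProjection W f u) (hf : f ∈ W) : u = f := by
  have h1 : f - u ∈ W ⊓ Wᗮ := ⟨W.sub_mem hf hu.1, hu.2⟩
  rw [Submodule.inf_orthogonal_eq_bot, Submodule.mem_bot, sub_eq_zero] at h1
  exact h1.symm

/-- Since `V 0 ⊆ V m`, the scaling function is reproduced by the projections onto `V m`, `m ≥ 0`.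
After rescaling, the dilates of the scaling function are reproduced by the kernel `q₀`. -/
theorem partialDeriv_eq_integral_centredKernel {V : ℤ → Submodule ℂ (L2 d)} (hV : IsMRA V)
    {φ : 𝓢(Rd d, ℂ)} (hφ : IsScalingFunction V φ) (ha : 0 ≤ a) (hb : 1 ≤ b) (hh : 0 < h)
    (hφb : IsGSBound a b h C φ) (m : ℕ) (α : Fin d → ℕ) (u : Rd d) :
    (((2⁻¹ ^ m) ^ (∑ i, α i) : ℝ) : ℂ) * partialDeriv α φ ((2⁻¹ ^ m : ℝ) • u) =
      ∫ w, φ ((2⁻¹ ^ m : ℝ) • u + (2⁻¹ ^ m : ℝ) • w) * centredKernel φ α u w := by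
  set g := dilate (twoPow (-m)) φ
  have hg : ∃ h' > 0, IsGSBound a b h' C g := by
    have h2 : (0 : ℝ) < 2 ^ (-m : ℤ) := by positivity
    refine ⟨min (h * 2 ^ (-m : ℤ)) (h / 2 ^ (-m : ℤ)), by positivity, ?_⟩
    refine hφb.dilate (by simp) hb (by positivity) hh.le ?_ ?_
    · rw [coe_twoPow, ← le_div_iff₀ h2]
      exact min_le_right _ _
    · rw [coe_twoPow]
      exact min_le_left _ _
  obtain ⟨h', h0', hg⟩ := hg
  have hmin : 0 < min h h' := lt_min hh h0'
  have hη : HasDecay b (min h h') C (conjugate φ) :=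
    (hφb.mono hb hmin.le (min_le_left _ _)).conjugate.hasDecay_zero
  obtain ⟨_, _, S, HS⟩ := exists_hasSum_translate d ha hb hmin
  obtain ⟨e, he⟩ := exists_eq_translate ha hb hh hφb
  obtain ⟨F, -, hF, -⟩ := HS φ (conjugate φ) g e C C C (hφb.mono hb hmin.le (min_le_left _ _)) hη
    (hg.mono hb hmin.le (min_le_right _ _)).hasDecay_zero he
  have hproj := isOrthogonalProjection_dilate hV (isOrthogonalProjection_of_hasSum hφ hF) m
  have hgm : dilate (twoPow m) g = φ := by
    rw [dilate_dilate, ← twoPow_add]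
    simp
  have hmem : φ.toLp 2 volume ∈ V m := by
    obtain ⟨e, he, -, hspan⟩ := hφ
    have h1 : φ.toLp 2 volume = e 0 := by
      refine Lp.ext ((φ.coeFn_toLp 2 volume).trans ((he 0).trans ?_).symm)
      refine Eventually.of_forall fun x => ?_
      have h0 : latticePoint (0 : Fin d → ℤ) = 0 := by ext i; simp
      simp only [h0, sub_zero]
    refine hV.monotone (by positivity : (0 : ℤ) ≤ m) ?_
    rw [h1, ← hspan]
    exact Submodule.le_topologicalClosure _ (Submodule.subset_span ⟨0, rfl⟩)
  rw [hgm] at hproj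
  have hFφ : dilate (twoPow m) F.toSchwartz = φ :=
    SchwartzMap.injective_toLp 2 volume (hproj.eq_of_mem hmem)
  have hFg : F.toSchwartz = g := by
    change _ = dilate (twoPow (-m)) φ
    rw [← hFφ, dilate_dilate, ← twoPow_add, add_neg_cancel, dilate_twoPow_zero]
  have key := partialDeriv_eq_integral_kernelSum hb hmin
    (hφb.mono hb hmin.le (min_le_left _ _)) hη hF α u
  have hpow : ((twoPow (-m) : ℝˣ) : ℝ) = 2⁻¹ ^ m := by
    rw [coe_twoPow, zpow_neg, zpow_natCast, inv_pow]
  rw [hFg, partialDeriv_dilate, smul_apply, dilate_apply, hpow, smul_eq_mul] at key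
  rw [key, ← integral_add_left_eq_self _ u]
  refine integral_congr_ae (Eventually.of_forall fun w => ?_)
  simp only [g, dilate_apply, hpow, smul_add, centredKernel]

/-- The vanishing moments of the derivatives of the reproducing kernel: the Taylor expansion of
the identity `partialDeriv_eq_integral_centredKernel` at scale `2^{-m}`, along points `x_m → x`
with `2^m x_m ∈ u + ℤ^d`, has to hold term by term in the limit `m → ∞`. -/
theorem polyDeriv_momentPoly_scalingFunction {V : ℤ → Submodule ℂ (L2 d)} (hV : IsMRA V)
    {φ : 𝓢(Rd d, ℂ)} (hφ : IsScalingFunction V φ) (ha : 0 ≤ a) (hb : 1 ≤ b) (hh : 0 < h)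
    (hφb : IsGSBound a b h C φ) (α : Fin d → ℕ) (u : Rd d) (j : ℕ) (hj : j ≤ ∑ i, α i)
    (x : Rd d) :
    polyDeriv (momentPoly (centredKernel φ α u) j) φ x =
      if j = ∑ i, α i then (j.factorial : ℂ) * partialDeriv α φ x else 0 := by
  induction j using Nat.strong_induction_on generalizing x with
  | _ j ih =>
  set n := ∑ i, α i
  obtain ⟨S, -, HS⟩ := exists_hasDecay_centredKernel hb hh d
  have hK := HS φ a C hφb α u
  have hKc := continuous_centredKernel hb hh hφb α u
  have h₁ : 0 < h / 2 ^ b / 2 := by positivity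
  -- a bound for all derivatives of order `j + 1`
  set B := C * ((j + 1).factorial : ℝ) ^ a / h ^ (j + 1)
  have hB : ∀ γ : Fin d → ℕ, ∑ i, γ i = j + 1 → ∀ z, ‖partialDeriv γ φ z‖ ≤ B := by
    intro γ hγ z
    have := (hφb.hasDecay hh γ).norm_le' hb hh.le z
    rwa [hγ] at this
  have hgi : Integrable fun w => (d ^ (j + 1) * B / j.factorial) *
      (‖w‖ ^ (j + 1) * ‖centredKernel φ α u w‖) :=
    (hK.integrable_pow_mul hb h₁ hKc (j + 1)).const_mul _
  set I := ∫ w, (d ^ (j + 1) * B / j.factorial) * (‖w‖ ^ (j + 1) * ‖centredKernel φ α u w‖)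
  set ε : ℕ → ℝ := fun m => 2⁻¹ ^ m
  have hε : ∀ m, 0 < ε m := fun m => by positivity
  have hε0 : Tendsto ε atTop (𝓝 0) :=
    tendsto_pow_atTop_nhds_zero_of_lt_one (by norm_num) (by norm_num)
  -- points `y m → x` with `(ε m)⁻¹ y m ∈ u + ℤ^d`, where the kernel is the same as at `u`
  set l : ℕ → Fin d → ℤ := fun m => latticeFloor ((ε m)⁻¹ • x - u)
  set y : ℕ → Rd d := fun m => ε m • (u + latticePoint (l m))
  have hy : Tendsto y atTop (𝓝 x) := by
    rw [tendsto_iff_norm_sub_tendsto_zero]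
    refine squeeze_zero (fun m => norm_nonneg _) (fun m => ?_)
      (by simpa using hε0.mul_const (d : ℝ))
    have e1 : y m - x = -(ε m • (((ε m)⁻¹ • x - u) - latticePoint (l m))) := by
      simp only [y, smul_sub, smul_add, smul_inv_smul₀ (hε m).ne']
      abel
    rw [e1, norm_neg, norm_smul, Real.norm_of_nonneg (hε m).le]
    exact mul_le_mul_of_nonneg_left (norm_sub_latticeFloor_le _) (hε m).le
  -- the terms of order less than `j` vanish by induction; the others are divided by `(ε m)^j`
  have key : ∀ m, ‖((ε m ^ (n - j) : ℝ) : ℂ) * partialDeriv α φ (y m) -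
      ((j.factorial : ℝ)⁻¹ : ℂ) * polyDeriv (momentPoly (centredKernel φ α u) j) φ (y m)‖ ≤
      ε m * I := by
    intro m
    have h1 := norm_integral_sub_taylor_le hb h₁ hK hKc φ (y m) (ε m) j
      (hgi.const_mul (ε m ^ (j + 1))) fun w => by
        refine (mul_le_mul_of_nonneg_right (norm_sub_taylor_le φ (y m) w (ε m) j
          fun γ hγ τ _ => hB γ hγ _) (norm_nonneg _)).trans (le_of_eq ?_)
        rw [abs_of_pos (hε m), mul_pow, mul_pow]
        ring
    rw [integral_const_mul] at h1
    have h2 := partialDeriv_eq_integral_centredKernel hV hφ ha hb hh hφb m α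
      (u + latticePoint (l m))
    simp only [centredKernel_add_latticePoint] at h2
    rw [Finset.sum_range_succ, Finset.sum_eq_zero fun i hi => ?_, zero_add] at h1
    · have hpos : (0 : ℝ) < ε m ^ j := pow_pos (hε m) j
      refine le_of_mul_le_mul_left ?_ hpos
      refine le_trans (le_of_eq ?_) (h1.trans (le_of_eq ?_))
      · have e2 : ∀ z : ℂ, ε m ^ j * ‖z‖ = ‖((ε m ^ j : ℝ) : ℂ) * z‖ := fun z => by
          rw [norm_mul, Complex.norm_real, Real.norm_of_nonneg hpos.le]
        rw [show (∫ w, φ (y m + ε m • w) * centredKernel φ α u w) = _ from h2.symm, e2, mul_sub]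
        congr 2
        · rw [← mul_assoc, ← Complex.ofReal_mul, ← pow_add, Nat.add_sub_cancel' hj]
        · push_cast
          ring
      · ring
    · have hi' : i < j := Finset.mem_range.1 hi
      rw [ih i hi' (hi'.le.trans hj), if_neg (by omega), mul_zero]
  have lim1 : Tendsto (fun m => ((ε m ^ (n - j) : ℝ) : ℂ) * partialDeriv α φ (y m) -
      ((j.factorial : ℝ)⁻¹ : ℂ) * polyDeriv (momentPoly (centredKernel φ α u) j) φ (y m))
      atTop (𝓝 0) := by
    rw [tendsto_zero_iff_norm_tendsto_zero]
    exact squeeze_zero (fun m => norm_nonneg _) key (by simpa using hε0.mul_const I)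
  have lim2 := (((Complex.continuous_ofReal.tendsto 0).comp hε0).pow (n - j)).mul
    (((partialDeriv α φ).continuous.tendsto x).comp hy) |>.sub
    ((((polyDeriv (momentPoly (centredKernel φ α u) j) φ).continuous.tendsto x).comp hy).const_mul
      ((j.factorial : ℝ)⁻¹ : ℂ))
  have heq := tendsto_nhds_unique lim1 (lim2.congr fun m => by simp)
  have hfac : ((j.factorial : ℝ) : ℂ) ≠ 0 := by exact_mod_cast j.factorial_ne_zero
  have heq' := eq_of_sub_eq_zero heq.symm
  rw [eq_comm, inv_mul_eq_iff_eq_mul₀ hfac] at heq'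
  rw [heq']
  split_ifs with hjn
  · subst hjn
    simp
  · have : n - j ≠ 0 := by omega
    simp [this]

/-- The moment conditions for the scaling function hold for all Schwartz functions, since a
constant coefficient differential operator that annihilates the scaling function is zero. -/
theorem polyDeriv_momentPoly_centredKernel {V : ℤ → Submodule ℂ (L2 d)} (hV : IsMRA V)
    {φ : 𝓢(Rd d, ℂ)} (hφ : IsScalingFunction V φ) (ha : 0 ≤ a) (hb : 1 ≤ b) (hh : 0 < h)
    (hφb : IsGSBound a b h C φ) (α : Fin d → ℕ) (u : Rd d) (j : ℕ) (hj : j ≤ ∑ i, α i)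
    (f : 𝓢(Rd d, ℂ)) (x : Rd d) :
    polyDeriv (momentPoly (centredKernel φ α u) j) f x =
      if j = ∑ i, α i then (j.factorial : ℂ) * partialDeriv α f x else 0 := by
  have hne : φ ≠ 0 := by
    rintro rfl
    obtain ⟨e, he, horth, -⟩ := hφ
    have h1 : e 0 = 0 := Lp.ext (((he 0).trans (by simp; rfl)).trans
      (Lp.coeFn_zero ℂ 2 volume).symm)
    have h2 := horth.1 0
    rw [h1, norm_zero] at h2
    exact zero_ne_one h2
  set p : MvPolynomial (Fin d) ℂ := if j = ∑ i, α i then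
    MvPolynomial.C (j.factorial : ℂ) * ∏ i, MvPolynomial.X i ^ α i else 0
  have hp : ∀ (g : 𝓢(Rd d, ℂ)) (z : Rd d), polyDeriv p g z =
      if j = ∑ i, α i then (j.factorial : ℂ) * partialDeriv α g z else 0 := by
    intro g z
    simp only [p]
    split_ifs with hjn
    · rw [map_mul, ← partialDeriv_eq_polyDeriv, ← MvPolynomial.algebraMap_eq, AlgHom.commutes,
        Algebra.algebraMap_eq_smul_one, smul_mul_assoc, one_mul]
      rfl
    · simp
  have hzero : polyDeriv (momentPoly (centredKernel φ α u) j - p) φ = 0 := by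
    ext z
    rw [map_sub, sub_apply, sub_apply, hp,
      polyDeriv_momentPoly_scalingFunction hV hφ ha hb hh hφb α u j hj z, sub_self]
    rfl
  rw [sub_eq_zero.1 (eq_zero_of_polyDeriv_eq_zero hne hzero), hp]

end Moments

/-! ### The rate of convergence in a single step -/

section Rate

variable {d : ℕ}

theorem factorial_rpow_le {ρ r s : ℝ} (hr : 0 ≤ r) (hs : ρ + r - 1 = s) (n : ℕ) :
    (n.factorial : ℝ) ^ ρ * ((n + 1).factorial : ℝ) ^ r / n.factorial ≤
      (2 ^ r) ^ n * (n.factorial : ℝ) ^ s := by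
  have hN : (0 : ℝ) < n.factorial := by exact_mod_cast n.factorial_pos
  have h1 : ((n : ℝ) + 1) ^ r ≤ (2 ^ r) ^ n := by
    rw [← Real.rpow_natCast, ← Real.rpow_mul (by norm_num), mul_comm, Real.rpow_mul (by norm_num),
      Real.rpow_natCast]
    refine Real.rpow_le_rpow (by positivity) ?_ hr
    exact_mod_cast Nat.lt_two_pow_self
  rw [Nat.factorial_succ, Nat.cast_mul, Real.mul_rpow (by positivity) (by positivity)]
  push_cast
  calc _ = ((n : ℝ) + 1) ^ r * (n.factorial : ℝ) ^ s := by
        rw [← hs, Real.rpow_sub hN, Real.rpow_add hN, Real.rpow_one]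
        ring
    _ ≤ _ := by gcongr

/-- The projections onto `V m` converge on each step, with rate `2^{-m}`. The loss of `σ` in the
regularity index comes from the three factorials in the remainder of Taylor's formula:
`n!^ρ₁` from the derivatives of the kernel, `(n + 1)!^ρ₂` from its moments of order `n + 1`,
and `1 / n!`. -/
theorem exists_isGSBound_sub {ρ₁ ρ₂ σ s t h C : ℝ} (hρ₁ : 0 ≤ ρ₁) (hρ₂ : 1 < ρ₂)
    (hσ : σ = ρ₁ + ρ₂ - 1) (hs : σ ≤ s) (ht : ρ₂ ≤ t) {V : ℤ → Submodule ℂ (L2 d)} (hV : IsMRA V)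
    {φ : 𝓢(Rd d, ℂ)} (hφ : IsScalingFunction V φ) (hh : 0 < h) (hφb : IsGSBound ρ₁ ρ₂ h C φ)
    {hf : ℝ} (hf0 : 0 < hf) :
    ∃ h' > 0, ∃ S : ℝ, ∀ (f : 𝓢(Rd d, ℂ)) (Cf : ℝ), IsGSBound (s - σ) t hf Cf f →
      ∀ (m : ℕ) (F : 𝓢(Rd d, ℂ)),
        HasSum (fun k => (∫ y, dilate (twoPow (-m)) f y * conjugate φ (y - latticePoint k)) •
          translate (latticePoint k) φ) F →
        IsGSBound s t h' (2⁻¹ ^ m * (S * Cf)) (dilate (twoPow m) F - f) := by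
  have hb : 1 ≤ ρ₂ := hρ₂.le
  have ht1 : 1 ≤ t := hb.trans ht
  have h2b : (0 : ℝ) < 2 ^ ρ₂ := by positivity
  obtain ⟨S₀, hS₀, HS₀⟩ := exists_hasDecay_centredKernel hb hh d
  -- parameters of the weights for the kernel, the kernel times a power, and the latter with the
  -- square root of its decay spent on the growth of `f`
  set h₁ := h / 2 ^ ρ₂ / 2
  set h₂ := h₁ / 2 ^ ρ₂
  set h₃ := h₂ / 2 ^ ρ₂
  have p₁ : 0 < h₁ := by positivity
  have p₂ : 0 < h₂ := by positivity
  have p₃ : 0 < h₃ := by positivity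
  obtain ⟨K₃, hK₃, HK₃⟩ := exists_inv_wt_le hb p₃ (d + 1)
  have hC : 0 ≤ C := hφb.nonneg hb hh.le
  -- the parameter of `f` may be decreased, so that its weight is beaten by that of the kernel
  set k := min hf h₃
  have hk : 0 < k := lt_min hf0 p₃
  set J := K₃ * ∫ w : Rd d, ((1 + ‖w‖) ^ (d + 1))⁻¹
  have hJ : 0 ≤ J := mul_nonneg hK₃.le (integral_nonneg fun w => by positivity)
  set r := s - σ + ρ₂
  have hr : 0 ≤ r := by simp only [r]; linarith
  set A := d / (k * h₂ * h) * 2 ^ r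
  have hA : 0 ≤ A := by positivity
  set h' := min (k / 2) (1 / (A + 1))
  have h0' : 0 < h' := by positivity
  refine ⟨h', h0', d / (k * h₂) * (C * C * S₀) * J, fun f Cf hfb m F hF => ?_⟩
  have hfk := hfb.mono ht1 hk.le (min_le_left _ _)
  have hCf : 0 ≤ Cf := hfb.nonneg ht1 hf0.le
  set ε : ℝ := 2⁻¹ ^ m
  have hε : 0 < ε := by positivity
  have hε1 : ε ≤ 1 := pow_le_one₀ (by norm_num) (by norm_num)
  have hpow : ((twoPow (-m) : ℝˣ) : ℝ) = ε := by
    rw [coe_twoPow, zpow_neg, zpow_natCast, ← inv_pow]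
  have hpow' : ((twoPow m : ℝˣ) : ℝ) = ε⁻¹ := by
    rw [coe_twoPow, zpow_natCast, ← inv_pow, inv_inv]
  refine isGSBound_of_norm_le (A := A) ht1 h0' hA ?_ (by positivity) fun α x => ?_
  · refine (mul_le_mul_of_nonneg_right (min_le_right _ _) hA).trans ?_
    rw [one_div_mul_eq_div, div_le_one (by positivity)]
    linarith
  set n := ∑ i, α i
  set u := ε⁻¹ • x with hu
  have hεu : ε • u = x := by rw [hu, smul_inv_smul₀ hε.ne']
  have hK := HS₀ φ ρ₁ C hφb α u
  have hKc := continuous_centredKernel hb hh hφb α u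
  have hfn := factorial_rpow_pos ρ₁ n
  have hfn' := factorial_rpow_pos ρ₂ (n + 1)
  have hfn'' := factorial_rpow_pos (s - σ) (n + 1)
  have hwx := wt_pos ht1 (by positivity : 0 ≤ k / 2) (norm_nonneg x)
  -- the derivatives of order `n + 1` of `f` near `x`, up to the weight of the distance to `x`
  set D := Cf * ((n + 1).factorial : ℝ) ^ (s - σ) / k ^ (n + 1) * (wt t (k / 2) ‖x‖)⁻¹
  have hD : 0 ≤ D := by positivity
  have hBf : ∀ (w : Rd d) (γ : Fin d → ℕ), ∑ i, γ i = n + 1 → ∀ τ ∈ Set.Icc (0 : ℝ) 1,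
      ‖partialDeriv γ f (x + τ • ε • w)‖ ≤ D * wt t k ‖w‖ := by
    intro w γ hγ τ hτ
    have h1 := hfk.norm_le ht1 hk γ (x + τ • ε • w)
    rw [hγ] at h1
    refine h1.trans ?_
    have hw := wt_pos ht1 hk.le (norm_nonneg w)
    have hw' := wt_pos ht1 hk.le (norm_nonneg (x + τ • ε • w))
    have h2 : wt t (k / 2) ‖x‖ ≤ wt t k ‖x + τ • ε • w‖ * wt t k ‖w‖ := by
      refine wt_half_le_mul ht1 hk.le (norm_nonneg _) (norm_nonneg _) (norm_nonneg _) ?_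
      have h3 : ‖τ • ε • w‖ ≤ ‖w‖ := by
        rw [smul_smul, norm_smul, Real.norm_of_nonneg (mul_nonneg hτ.1 hε.le)]
        exact mul_le_of_le_one_left (norm_nonneg _) (mul_le_one₀ hτ.2 hε.le hε1)
      have h4 := norm_sub_le (x + τ • ε • w) (τ • ε • w)
      rw [add_sub_cancel_right] at h4
      linarith
    simp only [D]
    rw [mul_assoc _ (wt t (k / 2) ‖x‖)⁻¹]
    refine mul_le_mul_of_nonneg_left ?_ (by positivity)
    rw [inv_mul_eq_div, le_div_iff₀ hwx, inv_mul_le_iff₀ hw']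
    exact h2
  set E := C * (n.factorial : ℝ) ^ ρ₁ / h ^ n * C * S₀ *
    (((n + 1).factorial : ℝ) ^ ρ₂ / h₂ ^ (n + 1))
  have hKw : ∀ w : Rd d, ‖w‖ ^ (n + 1) * ‖centredKernel φ α u w‖ * wt t k ‖w‖ ≤
      E * K₃ * ((1 + ‖w‖) ^ (d + 1))⁻¹ := by
    intro w
    have h1 := hK.pow_mul hb p₁ (n + 1) w
    rw [norm_mul, Complex.norm_real, Real.norm_of_nonneg (by positivity)] at h1
    have h2 := wt_div_sq_le hb p₂.le (norm_nonneg w)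
    have hw₃ := wt_pos hb p₃.le (norm_nonneg w)
    have h3 : wt t k ‖w‖ ≤ wt ρ₂ h₃ ‖w‖ := (wt_anti hb ht hk.le (norm_nonneg w)).trans
      (wt_mono hb (mul_nonneg hk.le (norm_nonneg w)) p₃.le (norm_nonneg w)
        (mul_le_mul_of_nonneg_right (min_le_right _ _) (norm_nonneg w)))
    have h4 : ‖w‖ ^ (n + 1) * ‖centredKernel φ α u w‖ * wt ρ₂ h₃ ‖w‖ ≤ E * (wt ρ₂ h₃ ‖w‖)⁻¹ := by
      rw [← div_eq_mul_inv, le_div_iff₀ hw₃, mul_assoc _ (wt ρ₂ h₃ ‖w‖)]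
      exact (mul_le_mul_of_nonneg_left h2 (by positivity)).trans h1
    calc _ ≤ ‖w‖ ^ (n + 1) * ‖centredKernel φ α u w‖ * wt ρ₂ h₃ ‖w‖ := by gcongr
      _ ≤ E * (wt ρ₂ h₃ ‖w‖)⁻¹ := h4
      _ ≤ E * (K₃ * ((1 + ‖w‖) ^ (d + 1))⁻¹) := by
          gcongr
          exact HK₃ _ (norm_nonneg w)
      _ = _ := by ring
  have hT := norm_integral_sub_taylor_le hb p₁ hK hKc f x ε n
    ((integrable_inv_one_add_norm_pow d).const_mul
      ((d * ε) ^ (n + 1) * D / n.factorial * (E * K₃))) fun w => by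
      refine (mul_le_mul_of_nonneg_right (norm_sub_taylor_le f x w ε n (hBf w))
        (norm_nonneg _)).trans ?_
      rw [abs_of_pos hε]
      calc _ = (d * ε) ^ (n + 1) * D / n.factorial *
            (‖w‖ ^ (n + 1) * ‖centredKernel φ α u w‖ * wt t k ‖w‖) := by
            rw [← mul_assoc (d : ℝ), mul_pow]
            ring
        _ ≤ (d * ε) ^ (n + 1) * D / n.factorial * (E * K₃ * ((1 + ‖w‖) ^ (d + 1))⁻¹) := by
            have := hKw w
            gcongr
        _ = _ := by ring
  rw [integral_const_mul] at hT
  -- by the moment conditions, only the term of order `n` of the Taylor polynomial survives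
  have hmom : ∑ j ∈ Finset.range (n + 1), ((ε ^ j / j.factorial : ℝ) : ℂ) *
      polyDeriv (momentPoly (centredKernel φ α u) j) f x =
      ((ε ^ n : ℝ) : ℂ) * partialDeriv α f x := by
    rw [Finset.sum_eq_single_of_mem n (Finset.self_mem_range_succ n)]
    · rw [polyDeriv_momentPoly_centredKernel hV hφ hρ₁ hb hh hφb α u n le_rfl, if_pos rfl,
        ← mul_assoc]
      congr 1
      have : (n.factorial : ℂ) ≠ 0 := by exact_mod_cast n.factorial_ne_zero
      push_cast
      field_simp
    · intro j hj hjn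
      rw [polyDeriv_momentPoly_centredKernel hV hφ hρ₁ hb hh hφb α u j
        (Nat.lt_succ_iff.1 (Finset.mem_range.1 hj)), if_neg hjn, mul_zero]
  have hFd : partialDeriv α F u = ∫ w, f (x + ε • w) * centredKernel φ α u w := by
    rw [partialDeriv_eq_integral_kernelSum hb hh hφb hφb.conjugate.hasDecay_zero hF α u,
      ← integral_add_left_eq_self _ u]
    refine integral_congr_ae (Eventually.of_forall fun w => ?_)
    simp only [dilate_apply, hpow, smul_add, hεu, centredKernel]
  -- the error is the remainder of order `n + 1` divided by `ε^n`, which leaves one factor `ε`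
  have hdiff : partialDeriv α (dilate (twoPow m) F - f) x = (((ε ^ n)⁻¹ : ℝ) : ℂ) *
      ((∫ w, f (x + ε • w) * centredKernel φ α u w) - ((ε ^ n : ℝ) : ℂ) * partialDeriv α f x) := by
    have hεn : ((ε ^ n : ℝ) : ℂ) ≠ 0 := by exact_mod_cast (pow_pos hε n).ne'
    rw [map_sub, sub_apply, partialDeriv_dilate, smul_apply, dilate_apply, hpow', smul_eq_mul,
      hFd, mul_sub, Complex.ofReal_inv, inv_mul_cancel_left₀ hεn, inv_pow, Complex.ofReal_inv]
  rw [hmom] at hT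
  rw [hdiff, norm_mul, Complex.norm_real, Real.norm_of_nonneg (by positivity)]
  refine (mul_le_mul_of_nonneg_left hT (by positivity)).trans ?_
  have hwle : (wt t (k / 2) ‖x‖)⁻¹ ≤ (wt t h' ‖x‖)⁻¹ :=
    inv_anti₀ (wt_pos ht1 h0'.le (norm_nonneg x)) (wt_mono ht1 (mul_nonneg h0'.le (norm_nonneg x))
      (by positivity) (norm_nonneg x)
      (mul_le_mul_of_nonneg_right (min_le_left _ _) (norm_nonneg x)))
  have hfac := factorial_rpow_le (ρ := ρ₁) hr (by simp only [r]; linarith : ρ₁ + r - 1 = s) n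
  have hsplit : ((n + 1).factorial : ℝ) ^ r =
      ((n + 1).factorial : ℝ) ^ (s - σ) * ((n + 1).factorial : ℝ) ^ ρ₂ :=
    Real.rpow_add (by exact_mod_cast (n + 1).factorial_pos) _ _
  calc _ = ε * (d / (k * h₂) * (C * C * S₀) * J * Cf) * (d / (k * h₂ * h)) ^ n *
        ((n.factorial : ℝ) ^ ρ₁ * ((n + 1).factorial : ℝ) ^ r / n.factorial) *
        (wt t (k / 2) ‖x‖)⁻¹ := by
        rw [hsplit]
        simp only [D, E, J, mul_pow, div_pow, pow_succ]
        field_simp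
    _ ≤ ε * (d / (k * h₂) * (C * C * S₀) * J * Cf) * (d / (k * h₂ * h)) ^ n *
        ((2 ^ r) ^ n * (n.factorial : ℝ) ^ s) * (wt t h' ‖x‖)⁻¹ := by gcongr
    _ = _ := by
        simp only [A, mul_pow]
        ring

end Rate

/-! ### The operators on Gelfand-Shilov spaces -/

section Operators

variable {d : ℕ} {a b r t h : ℝ}

theorem exists_dilation (d : ℕ) (ha : 0 ≤ a) (hb : 1 ≤ b) {c : ℝˣ} (hc : 0 < (c : ℝ)) :
    ∃ D : GelfandShilov a b d →L[ℂ] GelfandShilov a b d,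
      ∀ f, (D f).toSchwartz = dilate c f.toSchwartz := by
  have key : ∀ h : ℝ, 0 < h → ∃ h' > 0, ∀ (f : 𝓢(Rd d, ℂ)) (C : ℝ), IsGSBound a b h C f →
      IsGSBound a b h' C (dilate c f) := fun h hh => by
    have h0 : 0 < min (h / c) (h * c) := lt_min (by positivity) (by positivity)
    exact ⟨_, h0, fun f C hf => hf.dilate hc hb h0.le hh.le
      ((le_div_iff₀ hc).1 (min_le_left _ _)) (min_le_right _ _)⟩
  let T : GelfandShilov a b d →ₗ[ℂ] GelfandShilov a b d :=
    { toFun := fun f => ⟨dilate c f.toSchwartz, by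
        obtain ⟨h, hh, C, hf⟩ := (mem_gsSubmodule_iff ha hb).1 f.mem
        obtain ⟨h', h0, H⟩ := key h hh
        exact (mem_gsSubmodule_iff ha hb).2 ⟨h', h0, C, H _ C hf⟩⟩
      map_add' := fun f g => GelfandShilov.ext (map_add (dilate c) _ _)
      map_smul' := fun z f => GelfandShilov.ext (map_smul (dilate c) _ _) }
  refine ⟨⟨T, continuous_of_isGSBound ha hb ha hb T fun h hh => ?_⟩, fun f => rfl⟩
  obtain ⟨h', h0, H⟩ := key h hh
  exact ⟨h', h0, 1, fun f C hf => (one_mul C).symm ▸ H _ C hf⟩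

theorem integrable_mul_translate (f η : 𝓢(Rd d, ℂ)) (k : Rd d) :
    Integrable fun y => f y * η (y - k) :=
  (η.integrable.comp_sub_right k).bdd_mul f.continuous.aestronglyMeasurable
    (Eventually.of_forall fun y => f.norm_le_seminorm ℂ y)

/-- The operator with kernel `∑_k φ(x - k) η(y - k)`. -/
theorem exists_kernelOperator (hr : 0 ≤ r) (ha : 0 ≤ a) (ht : 1 ≤ t) (hh : 0 < h) {Cφ Cη : ℝ}
    {φ η : 𝓢(Rd d, ℂ)} (hφ : IsGSBound a t h Cφ φ) (hη : HasDecay t h Cη η)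
    {e : (Fin d → ℤ) → GelfandShilov a t d}
    (he : ∀ k, (e k).toSchwartz = translate (latticePoint k) φ) :
    ∃ T : GelfandShilov r t d →L[ℂ] GelfandShilov a t d, ∀ f,
      HasSum (fun k => (∫ y, f y * η (y - latticePoint k)) • e k) (T f) ∧
      HasSum (fun k => (∫ y, f y * η (y - latticePoint k)) • translate (latticePoint k) φ)
        (T f).toSchwartz := by
  have key : ∀ h₁ : ℝ, 0 < h₁ → ∃ h' > 0, ∃ K : ℝ, ∀ (f : 𝓢(Rd d, ℂ)) (C : ℝ),
      IsGSBound r t h₁ C f → ∃ F : GelfandShilov a t d,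
        HasSum (fun k => (∫ y, f y * η (y - latticePoint k)) • e k) F ∧
        HasSum (fun k => (∫ y, f y * η (y - latticePoint k)) • translate (latticePoint k) φ)
          F.toSchwartz ∧ IsGSBound a t h' (K * C) F.toSchwartz := fun h₁ hh₁ => by
    have h0 : 0 < min h h₁ := lt_min hh hh₁
    obtain ⟨h', h0', S, HS⟩ := exists_hasSum_translate d ha ht h0
    refine ⟨h', h0', S * (Cφ * Cη), fun f C hf => ?_⟩
    obtain ⟨F, hF₁, hF₂, hF₃⟩ := HS φ η f e Cφ Cη C (hφ.mono ht h0.le (min_le_left _ _))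
      (hη.mono ht h0.le (min_le_left _ _) le_rfl)
      (hf.hasDecay_zero.mono ht h0.le (min_le_right _ _) le_rfl) he
    exact ⟨F, hF₁, hF₂, hF₃.mono_right (le_of_eq (by ring))⟩
  have hex : ∀ f : GelfandShilov r t d, ∃ F : GelfandShilov a t d,
      HasSum (fun k => (∫ y, f y * η (y - latticePoint k)) • e k) F ∧
      HasSum (fun k => (∫ y, f y * η (y - latticePoint k)) • translate (latticePoint k) φ)
        F.toSchwartz := fun f => by
    obtain ⟨h₁, hh₁, C, hf⟩ := (mem_gsSubmodule_iff hr ht).1 f.mem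
    obtain ⟨h', -, K, H⟩ := key h₁ hh₁
    obtain ⟨F, hF₁, hF₂, -⟩ := H _ C hf
    exact ⟨F, hF₁, hF₂⟩
  choose T hT₁ hT₂ using hex
  let L : GelfandShilov r t d →ₗ[ℂ] GelfandShilov a t d :=
    { toFun := T
      map_add' := fun f g => by
        refine GelfandShilov.ext ((hT₂ (f + g)).unique
          (((hT₂ f).add (hT₂ g)).congr_fun fun k => ?_))
        rw [← add_smul, ← integral_add (integrable_mul_translate _ _ _)
          (integrable_mul_translate _ _ _)]
        simp [add_mul]
      map_smul' := fun z f => by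
        refine GelfandShilov.ext ((hT₂ (z • f)).unique
          (((hT₂ f).const_smul z).congr_fun fun k => ?_))
        rw [← smul_assoc, smul_eq_mul, ← integral_const_mul]
        simp [mul_assoc] }
  refine ⟨⟨L, continuous_of_isGSBound hr ht ha ht L fun h₁ hh₁ => ?_⟩, fun f => ⟨hT₁ f, hT₂ f⟩⟩
  obtain ⟨h', h0', K, H⟩ := key h₁ hh₁
  refine ⟨h', h0', K, fun f C hf => ?_⟩
  obtain ⟨F, -, hF₂, hF₃⟩ := H _ C hf
  rwa [← (hT₂ f).unique hF₂] at hF₃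

end Operators

/-! ### Transposition -/

/-- Termwise integration, including the integrability of the sum. -/
theorem integrable_of_hasSum {ι α : Type*} [Countable ι] [MeasurableSpace α] {μ : Measure α}
    {F : ι → α → ℂ} {G : α → ℂ} (hF : ∀ i, Integrable (F i) μ)
    (hs : Summable fun i => ∫ x, ‖F i x‖ ∂μ) (hG : ∀ x, HasSum (fun i => F i x) (G x)) :
    Integrable G μ ∧ HasSum (fun i => ∫ x, F i x ∂μ) (∫ x, G x ∂μ) := by
  classical
  have hG' : G = fun x => ∑' i, F i x := funext fun x => (hG x).tsum_eq.symm
  refine ⟨⟨?_, ?_⟩, hG' ▸ hasSum_integral_of_summable_integral_norm hF hs⟩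
  · exact aestronglyMeasurable_of_tendsto_ae (atTop : Filter (Finset ι))
      (f := fun s x => ∑ i ∈ s, F i x)
      (fun s => Finset.aestronglyMeasurable_fun_sum s fun i _ => (hF i).1)
      (Eventually.of_forall fun x => hG x)
  · have h1 : ∫⁻ x, ‖G x‖ₑ ∂μ ≤ ∑' i, ∫⁻ x, ‖F i x‖ₑ ∂μ := by
      rw [← lintegral_tsum fun i => (hF i).1.enorm, hG']
      exact lintegral_mono fun x => enorm_tsum_le_tsum_enorm
    refine h1.trans_lt (lt_top_iff_ne_top.2 ?_)
    simp only [← ofReal_integral_norm_eq_lintegral_enorm (hF _)]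
    exact hs.tsum_ofReal_ne_top

section Transpose

variable {d : ℕ} {a r t h : ℝ}

/-- The transpose of the operator with kernel `∑_k η(x - k) φ(y - k)` is given by the
evaluation of functionals at the sections of the kernel. -/
theorem apply_kernelOperator_eq_integral (hr : 0 ≤ r) (ha : 0 ≤ a) (ht : 1 ≤ t) (hh : 0 < h)
    {Cφ Cη : ℝ} {φ η : 𝓢(Rd d, ℂ)} (hφ : HasDecay t h Cφ φ) (hη : IsGSBound a t h Cη η)
    {e : (Fin d → ℤ) → GelfandShilov a t d}
    (he : ∀ k, (e k).toSchwartz = translate (latticePoint k) η)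
    {K : Rd d → GelfandShilov a t d}
    (hK : ∀ u, HasSum (fun k => φ (u - latticePoint k) • e k) (K u)) (f : GSDual a t d)
    (g : GelfandShilov r t d) {G : GelfandShilov a t d}
    (hG : HasSum (fun k => (∫ y, g y * φ (y - latticePoint k)) • e k) G) :
    Integrable (fun u => f (K u) * g u) ∧ f G = ∫ u, f (K u) * g u := by
  obtain ⟨h₀, hh₀, Cg, hg⟩ := (mem_gsSubmodule_iff hr ht).1 g.mem
  have p₀ : 0 < min h h₀ := lt_min hh hh₀
  obtain ⟨J, hJ, HJ⟩ := exists_integral_norm_mul_le d ht p₀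
  have h2 : (1 : ℝ) ≤ 2 ^ t := Real.one_le_rpow (by norm_num) (by linarith)
  set h₁ := min h h₀ / 2 ^ t / 2
  have p₁ : 0 < h₁ := by positivity
  set h₂ := h₁ / 2 ^ t
  have p₂ : 0 < h₂ := by positivity
  have hle : h₂ ≤ h := (div_le_self p₁.le h2).trans ((half_le_self (by positivity)).trans
    ((div_le_self p₀.le h2).trans (min_le_left _ _)))
  obtain ⟨M, hM, HM⟩ := exists_norm_apply_le f ha ht (by positivity : 0 < h₂ / 2)
  obtain ⟨S, hS, HS⟩ := exists_tsum_inv_wt_le d ht p₂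
  have hfe : ∀ k, ‖f (e k)‖ ≤ M * (Cη * wt t h₂ ‖latticePoint k‖) := fun k => HM _ _ <| by
    rw [he]
    exact (hη.mono ht p₂.le hle).translate ht p₂.le _
  have hCη := hη.nonneg ht hh.le
  have hgd := hg.hasDecay_zero.mono ht p₀.le (min_le_right h h₀) le_rfl
  have hφd := hφ.mono ht p₀.le (min_le_left h h₀) le_rfl
  have hCg := hgd.nonneg ht p₀.le
  have hCφ := hφd.nonneg ht p₀.le
  have hint := integrable_of_hasSum (μ := (volume : Measure (Rd d)))
    (F := fun k u => f (e k) * (g u * φ (u - latticePoint k))) (G := fun u => f (K u) * g u)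
    (fun k => (integrable_mul_translate g.toSchwartz φ (latticePoint k)).const_mul _) ?_ fun u => ?_
  · refine ⟨hint.1, ?_⟩
    have h1 := hG.mapL f
    refine h1.unique (hint.2.congr_fun fun k => ?_)
    rw [map_smul, integral_const_mul, smul_eq_mul, mul_comm]
  · refine ((HS 0).1.mul_left (M * Cη * (Cg * Cφ * J))).of_nonneg_of_le
      (fun k => integral_nonneg fun u => norm_nonneg _) fun k => ?_
    simp only [norm_mul (f (e k))]
    rw [integral_const_mul, zero_sub, norm_neg]
    have q₁ := wt_pos ht p₁.le (norm_nonneg (latticePoint k))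
    have q₂ := wt_pos ht p₂.le (norm_nonneg (latticePoint k))
    have h4 := wt_div_sq_le ht p₁.le (norm_nonneg (latticePoint k))
    calc _ ≤ M * (Cη * wt t h₂ ‖latticePoint k‖) *
          (Cg * Cφ * J * (wt t h₁ ‖latticePoint k‖)⁻¹) :=
          mul_le_mul (hfe k) (HJ _ _ _ _ hgd hφd k) (integral_nonneg fun u => norm_nonneg _)
            (by positivity)
      _ = M * Cη * (Cg * Cφ * J) * (wt t h₂ ‖latticePoint k‖ / wt t h₁ ‖latticePoint k‖) := by
          rw [div_eq_mul_inv]; ring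
      _ ≤ _ := by
          gcongr
          rw [div_le_iff₀ q₁, ← div_le_iff₀' (by positivity), div_inv_eq_mul]
          exact h4
  · refine (((hK u).mapL f).mul_right (g u)).congr_fun fun k => ?_
    rw [map_smul, smul_eq_mul]
    ring

end Transpose

/-! ### Strong convergence of functionals -/

section Dual

variable {d : ℕ} {a b : ℝ}

/-- If the functionals `F m` converge to `G` with a common rate on each step, they converge in the
strong topology: a suitable multiple of the supremum of the differences is a seminorm that is
continuous on each step, so that it is bounded on bounded sets. -/
theorem tendsto_dual_of_isGSBound (ha : 0 ≤ a) (hb : 1 ≤ b) {F : ℕ → GSDual a b d}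
    {G : GSDual a b d} {c : ℕ → ℝ} (hc0 : ∀ m, 0 < c m) (hc : Tendsto c atTop (𝓝 0))
    (H : ∀ h : ℝ, 0 < h → ∃ K : ℝ, ∀ (m : ℕ) (f : GelfandShilov a b d) (C : ℝ),
      IsGSBound a b h C f.toSchwartz → ‖F m f - G f‖ ≤ c m * (K * C)) :
    Tendsto F atTop (𝓝 G) := by
  set p : ℕ → Seminorm ℂ (GelfandShilov a b d) := fun m =>
    (c m)⁻¹.toNNReal • (normSeminorm ℂ ℂ).comp (F m - G).toLinearMap
  have hp : ∀ m f, p m f = (c m)⁻¹ * ‖F m f - G f‖ := fun m f => by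
    rw [smul_apply, NNReal.smul_def, Real.coe_toNNReal _ (inv_pos.2 (hc0 m)).le]
    rfl
  have hle : ∀ h : ℝ, 0 < h → ∃ K : ℝ, ∀ (f : GelfandShilov a b d) (C : ℝ),
      IsGSBound a b h C f.toSchwartz → ∀ m, p m f ≤ K * C := fun h hh => by
    obtain ⟨K, hK⟩ := H h hh
    refine ⟨K, fun f C hf m => ?_⟩
    rw [hp, inv_mul_le_iff₀ (hc0 m)]
    exact hK m f C hf
  have hbdd : BddAbove (Set.range p) := by
    rw [Seminorm.bddAbove_range_iff]
    intro f
    obtain ⟨h, hh, C, hf⟩ := (mem_gsSubmodule_iff ha hb).1 f.mem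
    obtain ⟨K, hK⟩ := hle h hh
    refine ⟨K * C, ?_⟩
    rintro _ ⟨m, rfl⟩
    exact hK f C hf m
  have hq : (⨆ m, p m) ∈ stepContinuousSeminorms a b d :=
    mem_stepContinuousSeminorms_of_le ha hb fun h hh => by
      obtain ⟨K, hK⟩ := hle h hh
      refine ⟨K, fun f C hf => ?_⟩
      rw [Seminorm.iSup_apply hbdd]
      exact ciSup_le fun m => hK f C hf m
  refine (UniformConvergenceCLM.tendsto_iff_tendstoUniformlyOn (RingHom.id ℂ) ℂ
    {S | Bornology.IsVonNBounded ℂ S}).2 ?_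
  intro S hS
  obtain ⟨r, hr, hSr⟩ := ((gs_withSeminorms a b d).isVonNBounded_iff_seminorm_bounded).1 hS
    ⟨_, hq⟩
  rw [Metric.tendstoUniformlyOn_iff]
  intro ε hε
  have h1 : Tendsto (fun m => c m * r) atTop (𝓝 0) := by simpa using hc.mul_const r
  filter_upwards [h1.eventually_lt_const hε] with m hm f hf
  rw [dist_eq_norm, norm_sub_rev]
  have h2 : p m f ≤ r := by
    refine le_trans ?_ (hSr f hf).le
    change _ ≤ (⨆ m, p m) f
    rw [Seminorm.iSup_apply hbdd]
    have h3 := Seminorm.bddAbove_range_iff.1 hbdd f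
    exact le_ciSup h3 m
  rw [hp, inv_mul_le_iff₀ (hc0 m)] at h2
  exact h2.trans_lt hm

end Dual

section Conjugate

variable {d : ℕ}

theorem hasSum_conjugate {ι : Type*} {f : ι → 𝓢(Rd d, ℂ)} {F : 𝓢(Rd d, ℂ)}
    (hF : HasSum f F) : HasSum (fun i => conjugate (f i)) (conjugate F) :=
  hF.mapL (SchwartzMap.postcompCLM (Complex.conjCLE : ℂ →L[ℝ] ℂ))

/-- The rate of convergence for the transposed operators, which are the conjugates of the
projections since these are self-adjoint. -/
theorem exists_isGSBound_sub_conjugate {ρ₁ ρ₂ σ s t h C : ℝ} (hρ₁ : 0 ≤ ρ₁) (hρ₂ : 1 < ρ₂)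
    (hσ : σ = ρ₁ + ρ₂ - 1) (hs : σ ≤ s) (ht : ρ₂ ≤ t) {V : ℤ → Submodule ℂ (L2 d)} (hV : IsMRA V)
    {φ : 𝓢(Rd d, ℂ)} (hφ : IsScalingFunction V φ) (hh : 0 < h) (hφb : IsGSBound ρ₁ ρ₂ h C φ)
    {hf : ℝ} (hf0 : 0 < hf) :
    ∃ h' > 0, ∃ S : ℝ, ∀ (f : 𝓢(Rd d, ℂ)) (Cf : ℝ), IsGSBound (s - σ) t hf Cf f →
      ∀ (m : ℕ) (F : 𝓢(Rd d, ℂ)),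
        HasSum (fun k => (∫ y, dilate (twoPow (-m)) f y * φ (y - latticePoint k)) •
          translate (latticePoint k) (conjugate φ)) F →
        IsGSBound s t h' (2⁻¹ ^ m * (S * Cf)) (dilate (twoPow m) F - f) := by
  obtain ⟨h', h0', S, HS⟩ := exists_isGSBound_sub hρ₁ hρ₂ hσ hs ht hV hφ hh hφb hf0
  refine ⟨h', h0', S, fun f Cf hf m F hF => ?_⟩
  have h1 := (HS (conjugate f) Cf hf.conjugate m (conjugate F) ?_).conjugate
  · convert h1 using 1
    ext x
    simp
  · refine (hasSum_conjugate hF).congr_fun fun k => ?_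
    ext x
    simp only [conjugate_apply, smul_apply, translate_apply, smul_eq_mul, map_mul,
      RingHomCompTriple.comp_apply, RingHom.id_apply]
    rw [← integral_conj]
    simp only [map_mul, dilate_apply, conjugate_apply]

end Conjugate

/-! ### Scaling -/

section Scaling

variable {d : ℕ}

theorem integral_zpow_mul_comp_smul (m : ℤ) {G : Rd d → ℂ} (hG : Integrable G) :
    Integrable (fun y => (2 : ℂ) ^ (m * (d : ℤ)) * G ((2 : ℝ) ^ m • y)) ∧
      ∫ y, (2 : ℂ) ^ (m * (d : ℤ)) * G ((2 : ℝ) ^ m • y) = ∫ y, G y := by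
  have h2 : (2 : ℝ) ^ m ≠ 0 := by positivity
  refine ⟨(hG.comp_smul h2).const_mul _, ?_⟩
  rw [integral_const_mul, Measure.integral_comp_smul volume G, finrank_euclideanSpace_fin,
    abs_of_pos (by positivity), Complex.real_smul, ← mul_assoc]
  have h3 : (2 : ℂ) ^ (m * (d : ℤ)) * (((((2 : ℝ) ^ m) ^ d)⁻¹ : ℝ) : ℂ) = 1 := by
    push_cast
    rw [zpow_mul, zpow_natCast]
    exact mul_inv_cancel₀ (pow_ne_zero _ (zpow_ne_zero _ two_ne_zero))
  rw [h3, one_mul]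

theorem dilate_twoPow_dilate_neg (m : ℤ) (f : 𝓢(Rd d, ℂ)) :
    dilate (twoPow m) (dilate (twoPow (-m)) f) = f := by
  rw [dilate_dilate, ← twoPow_add, neg_add_cancel, dilate_twoPow_zero]

end Scaling

/-! ### Convergence of multiresolution expansions -/

section Expansion

variable {d : ℕ} {ρ₁ ρ₂ σ s t h C : ℝ} {V : ℤ → Submodule ℂ (L2 d)} {φ : 𝓢(Rd d, ℂ)}

/-- The projection of `f` onto `V m` is obtained by applying the operator with kernel `q₀` between
dilations by `2^{-m}` and `2^m`, and converges with rate `2^{-m}`. -/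
theorem exists_expansion (hρ₁ : 0 ≤ ρ₁) (hρ₂ : 1 < ρ₂)
    (hσ : σ = ρ₁ + ρ₂ - 1) (hs : σ ≤ s) (ht : ρ₂ ≤ t) (hV : IsMRA V)
    (hφ : IsScalingFunction V φ) (hh : 0 < h) (hφb : IsGSBound ρ₁ ρ₂ h C φ)
    (f : GelfandShilov (s - σ) t d) :
    ∃ q : ℤ → GelfandShilov s t d,
      (∀ m, IsOrthogonalProjection (V m)
        (f.toSchwartz.toLp 2 volume) ((q m).toSchwartz.toLp 2 volume)) ∧
      (∀ m x, Integrable (fun y => f y * kernel φ m x y) ∧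
        q m x = ∫ y, f y * kernel φ m x y) ∧
      Tendsto q atTop (𝓝 (inclusion (sub_le_of_regular hρ₁ hρ₂ hσ s) le_rfl f)) := by
  have hr : 0 ≤ s - σ := sub_nonneg.2 hs
  have hs0 : 0 ≤ s := by linarith
  have ht1 : 1 ≤ t := hρ₂.le.trans ht
  have hφst : IsGSBound s t h C φ := hφb.index_mono hρ₂.le hh.le (by linarith) ht
  have hη : HasDecay t h C (conjugate φ) := hφst.conjugate.hasDecay_zero
  obtain ⟨e, he⟩ := exists_eq_translate hs0 ht1 hh hφst
  obtain ⟨T, hT⟩ := exists_kernelOperator hr hs0 ht1 hh hφst hη he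
  have hpow : ∀ m : ℤ, 0 < ((twoPow m : ℝˣ) : ℝ) := fun m => by
    rw [coe_twoPow]
    positivity
  choose D hD using fun m : ℤ => exists_dilation d hs0 ht1 (hpow m)
  choose D' hD' using fun m : ℤ => exists_dilation d hr ht1 (hpow m)
  have hq : ∀ m : ℤ, HasSum (fun k => (∫ y, dilate (twoPow (-m)) f.toSchwartz y *
      conjugate φ (y - latticePoint k)) • translate (latticePoint k) φ)
      (T (D' (-m) f)).toSchwartz := fun m => by
    have h1 := (hT (D' (-m) f)).2
    rwa [hD'] at h1
  refine ⟨fun m => D m (T (D' (-m) f)), fun m => ?_, fun m x => ?_, ?_⟩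
  · have h1 := isOrthogonalProjection_dilate hV (isOrthogonalProjection_of_hasSum hφ (hq m)) m
    rwa [dilate_twoPow_dilate_neg, ← hD] at h1
  · set u := (2 : ℝ) ^ m • x
    have h1 := (integrable_mul_kernelSum ht1 hh hφst.hasDecay_zero hη (conjugate φ).continuous
      (dilate (twoPow (-m)) f.toSchwartz).continuous (fun x => SchwartzMap.norm_le_seminorm ℂ _ x)
      u).1
    have h2 := partialDeriv_eq_integral_kernelSum ht1 hh hφst hη (hq m) 0 u
    obtain ⟨h3, h4⟩ := integral_zpow_mul_comp_smul m h1
    have h5 : (fun y => (2 : ℂ) ^ (m * (d : ℤ)) *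
        (dilate (twoPow (-m)) f.toSchwartz ((2 : ℝ) ^ m • y) *
          kernelSum φ (conjugate φ) u ((2 : ℝ) ^ m • y))) = fun y => f y * kernel φ m x y := by
      funext y
      have h6 := congrArg (fun g : 𝓢(Rd d, ℂ) => g y) (dilate_twoPow_dilate_neg m f.toSchwartz)
      simp only [dilate_apply (twoPow m), coe_twoPow] at h6
      rw [h6, kernel, kernelZero_eq_kernelSum]
      ring
    rw [h5] at h3 h4
    refine ⟨h3, ?_⟩
    rw [h4, hD, dilate_apply, coe_twoPow]
    simpa only [partialDeriv_zero, one_apply_eq_self] using h2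
  · obtain ⟨h₁, hh₁, C₁, hf⟩ := (mem_gsSubmodule_iff hr ht1).1 f.mem
    obtain ⟨h', h0', S, HS⟩ := exists_isGSBound_sub hρ₁ hρ₂ hσ hs ht hV hφ hh hφb hh₁
    rw [← Nat.map_cast_int_atTop, tendsto_map'_iff]
    refine tendsto_of_isGSBound hs0 ht1 h0' (C := fun m => 2⁻¹ ^ m * (S * C₁)) ?_
      (Eventually.of_forall fun m => ?_)
    · simpa using (tendsto_pow_atTop_nhds_zero_of_lt_one (r := (2⁻¹ : ℝ)) (by norm_num)
        (by norm_num)).mul_const (S * C₁)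
    · have h1 := HS f.toSchwartz C₁ hf m _ (hq m)
      rw [toSchwartz_inclusion, Function.comp_apply, hD]
      exact h1

/-- The functional `q_m f` is the composition of `f` with the transpose of the projection onto
`V m`, so that the rate of convergence for test functions is inherited in the strong topology. -/
theorem exists_dual_expansion (hρ₁ : 0 ≤ ρ₁) (hρ₂ : 1 < ρ₂)
    (hσ : σ = ρ₁ + ρ₂ - 1) (hs : σ ≤ s) (ht : ρ₂ ≤ t) (hV : IsMRA V)
    (hφ : IsScalingFunction V φ) (hh : 0 < h) (hφb : IsGSBound ρ₁ ρ₂ h C φ) :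
    ∃ K : ℤ → Rd d → GelfandShilov s t d,
      (∀ m x y, K m x y = kernel φ m x y) ∧
      ∀ f : GSDual s t d,
        ∃ F : ℤ → GSDual (s - σ) t d,
          (∀ m (ψ : GelfandShilov (s - σ) t d),
            Integrable (fun x => f (K m x) * ψ x) ∧ F m ψ = ∫ x, f (K m x) * ψ x) ∧
          Tendsto F atTop
            (𝓝 (f.comp (inclusion (sub_le_of_regular hρ₁ hρ₂ hσ s) le_rfl))) := by
  have hr : 0 ≤ s - σ := sub_nonneg.2 hs
  have hs0 : 0 ≤ s := by linarith
  have ht1 : 1 ≤ t := hρ₂.le.trans ht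
  have hφst : IsGSBound s t h C φ := hφb.index_mono hρ₂.le hh.le (by linarith) ht
  have hη : IsGSBound s t h C (conjugate φ) := hφst.conjugate
  obtain ⟨e, he⟩ := exists_eq_translate hs0 ht1 hh hη
  obtain ⟨T, hT⟩ := exists_kernelOperator hr hs0 ht1 hh hη hφst.hasDecay_zero he
  have hpow : ∀ m : ℤ, 0 < ((twoPow m : ℝˣ) : ℝ) := fun m => by
    rw [coe_twoPow]
    positivity
  choose D hD using fun m : ℤ => exists_dilation d hs0 ht1 (hpow m)
  choose D' hD' using fun m : ℤ => exists_dilation d hr ht1 (hpow m)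
  -- the sections of the kernel `q₀`, as elements of the Gelfand-Shilov space
  have hsec : ∀ u : Rd d, ∃ F : GelfandShilov s t d,
      HasSum (fun k => φ (u - latticePoint k) • e k) F ∧
      HasSum (fun k => φ (u - latticePoint k) • translate (latticePoint k) (conjugate φ))
        F.toSchwartz := fun u => by
    have hh2 : 0 < h / 2 := half_pos hh
    obtain ⟨h', -, S, HS⟩ := exists_hasSum_smul_translate d hs0 ht1 hh2
    obtain ⟨F, hF₁, hF₂, -⟩ := HS (conjugate φ) e C (C * wt t h ‖u‖)
      (fun k => φ (u - latticePoint k)) (hη.mono ht1 hh2.le (half_le_self hh.le)) he fun k => by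
        have q₁ := wt_pos ht1 hh2.le (norm_nonneg (latticePoint k))
        have q₂ := wt_pos ht1 hh.le (norm_nonneg (u - latticePoint k))
        have h1 := wt_half_le_mul ht1 hh.le (norm_nonneg (latticePoint k)) (norm_nonneg u)
          (norm_nonneg (u - latticePoint k)) (by simpa using norm_sub_le u (u - latticePoint k))
        have h2 := hφst.hasDecay_zero (u - latticePoint k)
        rw [← div_eq_mul_inv, le_div_iff₀ q₁]
        have q₃ := wt_pos ht1 hh.le (norm_nonneg u)
        calc _ ≤ ‖φ (u - latticePoint k)‖ * (wt t h ‖u‖ * wt t h ‖u - latticePoint k‖) := by gcongr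
          _ = ‖φ (u - latticePoint k)‖ * wt t h ‖u - latticePoint k‖ * wt t h ‖u‖ := by ring
          _ ≤ _ := by gcongr
    exact ⟨F, hF₁, hF₂⟩
  choose K₀ hK₀ hK₀' using hsec
  refine ⟨fun m x => (2 : ℂ) ^ (m * (d : ℤ)) • D m (K₀ ((2 : ℝ) ^ m • x)), fun m x y => ?_,
    fun f => ⟨fun m => (f.comp (D m)).comp (T.comp (D' (-m))), fun m ψ => ?_, ?_⟩⟩
  · have h1 := (hasSum_apply (hK₀' ((2 : ℝ) ^ m • x)) ((2 : ℝ) ^ m • y)).tsum_eq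
    rw [GelfandShilov.toSchwartz_smul, smul_apply, hD, dilate_apply, coe_twoPow, kernel,
      smul_eq_mul, ← h1]
    rfl
  · obtain ⟨h1, h2⟩ := apply_kernelOperator_eq_integral hr hs0 ht1 hh hφst.hasDecay_zero hη he hK₀
      (f.comp (D m)) (D' (-m) ψ) (hT (D' (-m) ψ)).1
    obtain ⟨h3, h4⟩ := integral_zpow_mul_comp_smul m h1
    have h5 : (fun x => (2 : ℂ) ^ (m * (d : ℤ)) * ((f.comp (D m)) (K₀ ((2 : ℝ) ^ m • x)) *
        (D' (-m) ψ) ((2 : ℝ) ^ m • x))) =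
        fun x => f ((2 : ℂ) ^ (m * (d : ℤ)) • D m (K₀ ((2 : ℝ) ^ m • x))) * ψ x := by
      funext x
      have h6 := congrArg (fun g : 𝓢(Rd d, ℂ) => g x) (dilate_twoPow_dilate_neg m ψ.toSchwartz)
      simp only [dilate_apply (twoPow m), coe_twoPow] at h6
      rw [hD', h6, map_smul, smul_eq_mul, ContinuousLinearMap.comp_apply, mul_assoc]
    rw [h5] at h3 h4
    exact ⟨h3, h2.trans h4.symm⟩
  · rw [← Nat.map_cast_int_atTop, tendsto_map'_iff]
    refine tendsto_dual_of_isGSBound hr ht1 (c := fun m => 2⁻¹ ^ m) (fun m => by positivity)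
      (tendsto_pow_atTop_nhds_zero_of_lt_one (by norm_num) (by norm_num)) fun h₁ hh₁ => ?_
    obtain ⟨h', h0', S, HS⟩ := exists_isGSBound_sub_conjugate hρ₁ hρ₂ hσ hs ht hV hφ hh hφb hh₁
    obtain ⟨M, -, HM⟩ := exists_norm_apply_le f hs0 ht1 h0'
    refine ⟨M * S, fun m ψ C₁ hψ => ?_⟩
    have h1 := (hT (D' (-m) ψ)).2
    rw [hD'] at h1
    have h2 := HM (D m (T (D' (-m) ψ)) - inclusion (sub_le_of_regular hρ₁ hρ₂ hσ s) le_rfl ψ)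
      (2⁻¹ ^ m * (S * C₁)) (by
        have h3 := HS ψ.toSchwartz C₁ hψ m _ h1
        rw [← hD] at h3
        exact h3)
    rw [map_sub] at h2
    refine h2.trans (le_of_eq ?_)
    ring

end Expansion

end GelfandShilovMRA

open GelfandShilovMRA in
theorem mainTheorem1 {d : ℕ} (ρ₁ ρ₂ σ s t : ℝ) (hρ₁ : 0 ≤ ρ₁) (hρ₂ : 1 < ρ₂)
    (hσ : σ = ρ₁ + ρ₂ - 1) (hs : σ ≤ s) (ht : ρ₂ ≤ t)
    (V : ℤ → Submodule ℂ (L2 d)) (hV : IsMRA V)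
    (φ : GelfandShilov ρ₁ ρ₂ d) (hφ : IsScalingFunction V φ) :
    -- (i) convergence of the multiresolution expansions of test functions
    (∀ f : GelfandShilov (s - σ) t d,
      ∃ q : ℤ → GelfandShilov s t d,
        (∀ m, IsOrthogonalProjection (V m)
          (f.toSchwartz.toLp 2 volume) ((q m).toSchwartz.toLp 2 volume)) ∧
        (∀ m x, Integrable (fun y => f y * kernel φ m x y) ∧
          q m x = ∫ y, f y * kernel φ m x y) ∧
        Tendsto q atTop (𝓝 (inclusion (sub_le_of_regular hρ₁ hρ₂ hσ s) le_rfl f))) ∧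
    -- (ii) convergence of the multiresolution expansions of ultradistributions
    ∃ K : ℤ → Rd d → GelfandShilov s t d,
      (∀ m x y, K m x y = kernel φ m x y) ∧
      ∀ f : GSDual s t d,
        ∃ F : ℤ → GSDual (s - σ) t d,
          (∀ m (ψ : GelfandShilov (s - σ) t d),
            Integrable (fun x => f (K m x) * ψ x) ∧ F m ψ = ∫ x, f (K m x) * ψ x) ∧
          Tendsto F atTop
            (𝓝 (f.comp (inclusion (sub_le_of_regular hρ₁ hρ₂ hσ s) le_rfl))) := by
  obtain ⟨h, hh, C, hφb⟩ := (mem_gsSubmodule_iff hρ₁ hρ₂.le).1 φ.mem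
  exact ⟨exists_expansion hρ₁ hρ₂ hσ hs ht hV hφ hh hφb,
    exists_dual_expansion hρ₁ hρ₂ hσ hs ht hV hφ hh hφb⟩
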